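/- Boolean circuits have fan-in at most $2$ gates over $\{\wedge,\vee,\neg,0,1\}$; the size of a Boolean circuit is its number of nodes, inputs included. An $n$-input Boolean circuit $C$ defines the set system $\mathcal F_C=\{S\subseteq[n] : C(\chi_S)=1\}$, where $\chi_S$ is the characteristic vector of $S$. Suppose there is a deterministic polynomial-time algorithm that takes as input $(m,n)$ in unary and outputs a collection of weight functions $w_1,\dots,w_t:[n]\to[2n]=\{1,\dots,2n\}$ such that for each Boolean circuit $C$ of size $m$ with $n$ inputs and $\mathcal F_C\neq\emptyset$ there is some $w_i$ with respect to which $\mathcal F_C$ has a unique minimum weight set (the weight of $S$ being $\sum_{u\in S}w_i(u)$). Let $\mathbb F$ be the field of rational numbers or any finite field. Then there is a family of polynomials $f_n\in\mathbb F\{x_1,\dots,x_n\}$, $n\ge 0$, in noncommuting variables $x_1,\dots,x_n$, with $f_n$ a linear combination of the $n^n$ monomials $x_{i_1}x_{i_2}\cdots x_{i_n}$ of degree $n$, such that: 1. (explicitness) a single deterministic algorithm, given $n$ in unary, writes down $f_n$ as a list of coefficients and monomials in time $2^{n^{O(1)}}$; 2. (hardness) $f_n$ does not have noncommutative arithmetic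 circuits of size $2^{o(n\lg n)}$: for every function $s:\mathbb N\to\mathbb N$ with $\lg s(n)=o(n\lg n)$, for all but finitely many $n$ no noncommutative arithmetic circuit over $\mathbb F$ of size at most $s(n)$ computes $f_n$. Here the gates of a noncommutative arithmetic circuit are variables, constants from $\mathbb F$, and fan-in-two additions and (ordered) multiplications. Its size is its number of gates; over the rationals, a constant counts with the length of its binary representation (sign, numerator and denominator). -/

import Mathlib

open Filter Asymptotics

/-- Straight-line Boolean programs with `n` inputs and `m` nodes (fan-in at most two, unbounded
fan-out). The first `n` nodes are the inputs; every further node is a gate reading earlier nodes. -/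
inductive BoolProg (n : ℕ) : ℕ → Type
  | inputs : BoolProg n n
  | const {k : ℕ} (P : BoolProg n k) (b : Bool) : BoolProg n (k + 1)
  | not {k : ℕ} (P : BoolProg n k) (i : Fin k) : BoolProg n (k + 1)
  | and {k : ℕ} (P : BoolProg n k) (i j : Fin k) : BoolProg n (k + 1)
  | or {k : ℕ} (P : BoolProg n k) (i j : Fin k) : BoolProg n (k + 1)

/-- The values of all nodes of a Boolean program on the input `x`. -/
def BoolProg.eval {n : ℕ} (x : Fin n → Bool) : {k : ℕ} → BoolProg n k → (Fin k → Bool)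
  | _, .inputs => x
  | _, .const P b => Fin.snoc (α := fun _ => Bool) (P.eval x) b
  | _, .not P i => Fin.snoc (α := fun _ => Bool) (P.eval x) (!(P.eval x i))
  | _, .and P i j => Fin.snoc (α := fun _ => Bool) (P.eval x) (P.eval x i && P.eval x j)
  | _, .or P i j => Fin.snoc (α := fun _ => Bool) (P.eval x) (P.eval x i || P.eval x j)

/-- A Boolean circuit with `n` inputs and size `m` (number of nodes, the inputs included). -/
structure BoolCircuit (n m : ℕ) where
  /-- the nodes of the circuit -/
  prog : BoolProg n m
  /-- the output node -/
  out : Fin m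

/-- The set system `{S ⊆ [n] ∣ C (χ_S) = 1}` defined by an `n`-input Boolean circuit `C`. -/
def BoolCircuit.setSystem {n m : ℕ} (C : BoolCircuit n m) : Set (Finset (Fin n)) :=
  {S | C.prog.eval (fun i => decide (i ∈ S)) C.out = true}

/-- With respect to the weight function `w`, the set system `𝓕` has a unique minimum weight set. -/
def HasUniqueMinWeightSet {n : ℕ} (w : Fin n → ℕ) (𝓕 : Set (Finset (Fin n))) : Prop :=
  ∃! S : Finset (Fin n), S ∈ 𝓕 ∧ ∀ T ∈ 𝓕, ∑ i ∈ S, w i ≤ ∑ i ∈ T, w i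

/-- Punctuation used for writing lists of lists of natural numbers on a tape. -/
inductive Punct
  | tick
  | comma
  | semicolon

/-- A list of natural numbers, each number in unary and followed by a comma. -/
def encodeNats (l : List ℕ) : List Punct :=
  l.flatMap fun a => List.replicate a Punct.tick ++ [Punct.comma]

/-- The pair `(m, n)` in unary, as the word `1 ^ m 0 1 ^ n`. -/
def encodeUnaryPair (p : ℕ × ℕ) : List Bool :=
  List.replicate p.1 true ++ false :: List.replicate p.2 true

/-- A list of weight functions; each is written as the list of its values, followed by a semicolon. -/
def encodeWeights {n : ℕ} (ws : List (Fin n → ℕ)) : List Punct :=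
  ws.flatMap fun w => encodeNats (List.ofFn w) ++ [Punct.semicolon]

/-- The black-box derandomization hypothesis for the isolation lemma: a deterministic
polynomial-time algorithm that on input `(m, n)` in unary outputs weight functions
`w_1, …, w_t : [n] → [2n]` such that for every Boolean circuit `C` of size `m` with `n` inputs,
defining a nonempty set system, one of the `w_i` gives that set system a unique minimum
weight set. -/
def IsolationHypothesis : Prop :=
  ∃ A : (m n : ℕ) → List (Fin n → ℕ),
    Nonempty (Turing.TM2ComputableInPolyTime encodeUnaryPair (id : List Punct → List Punct)
      (fun p => encodeWeights (A p.1 p.2))) ∧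
    (∀ m n : ℕ, ∀ w ∈ A m n, ∀ i : Fin n, 1 ≤ w i ∧ w i ≤ 2 * n) ∧
    ∀ (m n : ℕ) (C : BoolCircuit n m), C.setSystem.Nonempty →
      ∃ w ∈ A m n, HasUniqueMinWeightSet w C.setSystem

/-- Noncommutative arithmetic straight-line programs over `F` with `k` nodes in the noncommuting
variables `x_i`, `i : Fin n`: every node is a variable, a constant, or the sum or the (ordered)
product of two earlier nodes. -/
inductive ArithProg (F : Type) (n : ℕ) : ℕ → Type
  | nil : ArithProg F n 0
  | var {k : ℕ} (P : ArithProg F n k) (i : Fin n) : ArithProg F n (k + 1)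
  | const {k : ℕ} (P : ArithProg F n k) (c : F) : ArithProg F n (k + 1)
  | add {k : ℕ} (P : ArithProg F n k) (i j : Fin k) : ArithProg F n (k + 1)
  | mul {k : ℕ} (P : ArithProg F n k) (i j : Fin k) : ArithProg F n (k + 1)

/-- The noncommutative polynomials computed at all nodes of an arithmetic program. -/
noncomputable def ArithProg.eval {F : Type} [Field F] {n : ℕ} :
    {k : ℕ} → ArithProg F n k → (Fin k → FreeAlgebra F (Fin n))
  | _, .nil => Fin.elim0
  | _, .var P i => Fin.snoc (α := fun _ => FreeAlgebra F (Fin n)) P.eval (FreeAlgebra.ι F i)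
  | _, .const P c =>
      Fin.snoc (α := fun _ => FreeAlgebra F (Fin n)) P.eval (algebraMap F (FreeAlgebra F (Fin n)) c)
  | _, .add P i j =>
      Fin.snoc (α := fun _ => FreeAlgebra F (Fin n)) P.eval (P.eval i + P.eval j)
  | _, .mul P i j =>
      Fin.snoc (α := fun _ => FreeAlgebra F (Fin n)) P.eval (P.eval i * P.eval j)

/-- The size of an arithmetic program: every node counts one, except that a node holding a
constant counts the length of the word that represents this constant. -/
def ArithProg.size {F Γ : Type} (enc : F → List Γ) {n : ℕ} : {k : ℕ} → ArithProg F n k → ℕ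
  | _, .nil => 0
  | _, .var P _ => P.size enc + 1
  | _, .const P c => P.size enc + (enc c).length
  | _, .add P _ _ => P.size enc + 1
  | _, .mul P _ _ => P.size enc + 1

/-- `f` has a noncommutative arithmetic circuit of size at most `s`. -/
def HasCircuitOfSize {F Γ : Type} [Field F] (enc : F → List Γ) {n : ℕ}
    (f : FreeAlgebra F (Fin n)) (s : ℕ) : Prop :=
  ∃ (k : ℕ) (P : ArithProg F n k) (out : Fin k), P.eval out = f ∧ P.size enc ≤ s

/-- A rational number as a word: sign, numerator in binary, separator, denominator in binary. -/
def encodeRat (c : ℚ) : List (Option Bool) :=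
  some (decide (c.num < 0)) :: (Computability.encodeNat c.num.natAbs).map some ++
    none :: (Computability.encodeNat c.den).map some

/-- An element of a finite field as a word: a single letter of the finite alphabet `F`. -/
def encodeLetter {F : Type} (c : F) : List F := [c]

/-- The noncommutative polynomial with the given list of terms (coefficient, monomial). -/
noncomputable def ofTerms {F : Type} [Field F] {n : ℕ} (ts : List (F × List (Fin n))) :
    FreeAlgebra F (Fin n) :=
  (ts.map fun t => t.1 • (t.2.map (FreeAlgebra.ι F)).prod).sum

/-- A list of terms as a word: for each term its coefficient, then the indices of the variables
of its monomial, from left to right, then a semicolon. -/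
def encodeTerms {F Γ : Type} (enc : F → List Γ) {n : ℕ} (ts : List (F × List (Fin n))) :
    List (Γ ⊕ Punct) :=
  ts.flatMap fun t =>
    (enc t.1).map Sum.inl ++ (encodeNats (t.2.map Fin.val) ++ [Punct.semicolon]).map Sum.inr

/-- The family `f` is computable by a uniform algorithm in time `2 ^ (n ^ O(1))`: a single
deterministic machine, given `n` in unary, writes down all terms of `f n` within
`2 ^ (n ^ k + k)` steps, for a constant `k`. -/
def IsExplicit {F Γ : Type} [Field F] (enc : F → List Γ)
    (f : (n : ℕ) → FreeAlgebra F (Fin n)) : Prop :=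
  ∃ (ts : (n : ℕ) → List (F × List (Fin n))) (k : ℕ)
    (M : Turing.TM2ComputableInTime Computability.unaryEncodeNat
      (id : List (Γ ⊕ Punct) → List (Γ ⊕ Punct)) (fun n => encodeTerms enc (ts n))),
    (∀ n, ofTerms (ts n) = f n) ∧ ∀ n, M.time n ≤ 2 ^ (n ^ k + k)

/-- `f` is homogeneous of degree `d`: a linear combination of monomials of length `d`. -/
def IsHomogeneousOfDegree {F : Type} [Field F] {n : ℕ} (f : FreeAlgebra F (Fin n))
    (d : ℕ) : Prop :=
  f ∈ Submodule.span F (Set.range fun α : Fin d → Fin n =>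
    (List.ofFn fun j => FreeAlgebra.ι F (α j)).prod)

/-- Over `F` there is an explicit family `f n` of polynomials in `n` noncommuting variables,
homogeneous of degree `n`, which has no circuits of size `2 ^ o(n lg n)`: for every such size
bound `s`, for all but finitely many `n`, no circuit of size at most `s n` computes `f n`. -/
def HasExplicitHardPolynomials (F : Type) {Γ : Type} [Field F] (enc : F → List Γ) : Prop :=
  ∃ f : (n : ℕ) → FreeAlgebra F (Fin n),
    IsExplicit enc f ∧ (∀ n, IsHomogeneousOfDegree (f n) n) ∧
    ∀ s : ℕ → ℕ,
      (fun n : ℕ => Real.logb 2 (s n)) =o[atTop] (fun n : ℕ => (n : ℝ) * Real.logb 2 n) →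
      ∀ᶠ n in atTop, ¬ HasCircuitOfSize enc (f n) (s n)

/-! Split a word of length n over [n] into a prefix u of length b = n / c, with c = 2 (K + 1), and a
suffix v. Its graph, the set of pairs (position, letter), is a subset of a ground set of n²
elements. For circuits of size m = n ^ b with n² inputs, the assumed algorithm yields at most
poly(m) weight functions, where K is an exponent of that polynomial, and each gives a graph one of
at most 2 n³ + 1 weights. For fixed u, ask for coefficients c_v that sum to zero over the v for
which the graph of uv has weight t under w, for all w and t. By the choice of c these are fewer
conditions than there are suffixes (`length_mul_lt`), so modulo a prime there is a nonzero solution,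
and elimination finds it (`kernelVector_spec`). The polynomial is the sum of c_v times the monomial
of uv, over all u and v.

Suppose that a small circuit over a finite field computes it. Substitute for the variable x_i the
matrix whose entry (l, l + 1) tells whether i agrees with u at position l and (l, i) lies in a set
S. The upper right corner of the value is the sum of the c_v with the graph of uv inside S
(`countP_hardWords`). A Boolean circuit of polynomially larger size decides whether this sum is
nonzero (`BoolProg.exists_boolCircuit`); it has size m if the arithmetic circuit has size 2 ^ o(n lg
n). The set system is nonempty, because graphs form an antichain and so the graph of a uv with c_v ≠
0 is a member. But no w isolates it (`not_hasUniqueMinWeightSet`). A unique minimum S contains a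
graph with nonzero coefficient, which is itself a member and no heavier, hence equal to S. Any other
graph of the same weight with nonzero coefficient would be a second minimum, so the coefficients of
that weight class could not sum to zero.

Over ℚ the circuit is first reduced modulo a prime p that divides no denominator of a constant. The
product of the denominators is at most 2 ^ s, so some p = O(s²) will do (`exists_prime_not_dvd`). As
p depends on the circuit, the polynomial prepares for all of them: the block of the i-th prefix is
built modulo i + 2, and the circuit is refuted by the prefix with index p - 2.

For explicitness, data are binary trees in prefix notation on a stack, and `PolyTime` is a class of
functions on trees closed under the usual list operations and under calling the assumed algorithm.
The number n is represented by a tree of size about n ^ n, so that polynomial time becomes time 2 ^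
(n ^ O(1)). -/

/-! ### Composable programs for stack machines -/

/-- `M` goes from the configuration `c` to the configuration `d` within `t` steps. -/
def ReachesIn {K : Type} [DecidableEq K] {Γ : K → Type} {Λ σ : Type}
    (M : Λ → Turing.TM2.Stmt Γ Λ σ) (t : ℕ) (c d : Turing.TM2.Cfg Γ Λ σ) : Prop :=
  ∃ s ≤ t, (flip Option.bind (Turing.TM2.step M))^[s] (some c) = some d

namespace ReachesIn

variable {K : Type} [DecidableEq K] {Γ : K → Type} {Λ σ : Type}
  {M : Λ → Turing.TM2.Stmt Γ Λ σ} {t t₁ t₂ : ℕ} {c d e : Turing.TM2.Cfg Γ Λ σ}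

theorem refl (M : Λ → Turing.TM2.Stmt Γ Λ σ) (c : Turing.TM2.Cfg Γ Λ σ) :
    ReachesIn M 0 c c := ⟨0, le_rfl, rfl⟩

theorem mono (h : ReachesIn M t₁ c d) (ht : t₁ ≤ t₂) : ReachesIn M t₂ c d :=
  let ⟨s, hs, h⟩ := h
  ⟨s, hs.trans ht, h⟩

theorem trans (h₁ : ReachesIn M t₁ c d) (h₂ : ReachesIn M t₂ d e) :
    ReachesIn M (t₁ + t₂) c e := by
  obtain ⟨s₁, hs₁, h₁⟩ := h₁
  obtain ⟨s₂, hs₂, h₂⟩ := h₂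
  refine ⟨s₂ + s₁, by omega, ?_⟩
  rw [Function.iterate_add_apply, h₁, h₂]

theorem step {l : Λ} {v : σ} {S : ∀ k, List (Γ k)}
    (h : Turing.TM2.stepAux (M l) v S = d) : ReachesIn M 1 ⟨some l, v, S⟩ d :=
  ⟨1, le_rfl, by subst h; rfl⟩

end ReachesIn

/-- A program with one entry and one exit. Its code is given relative to an embedding of its labels
into the labels of an ambient machine and to the label at which that machine goes on. -/
structure Fragment {K : Type} (Γ : K → Type) (σ : Type) where
  /-- the labels -/
  Label : Type
  [labelFintype : Fintype Label]
  /-- the label at which the program starts -/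
  entry : Label
  /-- the code -/
  code : {Λ : Type} → (Label → Λ) → Λ → Label → Turing.TM2.Stmt Γ Λ σ

namespace Fragment

attribute [instance] labelFintype

variable {K : Type} [DecidableEq K] {Γ : K → Type} {σ : Type}

/-- The code of `P` is part of the machine `M`. -/
def Installed (P : Fragment Γ σ) {Λ : Type} (M : Λ → Turing.TM2.Stmt Γ Λ σ) (e : P.Label → Λ)
    (x : Λ) : Prop :=
  ∀ l, M (e l) = P.code e x l

/-- Started with the stacks `S`, the program `P` ends with the stacks `S'` within `t` steps. The
internal state is `v` before and after. -/
def Runs (P : Fragment Γ σ) (v : σ) (t : ℕ) (S S' : ∀ k, List (Γ k)) : Prop :=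
  ∀ (Λ : Type) (M : Λ → Turing.TM2.Stmt Γ Λ σ) (e : P.Label → Λ) (x : Λ), P.Installed M e x →
    ReachesIn M t ⟨some (e P.entry), v, S⟩ ⟨some x, v, S'⟩

theorem Runs.mono {P : Fragment Γ σ} {v : σ} {t t' : ℕ} {S S' : ∀ k, List (Γ k)}
    (h : P.Runs v t S S') (ht : t ≤ t') : P.Runs v t' S S' :=
  fun Λ M e x hM => (h Λ M e x hM).mono ht

/-- First `P`, then `Q`. -/
def seq (P Q : Fragment Γ σ) : Fragment Γ σ where
  Label := P.Label ⊕ Q.Label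
  entry := .inl P.entry
  code e x
    | .inl l => P.code (e ∘ .inl) (e (.inr Q.entry)) l
    | .inr l => Q.code (e ∘ .inr) x l

/-- Since `Runs` speaks of every machine in which the code is installed, both halves run directly
inside the machine that contains the composite, and no configuration has to be translated. -/
theorem Runs.seq {P Q : Fragment Γ σ} {v : σ} {t t' : ℕ} {S S' S'' : ∀ k, List (Γ k)}
    (hP : P.Runs v t S S') (hQ : Q.Runs v t' S' S'') : (P.seq Q).Runs v (t + t') S S'' :=
  fun Λ M e x hM => (hP Λ M (e ∘ .inl) (e (.inr Q.entry)) fun l => hM (.inl l)).trans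
    (hQ Λ M (e ∘ .inr) x fun l => hM (.inr l))

/-- The program with one label, whose statement may return to this label or leave the program. -/
def single (q : {Λ : Type} → Λ → Λ → Turing.TM2.Stmt Γ Λ σ) : Fragment Γ σ where
  Label := Unit
  entry := ()
  code e x _ := q (e ()) x

theorem Runs.single {q : {Λ : Type} → Λ → Λ → Turing.TM2.Stmt Γ Λ σ} {v : σ}
    {S S' : ∀ k, List (Γ k)}
    (h : ∀ (Λ : Type) (l x : Λ), Turing.TM2.stepAux (q l x) v S = ⟨some x, v, S'⟩) :
    (single q).Runs v 1 S S' := by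
  intro Λ M e x hM
  refine ReachesIn.step ?_
  rw [show M (e (Fragment.single q).entry) = _ from hM ()]
  exact h _ _ _

/-- The induction step for programs that consist of one label jumping back to itself. -/
theorem Runs.single_round
    {q : {Λ : Type} → Λ → Λ → Turing.TM2.Stmt Γ Λ σ} {v : σ} {t : ℕ}
    {S S' S'' : ∀ k, List (Γ k)}
    (h : ∀ (Λ : Type) (l x : Λ), Turing.TM2.stepAux (q l x) v S = ⟨some l, v, S'⟩)
    (hl : (Fragment.single q).Runs v t S' S'') : (Fragment.single q).Runs v (1 + t) S S'' := by
  intro Λ M e x hM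
  refine (ReachesIn.step ?_).trans (hl Λ M e x hM)
  rw [show M (e (Fragment.single q).entry) = _ from hM ()]
  exact h _ _ _

theorem Runs.congr
    {P : Fragment Γ σ} {v : σ} {t : ℕ} {S S' S'' : ∀ k, List (Γ k)} (h : P.Runs v t S S')
    (hS : S' = S'') : P.Runs v t S S'' :=
  hS ▸ h

theorem Runs.start {P : Fragment Γ σ} {v : σ} {t : ℕ} {S S' S'' : ∀ k, List (Γ k)}
    (h : P.Runs v t S S') (hS : S = S'') : P.Runs v t S'' S' :=
  hS ▸ h

/-- Choose between `P` and `Q`: the statement `q` gets the entries of both. -/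
def choose (q : {Λ : Type} → Λ → Λ → Turing.TM2.Stmt Γ Λ σ) (P Q : Fragment Γ σ) :
    Fragment Γ σ where
  Label := Option (P.Label ⊕ Q.Label)
  entry := none
  code e x
    | none => q (e (some (.inl P.entry))) (e (some (.inr Q.entry)))
    | some (.inl l) => P.code (e ∘ some ∘ .inl) x l
    | some (.inr l) => Q.code (e ∘ some ∘ .inr) x l

theorem Runs.choose_left {q : {Λ : Type} → Λ → Λ → Turing.TM2.Stmt Γ Λ σ} {P Q : Fragment Γ σ}
    {v : σ} {t : ℕ} {S S' S'' : ∀ k, List (Γ k)}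
    (h : ∀ (Λ : Type) (l x : Λ), Turing.TM2.stepAux (q l x) v S = ⟨some l, v, S'⟩)
    (hP : P.Runs v t S' S'') : (choose q P Q).Runs v (1 + t) S S'' := by
  intro Λ M e x hM
  refine (ReachesIn.step ?_).trans
    (hP Λ M (e ∘ some ∘ .inl) x fun l => hM (some (.inl l)))
  rw [show M (e (choose q P Q).entry) = _ from hM none]
  exact h _ _ _

theorem Runs.choose_right {q : {Λ : Type} → Λ → Λ → Turing.TM2.Stmt Γ Λ σ} {P Q : Fragment Γ σ}
    {v : σ} {t : ℕ} {S S' S'' : ∀ k, List (Γ k)}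
    (h : ∀ (Λ : Type) (l x : Λ), Turing.TM2.stepAux (q l x) v S = ⟨some x, v, S'⟩)
    (hQ : Q.Runs v t S' S'') : (choose q P Q).Runs v (1 + t) S S'' := by
  intro Λ M e x hM
  refine (ReachesIn.step ?_).trans
    (hQ Λ M (e ∘ some ∘ .inr) x fun l => hM (some (.inr l)))
  rw [show M (e (choose q P Q).entry) = _ from hM none]
  exact h _ _ _

/-- Repeat `P`: the statement `q` gets the entry of `P`, to which it goes for another round, and the
exit. -/
def loop (q : {Λ : Type} → Λ → Λ → Turing.TM2.Stmt Γ Λ σ) (P : Fragment Γ σ) : Fragment Γ σ where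
  Label := Option P.Label
  entry := none
  code e x
    | none => q (e (some P.entry)) x
    | some l => P.code (e ∘ some) (e none) l

theorem Runs.loop_exit {q : {Λ : Type} → Λ → Λ → Turing.TM2.Stmt Γ Λ σ} {P : Fragment Γ σ}
    {v : σ} {S S' : ∀ k, List (Γ k)}
    (h : ∀ (Λ : Type) (l x : Λ), Turing.TM2.stepAux (q l x) v S = ⟨some x, v, S'⟩) :
    (loop q P).Runs v 1 S S' := by
  intro Λ M e x hM
  refine ReachesIn.step ?_
  rw [show M (e (loop q P).entry) = _ from hM none]
  exact h _ _ _

theorem Runs.loop_round {q : {Λ : Type} → Λ → Λ → Turing.TM2.Stmt Γ Λ σ} {P : Fragment Γ σ}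
    {v : σ} {t t' : ℕ} {S S' S'' S''' : ∀ k, List (Γ k)}
    (h : ∀ (Λ : Type) (l x : Λ), Turing.TM2.stepAux (q l x) v S = ⟨some l, v, S'⟩)
    (hP : P.Runs v t S' S'') (hl : (loop q P).Runs v t' S'' S''') :
    (loop q P).Runs v (1 + t + t') S S''' := by
  intro Λ M e x hM
  refine ((ReachesIn.step ?_).trans
    (hP Λ M (e ∘ some) (e none) fun l => hM (some l))).trans (hl Λ M e x hM)
  rw [show M (e (loop q P).entry) = _ from hM none]
  exact h _ _ _

end Fragment

/-! ### Manipulating trees on stacks of bits -/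

/-- Binary trees, the data on which the machines built below work. -/
inductive BinTree
  | leaf
  | node (a b : BinTree)

/-- A binary tree in prefix notation. -/
def BinTree.word : BinTree → List Bool
  | .leaf => [false]
  | .node a b => true :: (a.word ++ b.word)

/-- The stacks of bits: the main stack, two stacks for moving trees, and a counter. -/
inductive BitStack
  | main
  | left
  | right
  | depth
  deriving DecidableEq

instance : Fintype BitStack :=
  ⟨{.main, .left, .right, .depth}, fun i => by cases i <;> simp⟩

/-- The stacks: input, output, stacks of bits, and the stacks of a subroutine. -/
inductive StackName (K₀ : Type)
  | inp
  | out
  | bits (i : BitStack)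
  | sub (k : K₀)
  deriving DecidableEq

/-- The names of stacks as a sum. -/
def StackName.equivSum (K₀ : Type) : StackName K₀ ≃ Bool ⊕ BitStack ⊕ K₀ where
  toFun
    | .inp => .inl true
    | .out => .inl false
    | .bits i => .inr (.inl i)
    | .sub k => .inr (.inr k)
  invFun
    | .inl true => .inp
    | .inl false => .out
    | .inr (.inl i) => .bits i
    | .inr (.inr k) => .sub k
  left_inv k := by cases k <;> rfl
  right_inv k := by rcases k with (_ | _) | _ | _ <;> rfl

instance {K₀ : Type} [Fintype K₀] : Fintype (StackName K₀) :=
  Fintype.ofEquiv _ (StackName.equivSum K₀).symm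

/-- The alphabets of the stacks. -/
abbrev StackName.Alphabet {K₀ : Type} (Γ₀ : K₀ → Type) (Ω : Type) : StackName K₀ → Type
  | .inp => Bool
  | .out => Ω
  | .bits _ => Bool
  | .sub k => Γ₀ k

/-- The internal states: that of the subroutine, a bit, and a small number. -/
abbrev Registers (σ₀ : Type) : Type := σ₀ × Option Bool × Option (Fin 8)

/-- The four stacks of bits. -/
def bitStacks (m l r d : List Bool) : BitStack → List Bool
  | .main => m
  | .left => l
  | .right => r
  | .depth => d

/-- All stacks. -/
def allStacks {K₀ : Type} {Γ₀ : K₀ → Type} {Ω : Type} (i : List Bool) (o : List Ω)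
    (b : BitStack → List Bool) (T : ∀ k, List (Γ₀ k)) :
    ∀ k : StackName K₀, List (k.Alphabet Γ₀ Ω)
  | .inp => i
  | .out => o
  | .bits j => b j
  | .sub k => T k

section Stacks

variable {K₀ : Type} {Γ₀ : K₀ → Type} {Ω : Type} (i : List Bool) (o : List Ω)
  (b : BitStack → List Bool) (T : ∀ k, List (Γ₀ k)) (m l r d x : List Bool)

@[simp] theorem bitStacks_main : bitStacks m l r d .main = m := rfl
@[simp] theorem bitStacks_left : bitStacks m l r d .left = l := rfl
@[simp] theorem bitStacks_right : bitStacks m l r d .right = r := rfl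
@[simp] theorem bitStacks_depth : bitStacks m l r d .depth = d := rfl

@[simp] theorem update_bitStacks_main :
    Function.update (bitStacks m l r d) .main x = bitStacks x l r d := by
  funext j; cases j <;> rfl

@[simp] theorem update_bitStacks_left :
    Function.update (bitStacks m l r d) .left x = bitStacks m x r d := by
  funext j; cases j <;> rfl

@[simp] theorem update_bitStacks_right :
    Function.update (bitStacks m l r d) .right x = bitStacks m l x d := by
  funext j; cases j <;> rfl

@[simp] theorem update_bitStacks_depth :
    Function.update (bitStacks m l r d) .depth x = bitStacks m l r x := by
  funext j; cases j <;> rfl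

@[simp] theorem allStacks_inp : allStacks i o b T .inp = i := rfl
@[simp] theorem allStacks_out : allStacks i o b T .out = o := rfl
@[simp] theorem allStacks_bits (j : BitStack) : allStacks i o b T (.bits j) = b j := rfl
@[simp] theorem allStacks_sub (k : K₀) : allStacks i o b T (.sub k) = T k := rfl

variable [DecidableEq K₀]

@[simp] theorem update_allStacks_inp :
    Function.update (allStacks i o b T) .inp x = allStacks x o b T := by
  funext j; cases j <;> rfl

@[simp] theorem update_allStacks_out (x : List Ω) :
    Function.update (allStacks i o b T) .out x = allStacks i x b T := by
  funext j; cases j <;> rfl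

@[simp] theorem update_allStacks_bits (j : BitStack) :
    Function.update (allStacks i o b T) (.bits j) x = allStacks i o (Function.update b j x) T := by
  funext j'
  cases j' with
  | bits j' =>
    by_cases h : j' = j
    · subst h; simp
    · rw [Function.update_of_ne (by simpa using h)]; simp [h]
  | _ => rfl

@[simp] theorem update_allStacks_sub (k : K₀) (x : List (Γ₀ k)) :
    Function.update (allStacks i o b T) (.sub k) x = allStacks i o b (Function.update T k x) := by
  funext j'
  cases j' with
  | sub j' =>
    by_cases h : j' = k
    · subst h; simp
    · rw [Function.update_of_ne (by simpa using h)]; simp [h]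
  | _ => rfl

end Stacks

/-- Programs that work on trees and may call a subroutine. -/
abbrev TreeFragment {K₀ : Type} (Γ₀ : K₀ → Type) (σ₀ Ω : Type) : Type 1 :=
  Fragment (StackName.Alphabet Γ₀ Ω) (Registers σ₀)

namespace TreeFragment

open Turing.TM2 Stmt

variable {K₀ : Type} [DecidableEq K₀] {Γ₀ : K₀ → Type} {σ₀ Ω : Type}

/-- Push a word on the main stack. -/
def pushWordStmt {Λ : Type} :
    List Bool → Stmt (StackName.Alphabet Γ₀ Ω) Λ (Registers σ₀) →
      Stmt (StackName.Alphabet Γ₀ Ω) Λ (Registers σ₀)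
  | [], q => q
  | a :: w, q => pushWordStmt w (push (.bits .main) (fun _ => a) q)

theorem stepAux_pushWordStmt {Λ : Type} (w : List Bool)
    (q : Stmt (StackName.Alphabet Γ₀ Ω) Λ (Registers σ₀)) (v : Registers σ₀) (i : List Bool)
    (o : List Ω) (m l r d : List Bool) (T : ∀ k, List (Γ₀ k)) :
    stepAux (pushWordStmt w q) v (allStacks i o (bitStacks m l r d) T) =
      stepAux q v (allStacks i o (bitStacks (w ++ m) l r d) T) := by
  induction w generalizing q with
  | nil => rfl
  | cons a w ih => simp [pushWordStmt, ih]

/-- Push a word on the main stack. -/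
def pushWord (w : List Bool) : TreeFragment Γ₀ σ₀ Ω :=
  Fragment.single fun _ x => pushWordStmt w (goto fun _ => x)

theorem pushWord_runs (w : List Bool) (s : σ₀) (i : List Bool) (o : List Ω) (m l r d : List Bool)
    (T : ∀ k, List (Γ₀ k)) :
    (pushWord w).Runs (s, none, none) 1 (allStacks i o (bitStacks m l r d) T)
      (allStacks i o (bitStacks (w ++ m) l r d) T) :=
  Fragment.Runs.single fun _ l x => by simp [stepAux_pushWordStmt]

/-- Remove the top of the main stack. -/
def popBit : TreeFragment Γ₀ σ₀ Ω :=
  Fragment.single fun _ x => pop (.bits .main) (fun v _ => v) (goto fun _ => x)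

theorem popBit_runs (a : Bool) (s : σ₀) (i : List Bool) (o : List Ω) (m l r d : List Bool)
    (T : ∀ k, List (Γ₀ k)) :
    popBit.Runs (s, none, none) 1 (allStacks i o (bitStacks (a :: m) l r d) T)
      (allStacks i o (bitStacks m l r d) T) :=
  Fragment.Runs.single fun _ l x => by simp

/-- The left stack or the right stack. -/
def side : Bool → BitStack
  | true => .left
  | false => .right

/-- The stacks of bits, with `x` on the given side and `y` on the other one. -/
def sideStacks : Bool → List Bool → List Bool → List Bool → List Bool → BitStack → List Bool
  | true, m, x, y, d => bitStacks m x y d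
  | false, m, x, y, d => bitStacks m y x d

/-- Move a tree from the main stack to a side; the stack `depth` counts the trees yet to be read. -/
def moveLoop (b : Bool) : TreeFragment Γ₀ σ₀ Ω :=
  Fragment.single fun l x => pop (.bits .depth) (fun v a => (v.1, a, v.2.2))
    (branch (fun v => v.2.1.isNone) (goto fun _ => x)
      (pop (.bits .main) (fun v a => (v.1, a, v.2.2))
        (push (.bits (side b)) (fun v => v.2.1.getD false)
          (branch (fun v => v.2.1.getD false)
            (push (.bits .depth) (fun _ => true) (push (.bits .depth) (fun _ => true)
              (load (fun v => (v.1, none, v.2.2)) (goto fun _ => l))))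
            (load (fun v => (v.1, none, v.2.2)) (goto fun _ => l))))))

/-- The counter holds one symbol for each tree still to be read: a leaf uses up one, a node trades
one for two. The run is stated with an arbitrary continuation `h`, so that the induction hypotheses
of the two children can be chained. -/
theorem moveLoop_runs_word (b : Bool) (t : BinTree) (s : σ₀) (i : List Bool) (o : List Ω)
    (y : List Bool) (T : ∀ k, List (Γ₀ k)) (S : ∀ k : StackName K₀, List (k.Alphabet Γ₀ Ω))
    {n : ℕ} (m x d : List Bool)
    (h : (moveLoop b).Runs (s, none, none) n
      (allStacks i o (sideStacks b m (t.word.reverse ++ x) y d) T) S) :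
    (moveLoop b).Runs (s, none, none) (t.word.length + n)
      (allStacks i o (sideStacks b (t.word ++ m) x y (true :: d)) T) S := by
  induction t generalizing n m x d with
  | leaf =>
    refine Fragment.Runs.single_round (fun _ l e => ?_) h
    cases b <;> simp [sideStacks, side, BinTree.word]
  | node t₁ t₂ h₁ h₂ =>
    have hlen : (BinTree.node t₁ t₂).word.length + n
        = 1 + (t₁.word.length + (t₂.word.length + n)) := by
      simp [BinTree.word]; omega
    rw [hlen]
    refine .single_round (S' := allStacks i o (sideStacks b (t₁.word ++ (t₂.word ++ m))
      (true :: x) y (true :: true :: d)) T) (fun _ l e => ?_) ?_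
    · cases b <;> simp [sideStacks, side, BinTree.word]
    · apply h₁
      apply h₂
      simpa [BinTree.word] using h

/-- Move a tree from the main stack to a side. -/
def moveTree (b : Bool) : TreeFragment Γ₀ σ₀ Ω :=
  (Fragment.single fun _ x => push (.bits .depth) (fun _ => true) (goto fun _ => x)).seq (moveLoop b)

theorem moveTree_runs (b : Bool) (t : BinTree) (s : σ₀) (i : List Bool) (o : List Ω)
    (m x y : List Bool) (T : ∀ k, List (Γ₀ k)) :
    (moveTree b).Runs (s, none, none) (t.word.length + 2)
      (allStacks i o (sideStacks b (t.word ++ m) x y []) T)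
      (allStacks i o (sideStacks b m (t.word.reverse ++ x) y []) T) := by
  refine Fragment.Runs.mono (.seq (S' := allStacks i o (sideStacks b (t.word ++ m) x y [true]) T)
    (.single fun _ l e => ?_) (moveLoop_runs_word b t s i o y T _ m x [] (n := 1)
      (.single fun _ l e => ?_))) (by omega)
  · cases b <;> simp [sideStacks]
  · cases b <;> simp [sideStacks]

/-- Pour the stack on the given side out on the main stack; if `keep`, also on the other side. -/
def pour (b keep : Bool) : TreeFragment Γ₀ σ₀ Ω :=
  Fragment.single fun l x => pop (.bits (side b)) (fun v a => (v.1, a, v.2.2))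
    (branch (fun v => v.2.1.isNone) (goto fun _ => x)
      (push (.bits .main) (fun v => v.2.1.getD false)
        (branch (fun _ => keep)
          (push (.bits (side !b)) (fun v => v.2.1.getD false)
            (load (fun v => (v.1, none, v.2.2)) (goto fun _ => l)))
          (load (fun v => (v.1, none, v.2.2)) (goto fun _ => l)))))

/-- A tree moved aside lies there reversed, so pouring restores the reading order, both on the main
stack and in the copy. -/
theorem pour_runs (b keep : Bool) (s : σ₀) (i : List Bool) (o : List Ω) (m x y : List Bool)
    (T : ∀ k, List (Γ₀ k)) :
    (pour b keep).Runs (s, none, none) (x.length + 1)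
      (allStacks i o (sideStacks b m x y []) T)
      (allStacks i o (sideStacks b (x.reverse ++ m) []
        (if keep then x.reverse ++ y else y) []) T) := by
  induction x generalizing m y with
  | nil => exact Fragment.Runs.single fun _ l e => by cases b <;> simp [sideStacks, side]
  | cons a x ih =>
    refine ((Fragment.Runs.single_round (fun _ l e => ?_)
      (ih (a :: m) (if keep then a :: y else y))).mono (by simp; omega)).congr ?_
    · cases b <;> cases keep <;> simp [sideStacks, side]
    · cases keep <;> simp

/-- Empty the stack on the given side. -/
def clear (b : Bool) : TreeFragment Γ₀ σ₀ Ω :=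
  Fragment.single fun l x => pop (.bits (side b)) (fun v a => (v.1, a, v.2.2))
    (branch (fun v => v.2.1.isNone) (goto fun _ => x)
      (load (fun v => (v.1, none, v.2.2)) (goto fun _ => l)))

theorem clear_runs (b : Bool) (s : σ₀) (i : List Bool) (o : List Ω) (m x y : List Bool)
    (T : ∀ k, List (Γ₀ k)) :
    (clear b).Runs (s, none, none) (x.length + 1)
      (allStacks i o (sideStacks b m x y []) T)
      (allStacks i o (sideStacks b m [] y []) T) := by
  induction x with
  | nil => exact Fragment.Runs.single fun _ l e => by cases b <;> simp [sideStacks, side]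
  | cons a x ih =>
    exact (Fragment.Runs.single_round
      (fun _ l e => by cases b <;> simp [sideStacks, side]) ih).mono (by simp; omega)

end TreeFragment

namespace TreeFragment

open Turing.TM2 Stmt

variable {K₀ : Type} [DecidableEq K₀] {Γ₀ : K₀ → Type} {σ₀ Ω : Type}

/-- Move the contents of the stack on the given side to the other side. -/
def transfer (b : Bool) : TreeFragment Γ₀ σ₀ Ω :=
  Fragment.single fun l x => pop (.bits (side b)) (fun v a => (v.1, a, v.2.2))
    (branch (fun v => v.2.1.isNone) (goto fun _ => x)
      (push (.bits (side !b)) (fun v => v.2.1.getD false)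
        (load (fun v => (v.1, none, v.2.2)) (goto fun _ => l))))

theorem transfer_runs (b : Bool) (s : σ₀) (i : List Bool) (o : List Ω) (m x y : List Bool)
    (T : ∀ k, List (Γ₀ k)) :
    (transfer b).Runs (s, none, none) (x.length + 1)
      (allStacks i o (sideStacks b m x y []) T)
      (allStacks i o (sideStacks b m [] (x.reverse ++ y) []) T) := by
  induction x generalizing y with
  | nil => exact .single fun _ l e => by cases b <;> simp [sideStacks, side]
  | cons a x ih =>
    refine ((Fragment.Runs.single_round (fun _ l e => ?_)
      (ih (a :: y))).mono (by simp; omega)).congr ?_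
    · cases b <;> simp [sideStacks, side]
    · simp

/-- All stacks are empty but the main stack. -/
def mainOnly (Γ₀ : K₀ → Type) (Ω : Type) (m : List Bool) :
    ∀ k : StackName K₀, List (k.Alphabet Γ₀ Ω) :=
  allStacks [] [] (bitStacks m [] [] []) fun _ => []

/-- The program replaces the word `w` on the top of the main stack by `w'`. -/
def Performs (P : TreeFragment Γ₀ σ₀ Ω) (s : σ₀) (t : ℕ) (w w' : List Bool) : Prop :=
  ∀ m, P.Runs (s, none, none) t (mainOnly Γ₀ Ω (w ++ m)) (mainOnly Γ₀ Ω (w' ++ m))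

theorem Performs.mono {P : TreeFragment Γ₀ σ₀ Ω} {s : σ₀} {t t' : ℕ} {w w' : List Bool}
    (h : Performs P s t w w') (ht : t ≤ t') : Performs P s t' w w' :=
  fun m => (h m).mono ht

theorem Performs.seq {P Q : TreeFragment Γ₀ σ₀ Ω} {s : σ₀} {t t' : ℕ} {w w' w'' : List Bool}
    (hP : Performs P s t w w') (hQ : Performs Q s t' w' w'') :
    Performs (P.seq Q) s (t + t') w w'' :=
  fun m => (hP m).seq (hQ m)

theorem Performs.append {P : TreeFragment Γ₀ σ₀ Ω} {s : σ₀} {t : ℕ} {w w' : List Bool}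
    (h : Performs P s t w w') (u : List Bool) : Performs P s t (w ++ u) (w' ++ u) :=
  fun m => by simpa using h (u ++ m)

theorem pushWord_performs (u w : List Bool) (s : σ₀) :
    Performs (pushWord (Γ₀ := Γ₀) (Ω := Ω) u) s 1 w (u ++ w) :=
  fun m => Fragment.Runs.congr (pushWord_runs u s [] [] (w ++ m) [] [] [] _) (by simp [mainOnly])

theorem popBit_performs (a : Bool) (w : List Bool) (s : σ₀) :
    Performs (popBit (Γ₀ := Γ₀) (Ω := Ω)) s 1 (a :: w) w :=
  fun m => popBit_runs a s [] [] (w ++ m) [] [] [] _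

/-- Remove the top tree. -/
def drop : TreeFragment Γ₀ σ₀ Ω := (moveTree true).seq (clear true)

theorem drop_performs (t : BinTree) (s : σ₀) :
    Performs (drop (Γ₀ := Γ₀) (Ω := Ω)) s (2 * t.word.length + 3) t.word [] := by
  intro m
  refine Fragment.Runs.mono (.seq (moveTree_runs true t s [] [] m [] [] _)
    (clear_runs true s [] [] m _ [] _)) ?_
  simp
  omega

/-- Duplicate the top tree. -/
def dup : TreeFragment Γ₀ σ₀ Ω :=
  (moveTree true).seq ((pour true true).seq ((transfer false).seq (pour true false)))

/-- The copy kept on the right is in reading order; `transfer` reverses it, so that the second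
pouring puts it back in reading order. -/
theorem dup_performs (t : BinTree) (s : σ₀) :
    Performs (dup (Γ₀ := Γ₀) (Ω := Ω)) s (4 * t.word.length + 5) t.word (t.word ++ t.word) := by
  intro m
  have h₁ := (moveTree_runs (Γ₀ := Γ₀) (Ω := Ω) true t s [] [] m [] [] fun _ => [])
  have h₂ := (pour_runs (Γ₀ := Γ₀) (Ω := Ω) true true s [] [] m (t.word.reverse ++ []) [] fun _ => [])
  have h₃ := (transfer_runs (Γ₀ := Γ₀) (Ω := Ω) false s [] [] (t.word ++ m) t.word [] fun _ => [])
  have h₄ := (pour_runs (Γ₀ := Γ₀) (Ω := Ω) true false s [] [] (t.word ++ m) t.word.reverse []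
    fun _ => [])
  simp only [sideStacks, List.append_nil, List.reverse_reverse, Bool.false_eq_true, if_false,
    if_true] at h₁ h₂ h₃ h₄
  refine Fragment.Runs.mono (((h₁.seq (h₂.seq (h₃.seq h₄))).congr ?_).start ?_) ?_
  · simp [mainOnly]
  · simp [mainOnly]
  · simp
    omega

/-- Exchange the two top trees. -/
def swap : TreeFragment Γ₀ σ₀ Ω :=
  (moveTree true).seq ((moveTree false).seq ((pour true false).seq (pour false false)))

theorem swap_performs (t₁ t₂ : BinTree) (s : σ₀) :
    Performs (swap (Γ₀ := Γ₀) (Ω := Ω)) s (2 * t₁.word.length + 2 * t₂.word.length + 6)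
      (t₁.word ++ t₂.word) (t₂.word ++ t₁.word) := by
  intro m
  have h₁ := (moveTree_runs (Γ₀ := Γ₀) (Ω := Ω) true t₁ s [] [] (t₂.word ++ m) [] [] fun _ => [])
  have h₂ := (moveTree_runs (Γ₀ := Γ₀) (Ω := Ω) false t₂ s [] [] m [] t₁.word.reverse fun _ => [])
  have h₃ := (pour_runs (Γ₀ := Γ₀) (Ω := Ω) true false s [] [] m t₁.word.reverse t₂.word.reverse
    fun _ => [])
  have h₄ := (pour_runs (Γ₀ := Γ₀) (Ω := Ω) false false s [] [] (t₁.word ++ m) t₂.word.reverse []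
    fun _ => [])
  simp only [sideStacks, List.append_nil, List.reverse_reverse, Bool.false_eq_true, if_false]
    at h₁ h₂ h₃ h₄
  refine Fragment.Runs.mono (((h₁.seq (h₂.seq (h₃.seq h₄))).congr ?_).start ?_) ?_
  · simp [mainOnly]
  · simp [mainOnly]
  · simp
    omega

/-- Remove the root and the left child of the top tree if this child is a leaf; then go to `x`.
Otherwise leave the tree as it is and go to `l`. -/
def testStmt {Λ : Type} (l x : Λ) : Stmt (StackName.Alphabet Γ₀ Ω) Λ (Registers σ₀) :=
  pop (.bits .main) (fun v _ => v) (pop (.bits .main) (fun v a => (v.1, a, v.2.2))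
    (branch (fun v => v.2.1.getD false)
      (push (.bits .main) (fun _ => true) (push (.bits .main) (fun _ => true)
        (load (fun v => (v.1, none, v.2.2)) (goto fun _ => l))))
      (load (fun v => (v.1, none, v.2.2)) (goto fun _ => x))))

/-- The intended input is a pair whose first component is a list. Its word begins with `true ::
false` if the list is empty and with `true :: true` otherwise. In the first case only the second
component of the pair is left on the stack. -/
theorem Performs.choose_leaf {P Q : TreeFragment Γ₀ σ₀ Ω} {s : σ₀} {t : ℕ} {w w' : List Bool}
    (h : Performs Q s t w w') :
    Performs (.choose testStmt P Q) s (1 + t) (true :: false :: w) w' :=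
  fun m => .choose_right (fun _ l x => by simp [testStmt, mainOnly]) (h m)

theorem Performs.choose_node {P Q : TreeFragment Γ₀ σ₀ Ω} {s : σ₀} {t : ℕ} {w w' : List Bool}
    (h : Performs P s t (true :: true :: w) w') :
    Performs (.choose testStmt P Q) s (1 + t) (true :: true :: w) w' :=
  fun m => .choose_left (fun _ l x => by simp [testStmt, mainOnly]) (h m)

theorem Performs.loop_leaf {P : TreeFragment Γ₀ σ₀ Ω} {s : σ₀} (w : List Bool) :
    Performs (.loop testStmt P) s 1 (true :: false :: w) w :=
  fun m => .loop_exit fun _ l x => by simp [testStmt, mainOnly]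

theorem Performs.loop_node {P : TreeFragment Γ₀ σ₀ Ω} {s : σ₀} {t t' : ℕ} {w w' w'' : List Bool}
    (h : Performs P s t (true :: true :: w) w') (hl : Performs (.loop testStmt P) s t' w' w'') :
    Performs (.loop testStmt P) s (1 + t + t') (true :: true :: w) w'' :=
  fun m => .loop_round (fun _ l x => by simp [testStmt, mainOnly]) (h m) (hl m)

end TreeFragment

/-! ### Tree representations and polynomial bounds -/

/-- Types whose elements are represented by binary trees. -/
class TreeEncoding (α : Type) where
  /-- the representation -/
  tree : α → BinTree

namespace TreeEncoding

variable {α β γ δ : Type} [TreeEncoding α] [TreeEncoding β] [TreeEncoding γ] [TreeEncoding δ]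

/-- The tree that represents `a`, in prefix notation. -/
def word (a : α) : List Bool := (tree a).word

/-- The number of nodes of the tree that represents `a`. -/
def size (a : α) : ℕ := (word a).length

instance : TreeEncoding Unit := ⟨fun _ => .leaf⟩

instance : TreeEncoding (α × β) := ⟨fun p => .node (tree p.1) (tree p.2)⟩

instance : TreeEncoding (List α) := ⟨fun l => l.foldr (fun a t => .node (tree a) t) .leaf⟩

/-- Numbers are in unary, so that bounds on sizes are bounds on values and arithmetic reduces to
operations on `List Unit`. -/
instance : TreeEncoding ℕ := ⟨fun n => tree (List.replicate n ())⟩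

@[simp] theorem word_unit (a : Unit) : word a = [false] := rfl

@[simp] theorem word_prod (a : α) (b : β) : word (a, b) = true :: (word a ++ word b) := rfl

@[simp] theorem word_nil : word ([] : List α) = [false] := rfl

@[simp] theorem word_cons (a : α) (l : List α) : word (a :: l) = true :: (word a ++ word l) := rfl

@[simp] theorem word_zero : word 0 = [false] := rfl

@[simp] theorem word_succ (n : ℕ) : word (n + 1) = true :: false :: word n := rfl

@[simp] theorem size_unit (a : Unit) : size a = 1 := rfl

@[simp] theorem size_prod (a : α) (b : β) : size (a, b) = size a + size b + 1 := by simp [size]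

@[simp] theorem size_nil : size ([] : List α) = 1 := rfl

@[simp] theorem size_cons (a : α) (l : List α) : size (a :: l) = size a + size l + 1 := by
  simp [size]

@[simp] theorem size_nat (n : ℕ) : size n = 2 * n + 1 := by
  induction n with
  | zero => rfl
  | succ n ih => simp [size] at ih ⊢; omega

theorem size_pos (a : α) : 0 < size a := by
  cases h : tree a <;> simp [size, word, h, BinTree.word]

theorem size_list (l : List α) : size l = (l.map size).sum + l.length + 1 := by
  induction l with
  | nil => rfl
  | cons a l ih => simp [ih]; omega

theorem size_append (l m : List α) : size (l ++ m) + 1 = size l + size m := by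
  simp [size_list]; omega

theorem length_lt_size (l : List α) : l.length < size l := by
  rw [size_list]; omega

theorem size_le_of_mem {a : α} {l : List α} (h : a ∈ l) : size a ≤ size l := by
  rw [size_list]
  have := List.single_le_sum (l := l.map size) (by simp) _ (List.mem_map_of_mem h)
  omega

theorem size_list_le {l : List α} {n b : ℕ} (hl : l.length ≤ n) (h : ∀ a ∈ l, size a ≤ b) :
    size l ≤ n * (b + 1) + 1 := by
  rw [size_list]
  have := List.sum_le_card_nsmul (l.map size) b (by simpa using h)
  simp at this
  have : l.length * b ≤ n * b := by gcongr
  nlinarith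

theorem size_reverse (l : List α) : size l.reverse = size l := by
  simp [size_list]

/-- `f a` is bounded by a polynomial in the size of `a`. -/
def PolyBounded (f : α → ℕ) : Prop := ∃ k : ℕ, ∀ a, f a ≤ (size a + 2) ^ k

namespace PolyBounded

variable {f g : α → ℕ}

theorem of_le (hg : PolyBounded g) (h : ∀ a, f a ≤ g a) : PolyBounded f :=
  let ⟨k, hk⟩ := hg
  ⟨k, fun a => (h a).trans (hk a)⟩

/-- The base of the power in `PolyBounded` is at least 2, so a large exponent absorbs any constant.
-/
theorem const (n : ℕ) : PolyBounded fun _ : α => n := by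
  refine ⟨n, fun a => ?_⟩
  calc n ≤ 2 ^ n := n.lt_two_pow_self.le
    _ ≤ _ := by gcongr; omega

theorem size_self : PolyBounded (size : α → ℕ) := ⟨1, fun a => by simp⟩

theorem add (hf : PolyBounded f) (hg : PolyBounded g) : PolyBounded fun a => f a + g a := by
  obtain ⟨j, hj⟩ := hf
  obtain ⟨k, hk⟩ := hg
  refine ⟨j + k + 1, fun a => ?_⟩
  have h₁ : (size a + 2) ^ j ≤ (size a + 2) ^ (j + k) := by gcongr <;> omega
  have h₂ : (size a + 2) ^ k ≤ (size a + 2) ^ (j + k) := by gcongr <;> omega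
  have := hj a
  have := hk a
  have : (size a + 2) ^ (j + k) * 2 ≤ (size a + 2) ^ (j + k) * (size a + 2) := by
    gcongr; omega
  rw [pow_succ]
  show f a + g a ≤ _
  omega

theorem mul (hf : PolyBounded f) (hg : PolyBounded g) : PolyBounded fun a => f a * g a := by
  obtain ⟨j, hj⟩ := hf
  obtain ⟨k, hk⟩ := hg
  refine ⟨j + k, fun a => ?_⟩
  rw [pow_add]
  exact Nat.mul_le_mul (hj a) (hk a)

theorem pow (hf : PolyBounded f) (n : ℕ) : PolyBounded fun a => f a ^ n := by
  obtain ⟨j, hj⟩ := hf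
  refine ⟨j * n, fun a => ?_⟩
  rw [pow_mul]
  exact Nat.pow_le_pow_left (hj a) n

theorem comp {f : β → ℕ} {g : α → β} (hf : PolyBounded f) (hg : PolyBounded fun a => size (g a)) :
    PolyBounded fun a => f (g a) :=
  let ⟨k, hk⟩ := hf
  ((hg.add (const 2)).pow k).of_le fun a => hk (g a)

theorem fst {f : α → ℕ} (hf : PolyBounded f) : PolyBounded fun p : α × β => f p.1 :=
  hf.comp (size_self.of_le fun p => by rw [size_prod]; omega)

theorem snd {f : β → ℕ} (hf : PolyBounded f) : PolyBounded fun p : α × β => f p.2 :=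
  hf.comp (size_self.of_le fun p => by rw [size_prod]; omega)

theorem polynomial (p : Polynomial ℕ) (hf : PolyBounded f) : PolyBounded fun a => p.eval (f a) := by
  induction p using Polynomial.induction_on' with
  | add p q hp hq => simpa using hp.add hq
  | monomial n c => simpa using (const c).mul (hf.pow n)

end PolyBounded

end TreeEncoding

/-! ### Closure properties of polynomial-time functions on trees -/

open TreeEncoding TreeFragment

/-- The function `f` on trees is computed in polynomial time by a program that may call the machine
`tm`. -/
def PolyTime (tm : Turing.FinTM2) (Ω : Type) {α β : Type} [TreeEncoding α] [TreeEncoding β]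
    (f : α → β) : Prop :=
  ∃ (P : TreeFragment tm.Γ tm.σ Ω) (t : α → ℕ),
    (∀ a, Performs P tm.initialState (t a) (word a) (word (f a))) ∧
    PolyBounded t ∧ PolyBounded fun a => size (f a)

namespace PolyTime

variable {tm : Turing.FinTM2} {Ω : Type} {α β γ δ : Type} [TreeEncoding α] [TreeEncoding β]
  [TreeEncoding γ] [TreeEncoding δ]

theorem size_le {f : α → β} (hf : PolyTime tm Ω f) : PolyBounded fun a => size (f a) :=
  let ⟨_, _, _, _, h⟩ := hf
  h

/-- Changes of type that keep the word cost nothing: `(a, l)` becomes `a :: l`, a list of units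
becomes its length. -/
theorem of_word_eq {f : α → β} (h : ∀ a, word (f a) = word a) : PolyTime tm Ω f := by
  refine ⟨pushWord [], fun _ => 1, fun a => ?_, .const 1, PolyBounded.size_self.of_le fun a => ?_⟩
  · rw [h a]
    exact pushWord_performs [] (word a) tm.initialState
  · simp [size, h a]

theorem id : PolyTime tm Ω (fun a : α => a) := of_word_eq fun _ => rfl

/-- The time of `g` is polynomial in the size of `f a`; this is why `PolyTime` also carries a bound
for the size of the output. -/
theorem comp {g : β → γ} {f : α → β} (hg : PolyTime tm Ω g) (hf : PolyTime tm Ω f) :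
    PolyTime tm Ω fun a => g (f a) := by
  have hf' := hf.size_le
  obtain ⟨P, t, hP, ht, -⟩ := hf
  obtain ⟨Q, u, hQ, hu, hg'⟩ := hg
  exact ⟨P.seq Q, fun a => t a + u (f a), fun a => (hP a).seq (hQ (f a)), ht.add (hu.comp hf'),
    hg'.comp hf'⟩

theorem congr {f g : α → β} (hf : PolyTime tm Ω f) (h : ∀ a, f a = g a) : PolyTime tm Ω g :=
  funext h ▸ hf

/-- Duplicate `c`, apply `g` to the upper copy, exchange, apply `f` to the other copy; the bit
`true` on top then makes a pair of the two results. -/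
theorem pair {f : γ → α} {g : γ → β} (hf : PolyTime tm Ω f) (hg : PolyTime tm Ω g) :
    PolyTime tm Ω fun c => (f c, g c) := by
  have hf' := hf.size_le
  have hg' := hg.size_le
  obtain ⟨P, t, hP, ht, -⟩ := hf
  obtain ⟨Q, u, hQ, hu, -⟩ := hg
  refine ⟨dup.seq (Q.seq (swap.seq (P.seq (pushWord [true])))), fun c => (4 * size c + 5) +
    (u c + ((2 * size (g c) + 2 * size c + 6) + (t c + 1))), fun c => ?_, ?_, ?_⟩
  · have h₄ := ((hP c).append (word (g c))).seq (pushWord_performs [true] _ _)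
    have h₃ := (swap_performs (Γ₀ := tm.Γ) (Ω := Ω) (tree (g c)) (tree c) tm.initialState).seq h₄
    exact (dup_performs (tree c) _).seq (((hQ c).append (word c)).seq h₃)
  · exact (((PolyBounded.const 4).mul .size_self).add (.const 5)).add (hu.add
      (((((PolyBounded.const 2).mul hg').add ((PolyBounded.const 2).mul .size_self)).add
        (.const 6)).add (ht.add (.const 1))))
  · simpa using (hf'.add hg').add (.const 1)

theorem fst {f : γ → α × β} (hf : PolyTime tm Ω f) : PolyTime tm Ω fun c => (f c).1 := by
  have h : PolyTime tm Ω (Prod.fst : α × β → α) := by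
    refine ⟨popBit.seq (swap.seq TreeFragment.drop), fun p => 1 + ((2 * size p.1 + 2 * size p.2 + 6) +
      (2 * size p.2 + 3)), fun p => ?_, ?_, .fst .size_self⟩
    · have h₂ := (drop_performs (Γ₀ := tm.Γ) (Ω := Ω) (tree p.2) tm.initialState).append
        (tree p.1).word
      exact (popBit_performs true _ _).seq ((swap_performs (tree p.1) (tree p.2) _).seq h₂)
    · exact (((PolyBounded.const 10).mul .size_self).add (.const 10)).of_le fun ⟨a, b⟩ => by
        rw [size_prod]; dsimp only; omega
  exact h.comp hf

theorem snd {f : γ → α × β} (hf : PolyTime tm Ω f) : PolyTime tm Ω fun c => (f c).2 := by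
  have h : PolyTime tm Ω (Prod.snd : α × β → β) := by
    refine ⟨popBit.seq TreeFragment.drop, fun p => 1 + (2 * size p.1 + 3), fun p => ?_, ?_,
      .snd .size_self⟩
    · have h₂ := (drop_performs (Γ₀ := tm.Γ) (Ω := Ω) (tree p.1) tm.initialState).append
        (tree p.2).word
      exact (popBit_performs true _ _).seq h₂
    · exact (((PolyBounded.const 10).mul .size_self).add (.const 10)).of_le fun ⟨a, b⟩ => by
        rw [size_prod]; dsimp only; omega
  exact h.comp hf

theorem const (b : β) : PolyTime tm Ω fun _ : α => b := by
  refine ⟨TreeFragment.drop.seq (pushWord (word b)), fun a => (2 * size a + 3) + 1, fun a => ?_, ?_,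
    .const _⟩
  · have h := pushWord_performs (Γ₀ := tm.Γ) (Ω := Ω) (word b) [] tm.initialState
    rw [List.append_nil] at h
    exact (drop_performs (tree a) _).seq h
  · exact (((PolyBounded.const 2).mul .size_self).add (.const 3)).add (.const 1)

theorem cons {f : γ → α} {l : γ → List α} (hf : PolyTime tm Ω f) (hl : PolyTime tm Ω l) :
    PolyTime tm Ω fun c => f c :: l c :=
  comp (g := fun p : α × List α => p.1 :: p.2) (of_word_eq fun _ => rfl) (hf.pair hl)

/-- Distinguish whether a list is empty. -/
theorem listCases {l : γ → List α} {g : γ → β} {h : (α × List α) × γ → β}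
    (hl : PolyTime tm Ω l) (hg : PolyTime tm Ω g) (hh : PolyTime tm Ω h) :
    PolyTime tm Ω fun c => (match l c with
      | [] => g c
      | a :: t => h ((a, t), c) : β) := by
  have key : PolyTime tm Ω fun p : List α × γ => (match p.1 with
      | [] => g p.2
      | a :: t => h ((a, t), p.2) : β) := by
    have hg' := hg.size_le
    have hh' := hh.size_le
    obtain ⟨P, t, hP, ht, -⟩ := hg
    obtain ⟨Q, u, hQ, hu, -⟩ := hh
    obtain ⟨k₁, ht⟩ := ht
    obtain ⟨k₂, hu⟩ := hu
    obtain ⟨k₃, hg'⟩ := hg'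
    obtain ⟨k₄, hh'⟩ := hh'
    refine ⟨.choose testStmt Q P, fun p => 1 + ((size p + 2) ^ k₁ + (size p + 2) ^ k₂), ?_, ?_, ?_⟩
    · rintro ⟨_ | ⟨a, l⟩, c⟩
      · refine Performs.choose_leaf ((hP c).mono ((ht c).trans ?_))
        refine le_add_right (Nat.pow_le_pow_left ?_ _)
        simp only [size_prod]
        omega
      · have h₁ := (hQ ((a, l), c)).mono (hu _)
        -- `((a, l), c)` and `(a :: l, c)` have the same word, so the branch for nonempty lists
        -- starts on the right input without any rearrangement.
        have h₂ : word ((a, l), c) = true :: true :: (word a ++ word l ++ word c) := by simp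
        have h₃ : word (a :: l, c) = true :: true :: (word a ++ word l ++ word c) := by simp
        rw [h₂] at h₁
        rw [h₃]
        refine (Performs.choose_node h₁).mono ?_
        simp only [size_prod, size_cons]
        omega
    · exact (PolyBounded.const 1).add (((PolyBounded.size_self.add (.const 2)).pow k₁).add
        ((PolyBounded.size_self.add (.const 2)).pow k₂))
    · refine ((((PolyBounded.size_self.add (.const 2)).pow k₃)).add
        ((PolyBounded.size_self.add (.const 2)).pow k₄)).of_le ?_
      rintro ⟨_ | ⟨a, l⟩, c⟩
      · refine (hg' c).trans (le_add_right (Nat.pow_le_pow_left ?_ _))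
        simp only [size_prod]
        omega
      · refine (hh' _).trans (le_add_left (Nat.pow_le_pow_left ?_ _))
        simp only [size_prod, size_cons]
        omega
  exact key.comp (hl.pair id)

end PolyTime

open TreeEncoding TreeFragment

/-- The loop keeps the rest of the list, the accumulator and the unchanged context `c`. The rest
comes first, where the test looks for the empty list, and a nonempty rest is already split into head
and tail by its word. The bound `D` is only needed for states that occur. -/
theorem TreeFragment.foldl_performs {K₀ : Type} [DecidableEq K₀] {Γ₀ : K₀ → Type} {σ₀ Ω : Type}
    {α β γ : Type} [TreeEncoding α] [TreeEncoding β] [TreeEncoding γ] {P : TreeFragment Γ₀ σ₀ Ω}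
    {s₀ : σ₀} {g : γ → β → α → β} {t : (α × List α) × (β × γ) → ℕ}
    (hP : ∀ a l s c, Performs P s₀ (t ((a, l), (s, c))) (word ((a, l), (s, c)))
      (word (l, (g c s a, c)))) (c : γ) (l : List α) (s : β) {D : ℕ}
    (hD : ∀ l₁ a l₂, l = l₁ ++ a :: l₂ → t ((a, l₂), (l₁.foldl (g c) s, c)) ≤ D) :
    Performs (.loop testStmt P) s₀ (l.length * (D + 1) + 1) (word (l, (s, c)))
      (word (l.foldl (g c) s, c)) := by
  induction l generalizing s with
  | nil => simpa using Performs.loop_leaf (P := P) (s := s₀) (word (s, c))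
  | cons a l ih =>
    have h₁ := (hP a l s c).mono (hD [] a l rfl)
    have h₂ : word ((a, l), (s, c)) = true :: true :: (word a ++ word l ++ word (s, c)) := by simp
    have h₃ : word (a :: l, (s, c)) = true :: true :: (word a ++ word l ++ word (s, c)) := by simp
    rw [h₂] at h₁
    rw [h₃]
    refine (h₁.loop_node (ih (g c s a) fun l₁ a' l₂ h => hD (a :: l₁) a' l₂ (by simp [h]))).mono ?_
    simp only [List.length_cons, Nat.add_one_mul]
    omega

namespace PolyTime

variable {tm : Turing.FinTM2} {Ω : Type} {α β γ δ : Type} [TreeEncoding α] [TreeEncoding β]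
  [TreeEncoding γ] [TreeEncoding δ]

theorem foldl_body {g : γ → β → α → β}
    (hg : PolyTime tm Ω fun x : γ × β × α => g x.1 x.2.1 x.2.2) :
    PolyTime tm Ω fun x : (α × List α) × (β × γ) => (x.1.2, (g x.2.2 x.2.1 x.1.1, x.2.2)) :=
  id.fst.snd.pair ((hg.comp (f := fun x : (α × List α) × (β × γ) => (x.2.2, x.2.1, x.1.1))
    (id.snd.snd.pair (id.snd.fst.pair id.fst.fst))).pair id.snd.snd)

/-- A fold whose intermediate values are of polynomial size. -/
theorem foldl {l : γ → List α} {b : γ → β} {g : γ → β → α → β} (hl : PolyTime tm Ω l)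
    (hb : PolyTime tm Ω b) (hg : PolyTime tm Ω fun x : γ × β × α => g x.1 x.2.1 x.2.2)
    {bd : γ → ℕ} (hbd : PolyBounded bd)
    (h : ∀ c l₁ l₂, l c = l₁ ++ l₂ → size (l₁.foldl (g c) (b c)) ≤ bd c) :
    PolyTime tm Ω fun c => (l c).foldl (g c) (b c) := by
  have key : PolyTime tm Ω fun c => ((l c).foldl (g c) (b c), c) := by
    have hl' := hl.size_le
    obtain ⟨P, t, hP, ht, -⟩ := hl.pair (hb.pair id)
    obtain ⟨Q, u, hQ, ⟨k, hu⟩, -⟩ := foldl_body hg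
    refine ⟨P.seq (.loop testStmt Q), fun c => t c +
      (size (l c) * ((size (l c) + bd c + size c + 5) ^ k + 1) + 1), fun c => ?_, ?_, ?_⟩
    · refine (hP c).seq ((foldl_performs (g := g) (fun a l s c => hQ ((a, l), (s, c))) c (l c) (b c)
        (D := (size (l c) + bd c + size c + 5) ^ k) ?_).mono ?_)
      -- Before each round the rest of the list is part of `l c` and the accumulator is bounded by
      -- `bd c`; the summand 5 covers the nodes of the pairs and the 2 in the base of `PolyBounded`.
      · intro l₁ a l₂ h'
        refine (hu _).trans (Nat.pow_le_pow_left ?_ _)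
        have h₁ := h c l₁ _ h'
        have h₂ := size_append l₁ (a :: l₂)
        have h₃ := size_pos l₁
        rw [h']
        simp only [size_prod, size_cons] at h₂ ⊢
        omega
      · gcongr
        exact (length_lt_size _).le
    · exact ht.add ((hl'.mul ((((((hl'.add hbd).add .size_self)).add (.const 5)).pow k).add
        (.const 1))).add (.const 1))
    · refine ((hbd.add .size_self).add (.const 1)).of_le fun c => ?_
      have := h c (l c) [] (by simp)
      rw [size_prod]
      omega
  exact key.fst

theorem reverse {l : γ → List α} (hl : PolyTime tm Ω l) : PolyTime tm Ω fun c => (l c).reverse := by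
  have h : ∀ l₁ l₂ : List α, l₁.foldl (fun s a => a :: s) l₂ = l₁.reverse ++ l₂ := by
    intro l₁
    induction l₁ with
    | nil => simp
    | cons a l₁ ih => simp [ih]
  refine (foldl (b := fun _ => []) (g := fun _ s a => a :: s) hl (const _)
    (cons id.snd.snd id.snd.fst) hl.size_le fun c l₁ l₂ h' => ?_).congr fun c => ?_
  · have := size_append l₁ l₂
    have := size_pos l₂
    rw [h', h, List.append_nil, size_reverse]
    omega
  · rw [h, List.append_nil]

theorem append {l m : γ → List α} (hl : PolyTime tm Ω l) (hm : PolyTime tm Ω m) :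
    PolyTime tm Ω fun c => l c ++ m c := by
  have h : ∀ l₁ l₂ : List α, l₁.foldl (fun s a => a :: s) l₂ = l₁.reverse ++ l₂ := by
    intro l₁
    induction l₁ with
    | nil => simp
    | cons a l₁ ih => simp [ih]
  refine (foldl (b := m) (g := fun _ s a => a :: s) hl.reverse hm
    (cons id.snd.snd id.snd.fst) (hl.size_le.add hm.size_le) fun c l₁ l₂ h' => ?_).congr
      fun c => ?_
  · have h₁ := size_append l₁ l₂
    have h₂ := size_pos l₂
    have h₃ := size_append l₁.reverse (m c)
    rw [← h', size_reverse] at h₁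
    rw [size_reverse] at h₃
    rw [h]
    omega
  · rw [h, List.reverse_reverse]

theorem flatMap {l : γ → List α} {f : γ → α → List β} (hl : PolyTime tm Ω l)
    (hf : PolyTime tm Ω fun x : γ × α => f x.1 x.2) :
    PolyTime tm Ω fun c => (l c).flatMap (f c) := by
  have h : ∀ (f : α → List β) (l₁ : List α) (l₂ : List β),
      l₁.foldl (fun s a => s ++ f a) l₂ = l₂ ++ l₁.flatMap f := by
    intro f l₁
    induction l₁ with
    | nil => simp
    | cons a l₁ ih => simp [ih]
  obtain ⟨k, hk⟩ := hf.size_le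
  refine (foldl (b := fun _ => []) (g := fun c s a => s ++ f c a) hl (const _)
    (append id.snd.fst (hf.comp (id.fst.pair id.snd.snd)))
    (bd := fun c => size (l c) * ((size c + size (l c) + 3) ^ k + 1) + 1)
    ((hl.size_le.mul ((((PolyBounded.size_self.add hl.size_le).add (.const 3)).pow k).add
      (.const 1))).add (.const 1)) fun c l₁ l₂ h' => ?_).congr fun c => ?_
  · rw [h, List.nil_append]
    have h₁ : ∀ a ∈ l₁, size (f c a) ≤ (size c + size (l c) + 3) ^ k := by
      intro a ha
      refine (hk (c, a)).trans (Nat.pow_le_pow_left ?_ _)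
      have := size_le_of_mem (l := l c) (a := a) (by simp [h', ha])
      rw [size_prod]
      omega
    have h₂ : l₁.length ≤ size (l c) := by
      have := length_lt_size (l c)
      simp [h'] at this ⊢
      omega
    have h₃ : ∀ l₃ : List α, (∀ a ∈ l₃, size (f c a) ≤ (size c + size (l c) + 3) ^ k) →
        size (l₃.flatMap (f c)) ≤ l₃.length * ((size c + size (l c) + 3) ^ k + 1) + 1 := by
      intro l₃
      induction l₃ with
      | nil => simp
      | cons a l₃ ih =>
        intro h₄
        have h₅ := ih fun a ha => h₄ a (by simp [ha])
        have h₆ := h₄ a (by simp)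
        have h₇ := size_append (f c a) (l₃.flatMap (f c))
        rw [List.flatMap_cons, List.length_cons, Nat.add_one_mul]
        omega
    refine (h₃ l₁ h₁).trans ?_
    gcongr
  · rw [h, List.nil_append]

theorem map {l : γ → List α} {f : γ → α → β} (hl : PolyTime tm Ω l)
    (hf : PolyTime tm Ω fun x : γ × α => f x.1 x.2) :
    PolyTime tm Ω fun c => (l c).map (f c) :=
  (flatMap (f := fun c a => [f c a]) hl (hf.cons (const []))).congr fun c => by
    induction l c <;> simp_all

theorem headD {l : γ → List α} {d : γ → α} (hl : PolyTime tm Ω l) (hd : PolyTime tm Ω d) :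
    PolyTime tm Ω fun c => (l c).headD (d c) :=
  (listCases (h := fun x : (α × List α) × γ => x.1.1) hl hd id.fst.fst).congr fun c => by
    cases l c <;> rfl

theorem tail {l : γ → List α} (hl : PolyTime tm Ω l) : PolyTime tm Ω fun c => (l c).tail :=
  (listCases (h := fun x : (α × List α) × γ => x.1.2) (g := fun _ => []) hl (const [])
    id.fst.snd).congr fun c => by cases l c <;> rfl

theorem replicate_unit {n : γ → ℕ} (hn : PolyTime tm Ω n) :
    PolyTime tm Ω fun c => List.replicate (n c) () :=
  comp (g := fun n : ℕ => List.replicate n ()) (of_word_eq fun _ => rfl) hn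

theorem length_unit {l : γ → List Unit} (hl : PolyTime tm Ω l) :
    PolyTime tm Ω fun c => (l c).length :=
  comp (g := fun l : List Unit => l.length) (of_word_eq fun l => by
    show (tree (List.replicate l.length ())).word = (tree l).word
    rw [← List.eq_replicate_of_mem (a := ()) (l := l) fun _ _ => rfl]) hl

theorem length {l : γ → List α} (hl : PolyTime tm Ω l) : PolyTime tm Ω fun c => (l c).length :=
  (length_unit (map (f := fun _ _ => ()) hl (const ()))).congr fun c => by simp

/-- An iteration whose intermediate values are of polynomial size. -/
theorem iterate {n : γ → ℕ} {b : γ → β} {g : γ → β → β} (hn : PolyTime tm Ω n)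
    (hb : PolyTime tm Ω b) (hg : PolyTime tm Ω fun x : γ × β => g x.1 x.2) {bd : γ → ℕ}
    (hbd : PolyBounded bd) (h : ∀ c, ∀ i ≤ n c, size ((g c)^[i] (b c)) ≤ bd c) :
    PolyTime tm Ω fun c => (g c)^[n c] (b c) := by
  have key : ∀ c (l : List Unit) (s : β),
      l.foldl (fun s _ => g c s) s = (g c)^[l.length] s := by
    intro c l
    induction l with
    | nil => simp
    | cons a l ih => simp [ih]
  refine (foldl (g := fun c s (_ : Unit) => g c s) hn.replicate_unit hb
    (hg.comp (id.fst.pair id.snd.fst)) hbd fun c l₁ l₂ h' => ?_).congr fun c => ?_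
  · rw [key]
    refine h c _ ?_
    have := congrArg List.length h'
    simp at this
    omega
  · rw [key]; simp

theorem succ {n : γ → ℕ} (hn : PolyTime tm Ω n) : PolyTime tm Ω fun c => n c + 1 :=
  (length_unit (cons (const ()) hn.replicate_unit)).congr fun c => by simp

theorem add {m n : γ → ℕ} (hm : PolyTime tm Ω m) (hn : PolyTime tm Ω n) :
    PolyTime tm Ω fun c => m c + n c :=
  (length_unit (append hm.replicate_unit hn.replicate_unit)).congr fun c => by simp

theorem mul {m n : γ → ℕ} (hm : PolyTime tm Ω m) (hn : PolyTime tm Ω n) :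
    PolyTime tm Ω fun c => m c * n c :=
  (length_unit (flatMap (f := fun c (_ : Unit) => List.replicate (n c) ()) hm.replicate_unit
    (hn.comp id.fst).replicate_unit)).congr fun c => by simp

theorem sub {m n : γ → ℕ} (hm : PolyTime tm Ω m) (hn : PolyTime tm Ω n) :
    PolyTime tm Ω fun c => m c - n c := by
  have h : ∀ (i : ℕ) (l : List Unit), (List.tail)^[i] l = l.drop i := by
    intro i
    induction i with
    | zero => simp
    | succ i ih => intro l; simp [ih]
  refine (length_unit (iterate (g := fun _ (l : List Unit) => l.tail) hn hm.replicate_unit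
    id.snd.tail hm.size_le fun c i _ => ?_)).congr fun c => ?_
  · rw [h, size_list, size_nat]
    simp
    omega
  · rw [h]; simp

/-- Distinguish whether a number is zero. -/
theorem ite_zero {n : γ → ℕ} {f g : γ → β} (hn : PolyTime tm Ω n) (hf : PolyTime tm Ω f)
    (hg : PolyTime tm Ω g) : PolyTime tm Ω fun c => if n c = 0 then f c else g c :=
  (listCases (h := fun x : (Unit × List Unit) × γ => g x.2) hn.replicate_unit hf
    (hg.comp id.snd)).congr fun c => by
      cases n c <;> simp [List.replicate_succ]

theorem ite_eq {m n : γ → ℕ} {f g : γ → β} (hm : PolyTime tm Ω m) (hn : PolyTime tm Ω n)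
    (hf : PolyTime tm Ω f) (hg : PolyTime tm Ω g) :
    PolyTime tm Ω fun c => if m c = n c then f c else g c :=
  (ite_zero ((hm.sub hn).add (hn.sub hm)) hf hg).congr fun c => by
    congr 1
    simp
    omega

theorem drop {n : γ → ℕ} {l : γ → List α} (hn : PolyTime tm Ω n) (hl : PolyTime tm Ω l) :
    PolyTime tm Ω fun c => (l c).drop (n c) := by
  have h : ∀ (i : ℕ) (l : List α), (List.tail)^[i] l = l.drop i := by
    intro i
    induction i with
    | zero => simp
    | succ i ih => intro l; simp [ih]
  refine (iterate (g := fun _ (l : List α) => l.tail) hn hl id.snd.tail hl.size_le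
    fun c i _ => ?_).congr fun c => h _ _
  have h₁ := size_append ((l c).take i) ((l c).drop i)
  have h₂ := size_pos ((l c).take i)
  rw [List.take_append_drop] at h₁
  rw [h]
  omega

theorem getD {l : γ → List α} {n : γ → ℕ} {d : γ → α} (hl : PolyTime tm Ω l)
    (hn : PolyTime tm Ω n) (hd : PolyTime tm Ω d) :
    PolyTime tm Ω fun c => (l c).getD (n c) (d c) :=
  (headD (hn.drop hl) hd).congr fun c => by
    rw [List.headD_eq_head?_getD, List.head?_drop, List.getD_eq_getElem?_getD]

theorem sum {l : γ → List ℕ} (hl : PolyTime tm Ω l) : PolyTime tm Ω fun c => (l c).sum :=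
  (length_unit (flatMap (f := fun _ n => List.replicate n ()) hl id.snd.replicate_unit)).congr
    fun c => by simp

theorem replicate {n : γ → ℕ} {a : γ → α} (hn : PolyTime tm Ω n) (ha : PolyTime tm Ω a) :
    PolyTime tm Ω fun c => List.replicate (n c) (a c) :=
  (map (f := fun c (_ : Unit) => a c) hn.replicate_unit (ha.comp id.fst)).congr fun c => by simp

theorem range {n : γ → ℕ} (hn : PolyTime tm Ω n) : PolyTime tm Ω fun c => List.range (n c) := by
  have h : ∀ i : ℕ, (fun l : List ℕ => l ++ [l.length])^[i] [] = List.range i := by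
    intro i
    induction i with
    | zero => simp
    | succ i ih => rw [Function.iterate_succ_apply', ih, List.range_succ, List.length_range]
  refine (iterate (g := fun _ (l : List ℕ) => l ++ [l.length]) (b := fun _ => []) hn (const _)
    (id.snd.append (id.snd.length.cons (const _)))
    (bd := fun c => size (n c) * (size (n c) + 1) + 1)
    ((hn.size_le.mul (hn.size_le.add (.const 1))).add (.const 1)) fun c i hi => ?_).congr
      fun c => h _
  rw [h]
  refine size_list_le ?_ fun a ha => ?_
  · simp; omega
  · simp at ha ⊢; omega

/-- Quotient and remainder, by counting. -/
theorem div_mod {m n : γ → ℕ} (hm : PolyTime tm Ω m) (hn : PolyTime tm Ω n)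
    (h0 : ∀ c, 0 < n c) : PolyTime tm Ω fun c => (m c / n c, m c % n c) := by
  have h : ∀ c i, (fun p : ℕ × ℕ => if p.2 + 1 = n c then (p.1 + 1, 0) else (p.1, p.2 + 1))^[i]
      (0, 0) = (i / n c, i % n c) := by
    intro c i
    induction i with
    | zero => simp
    | succ i ih =>
      rw [Function.iterate_succ_apply', ih, Nat.succ_div, Nat.add_mod i 1]
      have := Nat.mod_lt i (h0 c)
      have h₁ : n c ∣ i + 1 ↔ i % n c + 1 = n c := by
        constructor
        · intro hd
          have h₂ : (i % n c + 1) % n c = 0 := by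
            rw [Nat.mod_add_mod]; exact Nat.mod_eq_zero_of_dvd hd
          by_contra h₃
          rw [Nat.mod_eq_of_lt (by omega)] at h₂
          omega
        · intro hd
          rw [Nat.dvd_iff_mod_eq_zero, ← Nat.mod_add_mod, hd, Nat.mod_self]
      simp only [h₁]
      rcases eq_or_ne (i % n c + 1) (n c) with h₂ | h₂
      · simp [h₂]
      · have h₃ : (i + 1) % n c = i % n c + 1 := by
          rw [← Nat.mod_add_mod, Nat.mod_eq_of_lt (by omega)]
        simp [h₂, h₃]
  refine (iterate (γ := γ) (b := fun _ => ((0, 0) : ℕ × ℕ))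
    (g := fun c (p : ℕ × ℕ) => if p.2 + 1 = n c then (p.1 + 1, 0) else (p.1, p.2 + 1)) hm (const _)
    (ite_eq id.snd.snd.succ (hn.comp id.fst) (id.snd.fst.succ.pair (const 0))
      (id.snd.fst.pair id.snd.snd.succ)) (bd := fun c => 2 * size (m c) + 1)
    (((PolyBounded.const 2).mul hm.size_le).add (.const 1)) fun c i hi => ?_).congr fun c => h _ _
  rw [h]
  have := Nat.div_le_self i (n c)
  have := Nat.mod_le i (n c)
  simp only [size_prod, size_nat]
  omega

end PolyTime

/-! ### Calling the assumed algorithm as a subroutine -/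

open TreeEncoding TreeFragment

/-- The number of symbols that a statement pushes at most. -/
def Turing.TM2.Stmt.pushCount {K : Type} {Γ : K → Type} {Λ σ : Type} :
    Turing.TM2.Stmt Γ Λ σ → ℕ
  | .push _ _ q => q.pushCount + 1
  | .peek _ _ q => q.pushCount
  | .pop _ _ q => q.pushCount
  | .load _ q => q.pushCount
  | .branch _ q₁ q₂ => q₁.pushCount + q₂.pushCount
  | .goto _ => 0
  | .halt => 0

theorem Turing.TM2.length_stepAux_le {K : Type} [DecidableEq K] {Γ : K → Type} {Λ σ : Type}
    (q : Turing.TM2.Stmt Γ Λ σ) (v : σ) (S : ∀ k, List (Γ k)) (k : K) :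
    ((Turing.TM2.stepAux q v S).stk k).length ≤ (S k).length + q.pushCount := by
  induction q generalizing v S with
  | push j f q ih =>
    refine (ih _ _).trans ?_
    rcases eq_or_ne k j with rfl | h
    · simp [Stmt.pushCount]; omega
    · simp [Stmt.pushCount, h]
  | peek j f q ih => exact ih _ _
  | pop j f q ih =>
    refine (ih _ _).trans ?_
    rcases eq_or_ne k j with rfl | h
    · simp [Stmt.pushCount]
    · simp [Stmt.pushCount, h]
  | load f q ih => exact ih _ _
  | branch f q₁ q₂ h₁ h₂ =>
    have h₁ := h₁ v S
    have h₂ := h₂ v S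
    cases h : f v <;> simp [Stmt.pushCount, h] <;> omega
  | goto f => simp
  | halt => simp

/-- There are finitely many labels, so the number of symbols pushed in one step is bounded. Hence a
polynomial-time machine has output of polynomial length. -/
theorem Turing.FinTM2.exists_length_le (tm : Turing.FinTM2) : ∃ C : ℕ, ∀ (n : ℕ)
    (c c' : tm.Cfg) (k : tm.K), (flip Option.bind tm.step)^[n] (some c) = some c' →
      (c'.stk k).length ≤ (c.stk k).length + n * C := by
  have := tm.ΛFin
  refine ⟨Finset.univ.sup fun l => (tm.m l).pushCount, fun n => ?_⟩
  induction n with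
  | zero =>
    rintro c c' k h
    simp at h
    simp [h]
  | succ n ih =>
    intro c c' k h
    rw [Function.iterate_succ_apply] at h
    obtain ⟨_ | l, v, S⟩ := c
    -- A halted configuration has no successor, so it cannot be followed by `n + 1` steps.
    · have h₁ : ∀ m, (flip Option.bind tm.step)^[m] none = none := by
        intro m
        induction m with
        | zero => rfl
        | succ m ih => rw [Function.iterate_succ_apply', ih]; rfl
      exact absurd ((h₁ n).symm.trans h) (by simp)
    · refine (ih _ _ k h).trans ?_
      have h₁ := Turing.TM2.length_stepAux_le (tm.m l) v S k
      have h₂ := Finset.le_sup (f := fun l => (tm.m l).pushCount) (Finset.mem_univ l)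
      simp only [Nat.add_one_mul] at h₂ ⊢
      omega

namespace Turing.FinTM2

variable (tm : Turing.FinTM2)

theorem initList_nil_stk : (Turing.initList tm []).stk = fun _ => [] := by
  funext k
  by_cases h : k = tm.k₀
  · subst h; simp [Turing.initList]
  · simp [Turing.initList, h]

theorem initList_stk_self (s : List (tm.Γ tm.k₀)) : (Turing.initList tm s).stk tm.k₀ = s := by
  simp [Turing.initList]

theorem length_initList_stk_le (s : List (tm.Γ tm.k₀)) (k : tm.K) :
    ((Turing.initList tm s).stk k).length ≤ s.length := by
  by_cases h : k = tm.k₀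
  · subst h; simp [Turing.initList]
  · simp [Turing.initList, h]

theorem haltList_stk_self (s : List (tm.Γ tm.k₁)) : (Turing.haltList tm s).stk tm.k₁ = s := by
  simp [Turing.haltList]

theorem haltList_nil_stk : (Turing.haltList tm []).stk = fun _ => [] := by
  funext k
  by_cases h : k = tm.k₁
  · subst h; simp [Turing.haltList]
  · simp [Turing.haltList, h]

theorem update_initList_stk (s s' : List (tm.Γ tm.k₀)) :
    Function.update (Turing.initList tm s).stk tm.k₀ s' = (Turing.initList tm s').stk := by
  funext k
  by_cases h : k = tm.k₀
  · subst h; simp [Turing.initList]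
  · simp [Turing.initList, h]

theorem update_haltList_stk (s s' : List (tm.Γ tm.k₁)) :
    Function.update (Turing.haltList tm s).stk tm.k₁ s' = (Turing.haltList tm s').stk := by
  funext k
  by_cases h : k = tm.k₁
  · subst h; simp [Turing.haltList]
  · simp [Turing.haltList, h]

end Turing.FinTM2

namespace TreeFragment

open Turing.TM2 Stmt

/-- A statement of the subroutine as a statement of the host; the subroutine halts by going
to `x`. -/
def embedStmt {K₀ : Type} {Γ₀ : K₀ → Type} {Λ₀ σ₀ Ω Λ : Type} (e : Λ₀ → Λ) (x : Λ) :
    Stmt Γ₀ Λ₀ σ₀ → Stmt (StackName.Alphabet Γ₀ Ω) Λ (Registers σ₀)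
  | .push k f q => .push (.sub k) (fun v => f v.1) (embedStmt e x q)
  | .peek k f q => .peek (.sub k) (fun v a => (f v.1 a, v.2)) (embedStmt e x q)
  | .pop k f q => .pop (.sub k) (fun v a => (f v.1 a, v.2)) (embedStmt e x q)
  | .load f q => .load (fun v => (f v.1, v.2)) (embedStmt e x q)
  | .branch f q₁ q₂ => .branch (fun v => f v.1) (embedStmt e x q₁) (embedStmt e x q₂)
  | .goto f => .goto fun v => e (f v.1)
  | .halt => .goto fun _ => x

theorem stepAux_embedStmt {K₀ : Type} [DecidableEq K₀] {Γ₀ : K₀ → Type} {Λ₀ σ₀ Ω Λ : Type}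
    (e : Λ₀ → Λ) (x : Λ) (q : Stmt Γ₀ Λ₀ σ₀) (v : σ₀) (r : Option Bool × Option (Fin 8))
    (i : List Bool) (o : List Ω) (b : BitStack → List Bool) (T : ∀ k, List (Γ₀ k)) :
    stepAux (embedStmt e x q) (v, r) (allStacks i o b T) =
      ⟨some ((stepAux q v T).l.elim x e), ((stepAux q v T).var, r),
        allStacks i o b (stepAux q v T).stk⟩ := by
  induction q generalizing v T with
  | push k f q ih => simp [embedStmt, ih]
  | peek k f q ih => simp [embedStmt, ih]
  | pop k f q ih => simp [embedStmt, ih]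
  | load f q ih => simp [embedStmt, ih]
  | branch f q₁ q₂ h₁ h₂ => cases h : f v <;> simp [embedStmt, h, h₁, h₂]
  | goto f => simp [embedStmt]
  | halt => simp [embedStmt]

/-- Call the subroutine. -/
def call (tm : Turing.FinTM2) (Ω : Type) : TreeFragment tm.Γ tm.σ Ω where
  Label := tm.Λ
  labelFintype := tm.ΛFin
  entry := tm.main
  code e x l := embedStmt e x (tm.m l)

/-- In `haltList` the internal state is the initial one and all stacks but the output are empty, so
the host can go on, and even call again, without cleaning up. -/
theorem call_runs (tm : Turing.FinTM2) (Ω : Type) {s : List (tm.Γ tm.k₀)}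
    {s' : List (tm.Γ tm.k₁)} {n : ℕ} (i : List Bool) (o : List Ω) (b : BitStack → List Bool)
    (h : (flip Option.bind tm.step)^[n] (some (Turing.initList tm s)) =
      some (Turing.haltList tm s')) :
    (call tm Ω).Runs (tm.initialState, none, none) n
      (allStacks i o b (Turing.initList tm s).stk) (allStacks i o b (Turing.haltList tm s').stk) := by
  intro Λ M e x hM
  have key : ∀ (n : ℕ) (c c' : tm.Cfg), c'.l = none →
      (flip Option.bind tm.step)^[n] (some c) = some c' →
      ReachesIn M n ⟨some (c.l.elim x e), (c.var, none, none), allStacks i o b c.stk⟩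
        ⟨some x, (c'.var, none, none), allStacks i o b c'.stk⟩ := by
    intro n
    induction n with
    | zero =>
      intro c c' hc' h
      simp at h
      subst h
      rw [hc']
      exact .refl _ _
    | succ n ih =>
      intro c c' hc' h
      rw [Function.iterate_succ_apply] at h
      obtain ⟨_ | l, v, S⟩ := c
      · have h₁ : ∀ m, (flip Option.bind tm.step)^[m] none = none := by
          intro m
          induction m with
          | zero => rfl
          | succ m ih => rw [Function.iterate_succ_apply', ih]; rfl
        exact absurd ((h₁ n).symm.trans h) (by simp)
      · have h₁ := ih _ _ hc' h
        rw [add_comm]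
        refine (ReachesIn.step ?_).trans h₁
        rw [show M ((some l).elim x e) = _ from hM l]
        exact stepAux_embedStmt e x (tm.m l) v (none, none) i o b S
  exact key n _ _ rfl h

variable {tm : Turing.FinTM2} {Ω : Type}

/-- Move a number from the main stack to the input of the subroutine. -/
def loadNat (a : tm.Γ tm.k₀) : TreeFragment tm.Γ tm.σ Ω :=
  Fragment.single fun l x => pop (.bits .main) (fun v a => (v.1, a, v.2.2))
    (branch (fun v => v.2.1.getD false)
      (pop (.bits .main) (fun v _ => v) (push (.sub tm.k₀) (fun _ => a)
        (load (fun v => (v.1, none, v.2.2)) (goto fun _ => l))))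
      (load (fun v => (v.1, none, v.2.2)) (goto fun _ => x)))

theorem loadNat_runs (a : tm.Γ tm.k₀) (n : ℕ) (m : List Bool) (s : List (tm.Γ tm.k₀)) :
    (loadNat (Ω := Ω) a).Runs (tm.initialState, none, none) (n + 1)
      (allStacks [] [] (bitStacks (word n ++ m) [] [] []) (Turing.initList tm s).stk)
      (allStacks [] [] (bitStacks m [] [] [])
        (Turing.initList tm (List.replicate n a ++ s)).stk) := by
  induction n generalizing s with
  | zero => exact .single fun _ l x => by simp
  | succ n ih =>
    refine ((Fragment.Runs.single_round (fun _ l x => ?_) (ih (a :: s))).mono (by omega)).congr ?_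
    · simp [tm.update_initList_stk, tm.initList_stk_self]
    · rw [List.replicate_succ', List.append_assoc]
      rfl

/-- Push a symbol on the input of the subroutine. -/
def pushInput (a : tm.Γ tm.k₀) : TreeFragment tm.Γ tm.σ Ω :=
  Fragment.single fun _ x => push (.sub tm.k₀) (fun _ => a) (goto fun _ => x)

theorem pushInput_runs (a : tm.Γ tm.k₀) (m : List Bool) (s : List (tm.Γ tm.k₀)) :
    (pushInput (Ω := Ω) a).Runs (tm.initialState, none, none) 1
      (allStacks [] [] (bitStacks m [] [] []) (Turing.initList tm s).stk)
      (allStacks [] [] (bitStacks m [] [] []) (Turing.initList tm (a :: s)).stk) :=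
  .single fun _ l x => by simp [tm.update_initList_stk, tm.initList_stk_self]

/-- Turn the output of the subroutine into a list of codes on the main stack. -/
def unload (code : tm.Γ tm.k₁ → Fin 3) : TreeFragment tm.Γ tm.σ Ω :=
  Fragment.single fun l x =>
    pop (.sub tm.k₁) (fun v a => (v.1, v.2.1, a.map fun a => (code a).castLE (by omega)))
      (branch (fun v => v.2.2 == none) (goto fun _ => x)
        (branch (fun v => v.2.2 == some 0)
          (pushWordStmt (true :: word 0) (load (fun v => (v.1, none, none)) (goto fun _ => l)))
          (branch (fun v => v.2.2 == some 1)
            (pushWordStmt (true :: word 1) (load (fun v => (v.1, none, none)) (goto fun _ => l)))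
            (pushWordStmt (true :: word 2)
              (load (fun v => (v.1, none, none)) (goto fun _ => l))))))

/-- The output is popped from its beginning and the codes are consed, hence the reversal; the parser
reads the list in this order. -/
theorem unload_runs (code : tm.Γ tm.k₁ → Fin 3) (s : List (tm.Γ tm.k₁)) (l : List ℕ)
    (m : List Bool) :
    (unload (Ω := Ω) code).Runs (tm.initialState, none, none) (s.length + 1)
      (allStacks [] [] (bitStacks (word l ++ m) [] [] []) (Turing.haltList tm s).stk)
      (allStacks [] [] (bitStacks (word ((s.map fun a => (code a : ℕ)).reverse ++ l) ++ m) [] [] [])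
        fun _ => []) := by
  induction s generalizing l with
  | nil =>
    exact .single fun _ l x => by
      simp [tm.haltList_nil_stk]
  | cons a s ih =>
    refine ((Fragment.Runs.single_round (fun _ e x => ?_)
      (ih ((code a : ℕ) :: l))).mono (by simp; omega)).congr (by simp)
    have h : code a = 0 ∨ code a = 1 ∨ code a = 2 := by omega
    rcases h with h | h | h <;>
      simp [tm.haltList_stk_self, tm.update_haltList_stk, stepAux_pushWordStmt, h]

end TreeFragment

/-- The codes of the punctuation symbols. -/
def Punct.code : Punct → Fin 3
  | .tick => 0
  | .comma => 1
  | .semicolon => 2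

theorem encodeUnaryPair_eq (m n : ℕ) :
    encodeUnaryPair (m, n) = List.replicate m true ++ ([false] ++ List.replicate n true) := rfl

/-- A function computed by a machine in polynomial time can be called as a subroutine. -/
theorem PolyTime.call {g : ℕ × ℕ → List Punct}
    (A : Turing.TM2ComputableInPolyTime encodeUnaryPair (_root_.id : List Punct → List Punct) g)
    (Ω : Type) :
    PolyTime A.tm Ω fun p : ℕ × ℕ => ((g p).map fun a => (a.code : ℕ)).reverse := by
  obtain ⟨C, hC⟩ := A.tm.exists_length_le
  have hin : ∀ p : ℕ × ℕ, (encodeUnaryPair p).length = p.1 + p.2 + 1 := by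
    rintro ⟨a, b⟩
    simp [encodeUnaryPair_eq]
    omega
  have hlen : ∀ p : ℕ × ℕ, (g p).length ≤ (p.1 + p.2 + 1) + A.time.eval (p.1 + p.2 + 1) * C := by
    intro p
    obtain ⟨⟨n, hn⟩, hn'⟩ := A.outputsFun p
    have h₁ := hC n _ _ A.tm.k₁ hn
    have h₂ := A.tm.length_initList_stk_le ((encodeUnaryPair p).map A.inputAlphabet.invFun) A.tm.k₁
    rw [A.tm.haltList_stk_self] at h₁
    rw [hin] at hn'
    simp only [List.length_map, hin, id_eq] at h₁ h₂
    have : n * C ≤ A.time.eval (p.1 + p.2 + 1) * C := by gcongr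
    omega
  have hsize : PolyBounded fun p : ℕ × ℕ => p.1 + p.2 + 1 :=
    PolyBounded.size_self.of_le fun ⟨a, b⟩ => by simp; omega
  have hlen' : PolyBounded fun p : ℕ × ℕ => (g p).length :=
    (hsize.add ((hsize.polynomial A.time).mul (.const C))).of_le hlen
  -- The pair is exchanged because a stack is filled from its far end: first the ticks of `n`, then
  -- the separator, then those of `m`.
  refine PolyTime.congr (f := fun p : ℕ × ℕ =>
    ((g ((p.2, p.1).2, (p.2, p.1).1)).map fun a => (a.code : ℕ)).reverse) ?_ fun p => rfl
  refine PolyTime.comp (g := fun q : ℕ × ℕ =>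
    ((g (q.2, q.1)).map fun a => (a.code : ℕ)).reverse) ?_ (id.snd.pair id.fst)
  let t := A.inputAlphabet.invFun true
  refine ⟨popBit.seq ((loadNat t).seq ((pushInput (A.inputAlphabet.invFun false)).seq
    ((loadNat t).seq ((TreeFragment.call A.tm Ω).seq ((pushWord [false]).seq
      (unload fun a => (A.outputAlphabet a).code)))))),
    fun q => 1 + ((q.1 + 1) + (1 + ((q.2 + 1) + (A.time.eval (q.1 + q.2 + 1) +
      (1 + ((g (q.2, q.1)).length + 1)))))), ?_, ?_, ?_⟩
  · rintro ⟨n, m⟩ w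
    obtain ⟨⟨k, hk⟩, hk'⟩ := A.outputsFun (m, n)
    rw [hin] at hk'
    have h₁ := popBit_runs (Γ₀ := A.tm.Γ) (Ω := Ω) true A.tm.initialState [] []
      (word n ++ (word m ++ w)) [] [] [] (Turing.initList A.tm []).stk
    have h₂ := loadNat_runs (Ω := Ω) t n (word m ++ w) []
    have h₃ := pushInput_runs (Ω := Ω) (A.inputAlphabet.invFun false) (word m ++ w)
      (List.replicate n t ++ [])
    have h₄ := loadNat_runs (Ω := Ω) t m w
      (A.inputAlphabet.invFun false :: (List.replicate n t ++ []))
    have h₅ := call_runs A.tm Ω [] [] (bitStacks w [] [] []) hk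
    have h₆ := pushWord_runs (Γ₀ := A.tm.Γ) (Ω := Ω) [false] A.tm.initialState [] [] w [] [] []
      (Turing.haltList A.tm ((g (m, n)).map A.outputAlphabet.invFun)).stk
    have h₇ := unload_runs (Ω := Ω) (fun a => (A.outputAlphabet a).code)
      ((g (m, n)).map A.outputAlphabet.invFun) [] w
    have e : (encodeUnaryPair (m, n)).map A.inputAlphabet.invFun =
        List.replicate m t ++ A.inputAlphabet.invFun false :: (List.replicate n t ++ []) := by
      simp [encodeUnaryPair_eq, t]
    rw [e] at h₅
    refine Fragment.Runs.mono (((h₁.seq (h₂.seq (h₃.seq (h₄.seq (h₅.seq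
      (h₆.seq h₇)))))).congr ?_).start ?_) ?_
    · simp [mainOnly, Function.comp_def]
    · simp [mainOnly, A.tm.initList_nil_stk]
    · simp only [List.length_map]
      rw [add_comm m n] at hk'
      dsimp only at hk' ⊢
      omega
  · have h₁ : PolyBounded fun q : ℕ × ℕ => q.1 := hsize.of_le fun q => by omega
    have h₂ : PolyBounded fun q : ℕ × ℕ => q.2 := hsize.of_le fun q => by omega
    refine (PolyBounded.const 1).add ((h₁.add (.const 1)).add ((PolyBounded.const 1).add
      ((h₂.add (.const 1)).add ((hsize.polynomial A.time).add ((PolyBounded.const 1).add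
        (PolyBounded.add ?_ (.const 1)))))))
    exact hlen'.comp (g := fun q : ℕ × ℕ => (q.2, q.1)) (PolyBounded.size_self.of_le fun q => by
      rw [size_prod, size_prod]; omega)
  · have h : PolyBounded fun q : ℕ × ℕ => (g (q.2, q.1)).length :=
      hlen'.comp (g := fun q : ℕ × ℕ => (q.2, q.1)) (PolyBounded.size_self.of_le fun q => by
        rw [size_prod, size_prod]; omega)
    refine ((h.mul (.const 6)).add (.const 1)).of_le fun q => size_list_le (by simp) ?_
    intro a ha
    simp only [List.mem_reverse, List.mem_map] at ha
    obtain ⟨b, -, rfl⟩ := ha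
    have := b.code.isLt
    rw [size_nat]
    omega

/-! ### Input, output, and padding to exponential size -/

open TreeEncoding TreeFragment

theorem Fragment.Runs.of_reachesIn {K : Type} [DecidableEq K] {Γ : K → Type} {σ : Type}
    {q : {Λ : Type} → Λ → Λ → Turing.TM2.Stmt Γ Λ σ} {v : σ} {t : ℕ} {S S' : ∀ k, List (Γ k)}
    (h : ∀ (Λ : Type) (M : Λ → Turing.TM2.Stmt Γ Λ σ) (l x : Λ), M l = q l x →
      ReachesIn M t ⟨some l, v, S⟩ ⟨some x, v, S'⟩) : (Fragment.single q).Runs v t S S' :=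
  fun Λ M e x hM => h Λ M (e ()) x (hM ())

namespace TreeFragment

open Turing.TM2 Stmt

variable {K₀ : Type} [DecidableEq K₀] {Γ₀ : K₀ → Type} {σ₀ Ω : Type}

/-- Turn the input into a number on the main stack, on top of a zero. -/
def readInput : TreeFragment Γ₀ σ₀ Ω :=
  Fragment.single fun l x => pop .inp (fun v a => (v.1, a, v.2.2))
    (branch (fun v => v.2.1.isNone) (goto fun _ => x)
      (pushWordStmt [true, false] (load (fun v => (v.1, none, v.2.2)) (goto fun _ => l))))

theorem readInput_runs (n j : ℕ) (s : σ₀) :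
    (readInput (Γ₀ := Γ₀) (Ω := Ω)).Runs (s, none, none) (n + 1)
      (allStacks (List.replicate n true) [] (bitStacks (word j) [] [] []) fun _ => [])
      (mainOnly Γ₀ Ω (word (n + j))) := by
  induction n generalizing j with
  | zero => exact .single fun _ l x => by simp [mainOnly]
  | succ n ih =>
    refine ((Fragment.Runs.single_round (fun _ l x => ?_) (ih (j + 1))).mono (by omega)).congr ?_
    · simp [List.replicate_succ, stepAux_pushWordStmt]
    · rw [show n + (j + 1) = n + 1 + j by omega]

/-- Write the letters with the codes given by the list on the main stack, from right to left. -/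
def writeOutput (letter : Fin 8 → Ω) : TreeFragment Γ₀ σ₀ Ω :=
  Fragment.single fun l x => pop (.bits .main) (fun v a => (v.1, a, v.2.2))
    (branch (fun v => v.2.2.isNone)
      (branch (fun v => v.2.1.getD false)
        (load (fun v => (v.1, none, some 0)) (goto fun _ => l))
        (load (fun v => (v.1, none, none)) (goto fun _ => x)))
      (branch (fun v => v.2.1.getD false)
        (pop (.bits .main) (fun v _ => v)
          (load (fun v => (v.1, none, v.2.2.map (· + 1))) (goto fun _ => l)))
        (push .out (fun v => letter (v.2.2.getD 0))
          (load (fun v => (v.1, none, none)) (goto fun _ => l)))))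

theorem writeOutput_runs (letter : Fin 8 → Ω) (c : List ℕ) (s : σ₀) (o : List Ω) :
    (writeOutput (Γ₀ := Γ₀) letter).Runs (s, none, none) (size c)
      (allStacks [] o (bitStacks (word c) [] [] []) fun _ => [])
      (allStacks [] ((c.map fun a => letter (Fin.ofNat 8 a)).reverse ++ o)
        (bitStacks [] [] [] []) fun _ => []) := by
  refine .of_reachesIn fun Λ M l x hM => ?_
  -- The third register counts the ticks of the current code; it is `none` between two codes. Here
  -- `j` ticks have been read and `a` are left.
  have key : ∀ (a j : ℕ) (w : List Bool) (o : List Ω),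
      ReachesIn M (a + 1) ⟨some l, (s, none, some (Fin.ofNat 8 j)),
        allStacks [] o (bitStacks (word a ++ w) [] [] []) fun _ => []⟩
        ⟨some l, (s, none, none), allStacks [] (letter (Fin.ofNat 8 (a + j)) :: o)
          (bitStacks w [] [] []) fun _ => []⟩ := by
    intro a
    induction a with
    | zero =>
      intro j w o
      refine .step ?_
      rw [hM]
      simp
    | succ a ih =>
      intro j w o
      have h := ih (j + 1) w o
      rw [show a + 1 + j = a + (j + 1) by omega, add_comm (a + 1) 1]
      refine (ReachesIn.step ?_).trans h
      rw [hM]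
      have : Fin.ofNat 8 j + 1 = Fin.ofNat 8 (j + 1) := by
        ext; simp [Fin.val_add]
      simp
      exact this
  induction c generalizing o with
  | nil =>
    refine (ReachesIn.step ?_).mono (by simp)
    rw [hM]
    simp
  | cons a c ih =>
    have h₁ := key a 0 (word c) o
    have h₂ := ih (letter (Fin.ofNat 8 (a + 0)) :: o)
    have h₃ : ReachesIn M 1 ⟨some l, (s, none, none),
        allStacks [] o (bitStacks (word (a :: c)) [] [] []) fun _ => []⟩
        ⟨some l, (s, none, some (Fin.ofNat 8 0)),
          allStacks [] o (bitStacks (word a ++ word c) [] [] []) fun _ => []⟩ := by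
      refine .step ?_
      rw [hM]
      simp
    have h₄ := ((h₃.trans h₁).trans h₂).mono (t₂ := size (a :: c)) (by simp; omega)
    simpa using h₄

end TreeFragment

/-- A number `n`, represented by a tree whose size is exponential in `n`. -/
structure PowerInput where
  /-- the number -/
  val : ℕ

/-- The component `n ^ n` is mere padding: it makes lists of all words of length at most `n`
polynomial in the size of the input. -/
instance : TreeEncoding PowerInput := ⟨fun n => TreeEncoding.tree (n.val ^ n.val, n.val)⟩

theorem PowerInput.size_eq (n : PowerInput) : size n = 2 * n.val ^ n.val + 2 * n.val + 3 := by
  have : size n = size (n.val ^ n.val, n.val) := rfl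
  rw [this]
  simp
  omega

theorem pow_self_le (n : ℕ) : n ^ n ≤ 2 ^ n ^ 2 := by
  calc n ^ n ≤ (2 ^ n) ^ n := Nat.pow_le_pow_left n.lt_two_pow_self.le _
    _ = 2 ^ n ^ 2 := by rw [← pow_mul, sq]

theorem exists_pow_self_le_two_pow (K : ℕ) :
    ∃ k, ∀ n : ℕ, (32 * (n ^ n + n + 2)) ^ K ≤ 2 ^ (n ^ k + k) := by
  -- The base is at most 2 ^ (n² + n + 7). For n < 2 this exponent is at most 9, and the summand `k`
  -- absorbs 9 K; for n ≥ 2 it is at most 4 n², and n ^ (9 K) absorbs the factor 4 K.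
  refine ⟨9 * K + 2, fun n => ?_⟩
  have h₁ : 32 * (n ^ n + n + 2) ≤ 2 ^ (n ^ 2 + n + 7) := by
    have h₁ := pow_self_le n
    have h₂ : n + 2 ≤ 2 ^ (n + 1) := by
      have := (n + 1).lt_two_pow_self
      omega
    have h₃ : 2 ^ n ^ 2 ≤ 2 ^ (n ^ 2 + n + 1) := by
      apply Nat.pow_le_pow_right <;> omega
    have h₄ : 2 ^ (n + 1) ≤ 2 ^ (n ^ 2 + n + 1) := by
      apply Nat.pow_le_pow_right <;> nlinarith
    have h₅ : 2 ^ (n ^ 2 + n + 7) = 64 * 2 ^ (n ^ 2 + n + 1) := by ring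
    omega
  refine (Nat.pow_le_pow_left h₁ K).trans ?_
  rw [← pow_mul]
  apply Nat.pow_le_pow_right (by norm_num)
  rcases Nat.lt_or_ge n 2 with h | h
  · have : n ^ 2 + n + 7 ≤ 9 := by interval_cases n <;> norm_num
    have : (n ^ 2 + n + 7) * K ≤ 9 * K := by gcongr
    omega
  · have h₂ : n ^ 2 + n + 7 ≤ 4 * n ^ 2 := by nlinarith
    have h₃ : (n ^ 2 + n + 7) * K ≤ 4 * n ^ 2 * K := by gcongr
    have h₄ : 4 * K ≤ 2 ^ (9 * K) := by
      have := (9 * K).lt_two_pow_self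
      omega
    have h₅ : 2 ^ (9 * K) ≤ n ^ (9 * K) := Nat.pow_le_pow_left h _
    have h₆ : n ^ (9 * K + 2) = n ^ (9 * K) * n ^ 2 := pow_add _ _ _
    have h₇ : 4 * K * n ^ 2 ≤ n ^ (9 * K) * n ^ 2 := by gcongr; omega
    nlinarith

/-- The padding is computed by `n` multiplications by `n`. The result is not of polynomial size in
`n`, so `PolyTime.foldl` does not apply, and the loop is bounded directly in terms of `n ^ n`. -/
theorem powerInput_performs (tm : Turing.FinTM2) (Ω : Type) :
    ∃ (P : TreeFragment tm.Γ tm.σ Ω) (K : ℕ), ∀ n : ℕ, Performs P tm.initialState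
      ((32 * (n ^ n + n + 2)) ^ K) (word n) (word (PowerInput.mk n)) := by
  obtain ⟨P, t, hP, ⟨j, hj⟩, -⟩ := (PolyTime.replicate_unit (tm := tm) (Ω := Ω)
    (n := fun n : ℕ => n) .id).pair ((PolyTime.const 1).pair .id)
  obtain ⟨Q, u, hQ, ⟨k, hk⟩, -⟩ := PolyTime.foldl_body (tm := tm) (Ω := Ω)
    (g := fun (n s : ℕ) (_ : Unit) => n * s) (PolyTime.id.fst.mul PolyTime.id.snd.fst)
  refine ⟨P.seq (.loop testStmt Q), j + k + 4, fun n => ?_⟩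
  have hfold : ∀ l : List Unit, l.foldl (fun s _ => n * s) 1 = n ^ l.length := by
    intro l
    have : ∀ (l : List Unit) s, l.foldl (fun s _ => n * s) s = n ^ l.length * s := by
      intro l
      induction l with
      | nil => simp
      | cons a l ih => intro s; simp [ih, pow_succ, mul_assoc]
    rw [this, mul_one]
  have h₁ := foldl_performs (g := fun (n s : ℕ) (_ : Unit) => n * s)
    (fun a l s c => hQ ((a, l), (s, c))) n (List.replicate n ()) 1
    (D := (32 * (n ^ n + n + 2)) ^ k) ?_
  · have h₂ := (hP n).seq h₁
    rw [hfold, List.length_replicate] at h₂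
    refine h₂.mono ?_
    have h₃ : t n ≤ (32 * (n ^ n + n + 2)) ^ j := by
      refine (hj n).trans (Nat.pow_le_pow_left ?_ _)
      rw [size_nat]
      omega
    set X := 32 * (n ^ n + n + 2) with hX
    have hX1 : 1 ≤ X := by omega
    have h₄ : X ^ j ≤ X ^ (j + k) := Nat.pow_le_pow_right hX1 (by omega)
    have h₅ : X ^ k ≤ X ^ (j + k) := Nat.pow_le_pow_right hX1 (by omega)
    have h₆ : 1 ≤ X ^ (j + k) := Nat.one_le_pow _ _ hX1
    have h₇ : X ^ (j + k + 4) = X ^ (j + k) * X ^ 4 := pow_add _ _ _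
    have h₈ : n * (X ^ k + 1) ≤ X * (2 * X ^ (j + k)) := by
      apply Nat.mul_le_mul <;> omega
    have h₉ : X ^ (j + k) * (2 * X + 2) ≤ X ^ (j + k) * X ^ 4 := by
      gcongr
      have : 4 ≤ X := by omega
      calc 2 * X + 2 ≤ 4 * X := by omega
        _ ≤ X * X * X * X := by nlinarith [Nat.mul_le_mul this this, Nat.mul_le_mul hX1 hX1]
        _ = X ^ 4 := by ring
    nlinarith
  · intro l₁ a l₂ h
    refine (hk _).trans (Nat.pow_le_pow_left ?_ _)
    have h₂ := congrArg List.length h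
    simp at h₂
    have h₃ : n ^ l₁.length ≤ n ^ n := Nat.pow_le_pow_right (by omega) (by omega)
    rw [hfold]
    simp only [size_prod, size_nat, size_unit]
    have h₄ : size l₂ = 2 * l₂.length + 1 := by
      clear h h₂
      induction l₂ with
      | nil => rfl
      | cons b l₂ ih => simp [ih]; omega
    omega

theorem unaryEncodeNat_eq (n : ℕ) : Computability.unaryEncodeNat n = List.replicate n true := by
  induction n with
  | zero => rfl
  | succ n ih => rw [Computability.unaryEncodeNat, ih, List.replicate_succ]

/-- What is computed in polynomial time from `n ^ n` is computed in time `2 ^ (n ^ O(1))`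
from `n`. -/
theorem exists_computableInTime (tm : Turing.FinTM2) {Ω : Type} (letter : Fin 8 → Ω)
    {f : PowerInput → List ℕ} (hf : PolyTime tm Ω f) :
    ∃ (k : ℕ) (M : Turing.TM2ComputableInTime Computability.unaryEncodeNat
      (id : List Ω → List Ω) fun n => (f ⟨n⟩).map fun a => letter (Fin.ofNat 8 a)),
      ∀ n, M.time n ≤ 2 ^ (n ^ k + k) := by
  obtain ⟨P, K, hP⟩ := powerInput_performs tm Ω
  -- The output stack is filled from its last letter, so the list of codes is needed in reverse.
  obtain ⟨Q, t, hQ, ⟨k, hk⟩, ⟨j, hj⟩⟩ := hf.reverse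
  let R : TreeFragment tm.Γ tm.σ Ω :=
    (pushWord [false]).seq (readInput.seq (P.seq (Q.seq (writeOutput letter))))
  have hR : ∀ n : ℕ, R.Runs (tm.initialState, none, none)
      (1 + ((n + 1) + ((32 * (n ^ n + n + 2)) ^ K + ((32 * (n ^ n + n + 2)) ^ k +
        (32 * (n ^ n + n + 2)) ^ j))))
      (allStacks (List.replicate n true) [] (bitStacks [] [] [] []) fun _ => [])
      (allStacks [] ((f ⟨n⟩).map fun a => letter (Fin.ofNat 8 a)) (bitStacks [] [] [] [])
        fun _ => []) := by
    intro n
    have h₁ := pushWord_runs (Γ₀ := tm.Γ) (Ω := Ω) [false] tm.initialState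
      (List.replicate n true) [] [] [] [] [] fun _ => []
    have h₂ := readInput_runs (Γ₀ := tm.Γ) (Ω := Ω) n 0 tm.initialState
    have h₃ := hP n []
    have h₄ := hQ ⟨n⟩ []
    have h₅ := writeOutput_runs (Γ₀ := tm.Γ) letter (f ⟨n⟩).reverse tm.initialState []
    simp only [List.append_nil, add_zero, ← List.map_reverse, List.reverse_reverse]
      at h₁ h₂ h₃ h₄ h₅
    have h₆ : size (PowerInput.mk n) + 2 ≤ 32 * (n ^ n + n + 2) := by
      rw [PowerInput.size_eq]; dsimp only; omega
    exact h₁.seq (h₂.seq (h₃.seq ((h₄.mono ((hk _).trans (Nat.pow_le_pow_left h₆ _))).seq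
      (h₅.mono ((hj _).trans (Nat.pow_le_pow_left h₆ _))))))
  obtain ⟨k', hk'⟩ := exists_pow_self_le_two_pow (K + k + j + 2)
  have := tm.kFin
  have := tm.σFin
  -- The label `none` is the exit of the program; halting there takes the one step that is added to
  -- `s` below.
  let T : Turing.FinTM2 :=
    { K := StackName tm.K
      k₀ := .inp
      k₁ := .out
      Γ := StackName.Alphabet tm.Γ Ω
      Λ := Option R.Label
      main := some R.entry
      σ := Registers tm.σ
      initialState := (tm.initialState, none, none)
      Γk₀Fin := (inferInstance : Fintype Bool)
      m := fun l => l.elim .halt (R.code some none) }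
  have hT : ∀ n : ℕ, Nonempty (Turing.TM2OutputsInTime T (List.replicate n true)
      (some ((f ⟨n⟩).map fun a => letter (Fin.ofNat 8 a))) (2 ^ (n ^ k' + k'))) := by
    intro n
    obtain ⟨s, hs, h⟩ := hR n (Option R.Label) T.m some none fun l => rfl
    have e₁ : Turing.initList T (List.replicate n true) = ⟨some (some R.entry),
        (tm.initialState, none, none),
        allStacks (List.replicate n true) [] (bitStacks [] [] [] []) fun _ => []⟩ := by
      unfold Turing.initList
      congr 1
      funext i
      rcases i with _ | _ | (_ | _ | _ | _) | _ <;> rfl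
    have e₂ : Turing.haltList T ((f ⟨n⟩).map fun a => letter (Fin.ofNat 8 a)) = ⟨none,
        (tm.initialState, none, none),
        allStacks [] ((f ⟨n⟩).map fun a => letter (Fin.ofNat 8 a)) (bitStacks [] [] [] [])
          fun _ => []⟩ := by
      unfold Turing.haltList
      congr 1
      funext i
      rcases i with _ | _ | (_ | _ | _ | _) | _ <;> rfl
    refine ⟨⟨⟨s + 1, ?_⟩, ?_⟩⟩
    · rw [Function.iterate_succ_apply', e₁]
      exact (congrArg (flip Option.bind T.step) h).trans (congrArg some e₂.symm)
    · refine le_trans ?_ (hk' n)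
      set X := 32 * (n ^ n + n + 2) with hX
      have hX1 : 1 ≤ X := by omega
      have h₁ : X ^ K ≤ X ^ (K + k + j) := Nat.pow_le_pow_right hX1 (by omega)
      have h₂ : X ^ k ≤ X ^ (K + k + j) := Nat.pow_le_pow_right hX1 (by omega)
      have h₃ : X ^ j ≤ X ^ (K + k + j) := Nat.pow_le_pow_right hX1 (by omega)
      have h₄ : 1 ≤ X ^ (K + k + j) := Nat.one_le_pow _ _ hX1
      have h₅ : X ^ (K + k + j + 2) = X ^ (K + k + j) * X ^ 2 := pow_add _ _ _
      have h₆ : X ^ (K + k + j) * (X + 3) ≤ X ^ (K + k + j) * X ^ 2 := by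
        gcongr
        have : 64 ≤ X := by omega
        nlinarith
      have h₇ : n + 3 ≤ X := by omega
      have h₈ : 1 * X ≤ X ^ (K + k + j) * X := by gcongr
      dsimp only
      nlinarith
  refine ⟨k', ⟨⟨T, Equiv.refl _, Equiv.refl _⟩, fun n => 2 ^ (n ^ k' + k'), fun n => ?_⟩,
    fun n => le_rfl⟩
  have h := (hT n).some
  rw [unaryEncodeNat_eq, List.length_replicate]
  show Turing.TM2OutputsInTime T (List.map _root_.id (List.replicate n true)) (some (List.map
    _root_.id ((f ⟨n⟩).map fun a => letter (Fin.ofNat 8 a)))) (2 ^ (n ^ k' + k'))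
  rw [List.map_id, List.map_id]
  exact h

/-! ### Construction of the hard polynomial as a list of words -/

open TreeEncoding

/-- All words of length `k` over `{0, …, n - 1}`. -/
def allWords (n k : ℕ) : List (List ℕ) :=
  (fun ws : List (List ℕ) => ws.flatMap fun w => (List.range n).map fun i => i :: w)^[k] [[]]

/-- The weight of the graph of the word `m`, where `w` lists the weights of all pairs. -/
def wordWeight (n : ℕ) (w m : List ℕ) : ℕ :=
  (m.foldl (fun p i => (p.1.drop n, p.2 + p.1.getD i 0)) (w, 0)).2

/-- One letter of the reversed encoding of a list of weight functions is read. -/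
def parseStep (s : List (List ℕ)) (a : ℕ) : List (List ℕ) :=
  if a = 0 then (((s.headD []).headD 0 + 1) :: (s.headD []).tail) :: s.tail
  else if a = 1 then (0 :: s.headD []) :: s.tail
  else [] :: s

/-- The weight functions with the given encoding, which is reversed. -/
def parseWeights (l : List ℕ) : List (List ℕ) := l.foldl parseStep []

/-- The inner product modulo `r + 1` of two vectors of length `N`. -/
def dotMod (r N : ℕ) (a x : List ℕ) : ℕ :=
  ((List.range N).map fun j => a.getD j 0 * x.getD j 0).sum % (r + 1)

/-- The linear combination `α x - β y` modulo `r + 1`. -/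
def combineMod (r N α β : ℕ) (x y : List ℕ) : List ℕ :=
  (List.range N).map fun j => (α * x.getD j 0 + (r + 1 - β) * y.getD j 0) % (r + 1)

/-- One step of an elimination: `p.1` is the pivot, and `p.2` are vectors orthogonal to `a`. -/
def pivotStep (r N : ℕ) (a : List ℕ) (p : List ℕ × List (List ℕ)) (x : List ℕ) :
    List ℕ × List (List ℕ) :=
  if dotMod r N a p.1 = 0 then (x, p.1 :: p.2)
  else (p.1, combineMod r N (dotMod r N a p.1) (dotMod r N a x) x p.1 :: p.2)

/-- Combine the vectors in `L` to vectors orthogonal to `a`, one less in number. -/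
def eliminate (r N : ℕ) (L : List (List ℕ)) (a : List ℕ) : List (List ℕ) :=
  match L with
  | [] => []
  | x :: L => (L.foldl (pivotStep r N a) (x, [])).2

/-- The unit vectors. -/
def unitVectors (N : ℕ) : List (List ℕ) :=
  (List.range N).map fun i => (List.range N).map fun j => if i = j then 1 else 0

/-- A vector orthogonal to all `rows` modulo `r + 1`. -/
def kernelVector (r N : ℕ) (rows : List (List ℕ)) : List ℕ :=
  (rows.foldl (eliminate r N) (unitVectors N)).headD []

/-- The indicators of the sets of those words in `V` that have a given weight after the
prefix `u`. -/
def weightRows (n : ℕ) (ws : List (List ℕ)) (u : List ℕ) (V : List (List ℕ)) : List (List ℕ) :=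
  ws.flatMap fun w => (List.range (2 * (n * n) * n + 1)).map fun t =>
    V.map fun v => if wordWeight n w (u ++ v) = t then 1 else 0

/-- The monomials of the hard polynomial, repeated according to their coefficients. The coefficients
of the monomials with the `i`-th prefix of length `b` are a vector that is orthogonal modulo
`r i + 1` to all `weightRows`. -/
def hardWords (n b : ℕ) (r : ℕ → ℕ) (ws : List (List ℕ)) : List (List ℕ) :=
  (List.range (allWords n b).length).flatMap fun i =>
    (List.range (allWords n (n - b)).length).flatMap fun j =>
      List.replicate ((kernelVector (r i) (allWords n (n - b)).length
        (weightRows n ws ((allWords n b).getD i []) (allWords n (n - b)))).getD j 0)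
        ((allWords n b).getD i [] ++ (allWords n (n - b)).getD j [])

/-- The codes of the letters of a term. -/
def termCodes (pre w : List ℕ) : List ℕ :=
  pre ++ (w.flatMap (fun a => List.replicate a 0 ++ [1]) ++ [2])

theorem length_allWords (n k : ℕ) : (allWords n k).length = n ^ k := by
  induction k with
  | zero => rfl
  | succ k ih =>
    unfold allWords at ih ⊢
    rw [Function.iterate_succ_apply', List.length_flatMap]
    simp [ih, pow_succ]

theorem mem_allWords {n k : ℕ} {w : List ℕ} :
    w ∈ allWords n k ↔ w.length = k ∧ ∀ i ∈ w, i < n := by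
  induction k generalizing w with
  | zero =>
    simp only [allWords, Function.iterate_zero, id_eq, List.mem_singleton, List.length_eq_zero_iff]
    constructor
    · rintro rfl; simp
    · exact fun h => h.1
  | succ k ih =>
    have h : allWords n (k + 1) =
        (allWords n k).flatMap fun w => (List.range n).map fun i => i :: w := by
      unfold allWords
      rw [Function.iterate_succ_apply']
    rw [h]
    simp only [List.mem_flatMap, List.mem_map, List.mem_range, ih]
    constructor
    · rintro ⟨v, ⟨hv, hv'⟩, i, hi, rfl⟩
      simp [hv, hi]
      exact hv'
    · rintro ⟨h₁, h₂⟩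
      cases w with
      | nil => simp at h₁
      | cons i w =>
        refine ⟨w, ⟨by simpa using h₁, fun j hj => h₂ j (by simp [hj])⟩, i, h₂ i (by simp), rfl⟩

theorem nodup_allWords (n k : ℕ) : (allWords n k).Nodup := by
  induction k with
  | zero => simp [allWords]
  | succ k ih =>
    have h : allWords n (k + 1) =
        (allWords n k).flatMap fun w => (List.range n).map fun i => i :: w := by
      unfold allWords
      rw [Function.iterate_succ_apply']
    rw [h, List.nodup_flatMap]
    refine ⟨fun w _ => List.Nodup.map (fun i j h => by simpa using h) List.nodup_range, ?_⟩
    refine ih.imp ?_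
    intro v w hvw x hx hx'
    simp only [List.mem_map] at hx hx'
    obtain ⟨i, -, rfl⟩ := hx
    obtain ⟨j, -, h⟩ := hx'
    simp only [List.cons.injEq] at h
    exact hvw h.2.symm

theorem length_combineMod (r N α β : ℕ) (x y : List ℕ) : (combineMod r N α β x y).length = N := by
  simp [combineMod]

theorem size_combineMod_le (r N α β : ℕ) (x y : List ℕ) :
    size (combineMod r N α β x y) ≤ N * (2 * r + 2) + 1 := by
  refine size_list_le (length_combineMod ..).le fun a ha => ?_
  simp only [combineMod, List.mem_map] at ha
  obtain ⟨j, -, rfl⟩ := ha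
  have := Nat.mod_lt (α * x.getD j 0 + (r + 1 - β) * y.getD j 0) (show 0 < r + 1 by omega)
  rw [size_nat]
  omega

/-- Every vector that arises is an old one or a value of `combineMod`. With a bound on sizes as `Q`
this serves the running time; with a trivial `Q` it only counts vectors. -/
theorem foldl_pivotStep_mem {r N : ℕ} {a : List ℕ} {Q : List ℕ → Prop}
    (hQ : ∀ α β x y, Q (combineMod r N α β x y)) (L : List (List ℕ)) (p : List ℕ × List (List ℕ))
    (hL : ∀ x ∈ L, Q x) (h₁ : Q p.1) (h₂ : ∀ x ∈ p.2, Q x) :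
    Q (L.foldl (pivotStep r N a) p).1 ∧ (∀ x ∈ (L.foldl (pivotStep r N a) p).2, Q x) ∧
      (L.foldl (pivotStep r N a) p).2.length = L.length + p.2.length := by
  induction L generalizing p with
  | nil => simp [h₁]; exact h₂
  | cons y L ih =>
    have h := ih (pivotStep r N a p y) (fun x hx => hL x (by simp [hx])) ?_ ?_
    · refine ⟨h.1, h.2.1, h.2.2.trans ?_⟩
      unfold pivotStep
      split <;> simp <;> omega
    · unfold pivotStep
      split
      · exact hL y (by simp)
      · exact h₁
    · unfold pivotStep
      split
      · simp [h₁]; exact h₂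
      · simp [hQ]; exact h₂

theorem length_eliminate (r N : ℕ) (L : List (List ℕ)) (a : List ℕ) :
    (eliminate r N L a).length = L.length - 1 := by
  cases L with
  | nil => rfl
  | cons x L =>
    have := foldl_pivotStep_mem (a := a) (r := r) (N := N) (Q := fun _ => True) (by simp) L (x, [])
      (by simp) trivial (by simp)
    simp [eliminate, this.2.2]

theorem eliminate_mem {r N : ℕ} {Q : List ℕ → Prop} (hQ : ∀ α β x y, Q (combineMod r N α β x y))
    {L : List (List ℕ)} (hL : ∀ x ∈ L, Q x) (a : List ℕ) : ∀ x ∈ eliminate r N L a, Q x := by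
  cases L with
  | nil => simp [eliminate]
  | cons x L =>
    exact (foldl_pivotStep_mem hQ L (x, []) (fun y hy => hL y (by simp [hy])) (hL x (by simp))
      (by simp)).2.1

theorem foldl_eliminate_mem {r N : ℕ} {Q : List ℕ → Prop}
    (hQ : ∀ α β x y, Q (combineMod r N α β x y)) (rows : List (List ℕ)) {L : List (List ℕ)}
    (hL : ∀ x ∈ L, Q x) : (∀ x ∈ rows.foldl (eliminate r N) L, Q x) ∧
      (rows.foldl (eliminate r N) L).length = L.length - rows.length := by
  induction rows generalizing L with
  | nil => simp; exact hL
  | cons a rows ih =>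
    have h := ih (eliminate_mem hQ hL a)
    refine ⟨h.1, h.2.trans ?_⟩
    rw [length_eliminate, List.length_cons]
    omega

/-! ### The construction takes polynomial time -/

namespace PolyTime

variable {tm : Turing.FinTM2} {Ω : Type} {α β γ δ : Type} [TreeEncoding α] [TreeEncoding β]
  [TreeEncoding γ] [TreeEncoding δ]

theorem powerInput_val : PolyTime tm Ω fun n : PowerInput => n.val :=
  snd (f := fun n : PowerInput => (n.val ^ n.val, n.val)) (of_word_eq fun _ => rfl)

theorem allWords {k : PowerInput → ℕ} (hk : PolyTime tm Ω k) (h : ∀ n, k n ≤ n.val) :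
    PolyTime tm Ω fun n : PowerInput => allWords n.val (k n) := by
  refine iterate (g := fun (n : PowerInput) (ws : List (List ℕ)) =>
    ws.flatMap fun w => (List.range n.val).map fun i => i :: w) hk (const _) ?_
    (bd := fun n => size n * (size n * (size n + 1) + 1 + 1) + 1) ?_ ?_
  · exact flatMap (f := fun (x : PowerInput × List (List ℕ)) w => (List.range x.1.val).map
      fun i => i :: w) id.snd (map (f := fun (x : (PowerInput × List (List ℕ)) × List ℕ) i =>
        i :: x.2) (powerInput_val.comp id.fst.fst).range (cons id.snd id.fst.snd))
  · have h := PolyBounded.size_self (α := PowerInput)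
    exact (h.mul (((h.mul (h.add (.const 1))).add (.const 1)).add (.const 1))).add (.const 1)
  · intro n i hi
    have h₁ : i ≤ n.val := hi.trans (h n)
    have h₂ : n.val ^ i ≤ n.val ^ n.val := by
      -- For n = 0 the power is not monotone in the exponent, but then i = 0.
      rcases Nat.eq_zero_or_pos n.val with h | h
      · rw [h] at h₁ ⊢
        interval_cases i
        simp
      · exact Nat.pow_le_pow_right h h₁
    have h₃ := n.size_eq
    change size (_root_.allWords n.val i) ≤ _
    refine size_list_le (by rw [length_allWords]; omega) fun w hw => ?_
    rw [mem_allWords] at hw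
    refine size_list_le (by omega) fun a ha => ?_
    have := hw.2 a ha
    rw [size_nat]
    omega

theorem wordWeight {n : γ → ℕ} {w m : γ → List ℕ} (hn : PolyTime tm Ω n) (hw : PolyTime tm Ω w)
    (hm : PolyTime tm Ω m) : PolyTime tm Ω fun c => wordWeight (n c) (w c) (m c) := by
  refine fst (f := fun c => (((m c).foldl (fun p i => (p.1.drop (n c), p.2 + p.1.getD i 0))
    (w c, 0)).2, ())) (pair (snd ?_) (const ()))
  refine foldl (g := fun c (p : List ℕ × ℕ) i => (p.1.drop (n c), p.2 + p.1.getD i 0))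
    (b := fun c => (w c, 0)) hm (hw.pair (const 0))
    (((hn.comp id.fst).drop id.snd.fst.fst).pair (id.snd.fst.snd.add
      (id.snd.fst.fst.getD id.snd.snd (const 0))))
    (bd := fun c => size (w c) + 2 * (size (m c) * size (w c)) + 2) ?_ ?_
  · exact (hw.size_le.add ((PolyBounded.const 2).mul (hm.size_le.mul hw.size_le))).add (.const 2)
  · intro c l₁ l₂ h
    -- The list only gets shorter, and each letter adds one of its entries, which is at most its
    -- size.
    have key : ∀ (l : List ℕ) (p : List ℕ × ℕ),
        size (l.foldl (fun p i => (p.1.drop (n c), p.2 + p.1.getD i 0)) p).1 ≤ size p.1 ∧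
        (l.foldl (fun p i => (p.1.drop (n c), p.2 + p.1.getD i 0)) p).2 ≤
          p.2 + l.length * size p.1 := by
      intro l
      induction l with
      | nil => simp
      | cons a l ih =>
        intro p
        have h₁ := ih (p.1.drop (n c), p.2 + p.1.getD a 0)
        have h₂ : size (p.1.drop (n c)) ≤ size p.1 := by
          have h₁ := size_append (p.1.take (n c)) (p.1.drop (n c))
          have h₂ := size_pos (p.1.take (n c))
          rw [List.take_append_drop] at h₁
          omega
        have h₃ : p.1.getD a 0 ≤ size p.1 := by
          rw [List.getD_eq_getElem?_getD]
          cases h : p.1[a]? with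
          | none => simp
          | some b =>
            have := size_le_of_mem (List.mem_of_getElem? h)
            rw [size_nat] at this
            simp
            omega
        have h₄ : l.length * size (p.1.drop (n c)) ≤ l.length * size p.1 := by gcongr
        refine ⟨h₁.1.trans h₂, h₁.2.trans ?_⟩
        simp only [List.length_cons, Nat.add_one_mul]
        omega
    have h₁ := key l₁ (w c, 0)
    have h₂ : l₁.length ≤ size (m c) := by
      have := length_lt_size (m c)
      simp [h] at this ⊢
      omega
    have h₃ : l₁.length * size (w c) ≤ size (m c) * size (w c) := by gcongr
    generalize l₁.foldl _ _ = q at h₁ ⊢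
    obtain ⟨q₁, q₂⟩ := q
    rw [size_prod, size_nat]
    dsimp only at h₁ ⊢
    omega

theorem parseWeights {l : γ → List ℕ} (hl : PolyTime tm Ω l) :
    PolyTime tm Ω fun c => parseWeights (l c) := by
  have h₁ : PolyTime tm Ω fun x : γ × List (List ℕ) × ℕ => x.2.1.headD [] :=
    headD id.snd.fst (const _)
  refine foldl (g := fun _ => parseStep) (b := fun _ => []) hl (const _)
    (ite_eq id.snd.snd (const 0)
      (cons (cons (headD h₁ (const 0)).succ h₁.tail) id.snd.fst.tail)
      (ite_eq id.snd.snd (const 1) (cons (cons (const 0) h₁) id.snd.fst.tail)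
        (cons (const _) id.snd.fst)))
    (bd := fun c => 8 * size (l c) + 1)
    (((PolyBounded.const 8).mul hl.size_le).add (.const 1)) fun c l₁ l₂ h => ?_
  have key : ∀ (l : List ℕ) (s : List (List ℕ)),
      size (l.foldl parseStep s) ≤ 8 * l.length + size s := by
    intro l
    induction l with
    | nil => simp
    | cons a l ih =>
      intro s
      have h₁ := ih (parseStep s a)
      have h₂ : size (parseStep s a) ≤ size s + 8 := by
        unfold parseStep
        rcases s with _ | ⟨_ | ⟨b, t⟩, s⟩ <;> split_ifs <;> simp <;> omega
      rw [List.foldl_cons, List.length_cons]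
      omega
  have h₁ := key l₁ []
  have h₂ : l₁.length ≤ size (l c) := by
    have := length_lt_size (l c)
    simp [h] at this ⊢
    omega
  rw [size_nil] at h₁
  omega

theorem dotMod {r N : γ → ℕ} {a x : γ → List ℕ} (hr : PolyTime tm Ω r) (hN : PolyTime tm Ω N)
    (ha : PolyTime tm Ω a) (hx : PolyTime tm Ω x) :
    PolyTime tm Ω fun c => dotMod (r c) (N c) (a c) (x c) :=
  snd (div_mod (sum (map (f := fun c j => (a c).getD j 0 * (x c).getD j 0) hN.range
    (((ha.comp id.fst).getD id.snd (const 0)).mul ((hx.comp id.fst).getD id.snd (const 0)))))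
      hr.succ fun _ => Nat.succ_pos _)

theorem combineMod {r N a b : γ → ℕ} {x y : γ → List ℕ} (hr : PolyTime tm Ω r)
    (hN : PolyTime tm Ω N) (ha : PolyTime tm Ω a) (hb : PolyTime tm Ω b) (hx : PolyTime tm Ω x)
    (hy : PolyTime tm Ω y) :
    PolyTime tm Ω fun c => combineMod (r c) (N c) (a c) (b c) (x c) (y c) :=
  map (f := fun c j => (a c * (x c).getD j 0 + (r c + 1 - b c) * (y c).getD j 0) % (r c + 1))
    hN.range (snd (div_mod (((ha.comp id.fst).mul ((hx.comp id.fst).getD id.snd (const 0))).add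
      (((hr.comp id.fst).succ.sub (hb.comp id.fst)).mul ((hy.comp id.fst).getD id.snd (const 0))))
        (hr.comp id.fst).succ fun _ => Nat.succ_pos _))

theorem pivotStep {r N : γ → ℕ} {a x : γ → List ℕ} {p : γ → List ℕ × List (List ℕ)}
    (hr : PolyTime tm Ω r) (hN : PolyTime tm Ω N) (ha : PolyTime tm Ω a) (hp : PolyTime tm Ω p)
    (hx : PolyTime tm Ω x) :
    PolyTime tm Ω fun c => pivotStep (r c) (N c) (a c) (p c) (x c) :=
  ite_zero (dotMod hr hN ha hp.fst) (hx.pair (hp.fst.cons hp.snd))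
    (hp.fst.pair (cons (combineMod hr hN (dotMod hr hN ha hp.fst) (dotMod hr hN ha hx) hx hp.fst)
      hp.snd))

theorem eliminate {r N : γ → ℕ} {L : γ → List (List ℕ)} {a : γ → List ℕ}
    (hr : PolyTime tm Ω r) (hN : PolyTime tm Ω N) (hL : PolyTime tm Ω L) (ha : PolyTime tm Ω a) :
    PolyTime tm Ω fun c => eliminate (r c) (N c) (L c) (a c) := by
  refine (listCases (h := fun x : (List ℕ × List (List ℕ)) × γ =>
    (x.1.2.foldl (_root_.pivotStep (r x.2) (N x.2) (a x.2)) (x.1.1, [])).2)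
    (g := fun _ => []) hL (const _) (snd ?_)).congr fun c => by cases h : L c <;> rfl
  refine foldl (g := fun (x : (List ℕ × List (List ℕ)) × γ) => _root_.pivotStep (r x.2) (N x.2) (a x.2))
    (b := fun x => (x.1.1, [])) id.fst.snd (id.fst.fst.pair (const _))
    (pivotStep (hr.comp id.fst.snd) (hN.comp id.fst.snd) (ha.comp id.fst.snd) id.snd.fst id.snd.snd)
    (bd := fun x => (size x + (N x.2 * (2 * r x.2 + 2) + 1)) + (size x *
      ((size x + (N x.2 * (2 * r x.2 + 2) + 1)) + 1) + 1) + 1) ?_ ?_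
  · have h₁ : PolyBounded fun x : (List ℕ × List (List ℕ)) × γ =>
        size x + (N x.2 * (2 * r x.2 + 2) + 1) :=
      PolyBounded.size_self.add (((hN.size_le.of_le fun c => by simp; omega).snd.mul
        (((PolyBounded.const 2).mul (hr.size_le.of_le fun c => by simp; omega).snd).add
          (.const 2))).add (.const 1))
    exact (h₁.add ((PolyBounded.size_self.mul (h₁.add (.const 1))).add (.const 1))).add (.const 1)
  · rintro ⟨⟨x, L⟩, c⟩ l₁ l₂ (h : L = l₁ ++ l₂)
    subst h
    have key := foldl_pivotStep_mem (a := a c) (Q := fun y => size y ≤ size ((x, l₁ ++ l₂), c) +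
        (N c * (2 * r c + 2) + 1))
      (fun α β x y => (size_combineMod_le (r c) (N c) α β x y).trans (by omega)) l₁ (x, [])
      (fun y hy => ?_) ?_ (by simp)
    · generalize List.foldl _ _ _ = q at key ⊢
      obtain ⟨q₁, q₂⟩ := q
      rw [size_prod]
      have h₁ := size_list_le (l := q₂) (n := size ((x, l₁ ++ l₂), c)) (by
        have := key.2.2
        have := length_lt_size (l₁ ++ l₂)
        simp at this ⊢
        simp at key
        omega) key.2.1
      have h₂ := key.1
      dsimp only at h₁ h₂ ⊢
      omega
    · have := size_le_of_mem (l := l₁ ++ l₂) (a := y) (by simp [hy])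
      simp only [size_prod]
      omega
    · simp only [size_prod]
      omega

theorem kernelVector {r N : γ → ℕ} {rows : γ → List (List ℕ)} (hr : PolyTime tm Ω r)
    (hN : PolyTime tm Ω N) (hrows : PolyTime tm Ω rows) :
    PolyTime tm Ω fun c => kernelVector (r c) (N c) (rows c) := by
  refine headD (foldl (g := fun c => _root_.eliminate (r c) (N c)) (b := fun c => unitVectors (N c))
    hrows ?_ (eliminate (hr.comp id.fst) (hN.comp id.fst) id.snd.fst id.snd.snd)
    (bd := fun c => N c * ((N c * (2 * r c + 4) + 1) + 1) + 1) ?_ ?_) (const _)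
  · exact map (f := fun c i => (List.range (N c)).map fun j => if i = j then 1 else 0) hN.range
      (map (f := fun (x : γ × ℕ) j => if x.2 = j then 1 else 0) (hN.comp id.fst).range
        (ite_eq id.fst.snd id.snd (const 1) (const 0)))
  · have h₁ : PolyBounded N := hN.size_le.of_le fun c => by simp; omega
    have h₂ : PolyBounded r := hr.size_le.of_le fun c => by simp; omega
    exact (h₁.mul (((h₁.mul (((PolyBounded.const 2).mul h₂).add (.const 4))).add (.const 1)).add
      (.const 1))).add (.const 1)
  · intro c l₁ l₂ h
    have key := foldl_eliminate_mem (r := r c) (N := N c)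
      (Q := fun y => size y ≤ N c * (2 * r c + 4) + 1)
      (fun α β x y => (size_combineMod_le (r c) (N c) α β x y).trans (by gcongr; omega)) l₁
      (L := unitVectors (N c)) ?_
    · refine size_list_le ?_ key.1
      rw [key.2]
      simp [unitVectors]
    · intro x hx
      simp only [unitVectors, List.mem_map] at hx
      obtain ⟨i, -, rfl⟩ := hx
      refine (size_list_le (n := N c) (b := 3) (by simp) fun a ha => ?_).trans
        (Nat.add_le_add_right (Nat.mul_le_mul_left _ (by omega)) 1)
      simp only [List.mem_map] at ha
      obtain ⟨j, -, rfl⟩ := ha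
      split <;> simp

theorem weightRows {n : γ → ℕ} {ws : γ → List (List ℕ)} {u : γ → List ℕ} {V : γ → List (List ℕ)}
    (hn : PolyTime tm Ω n) (hws : PolyTime tm Ω ws) (hu : PolyTime tm Ω u)
    (hV : PolyTime tm Ω V) :
    PolyTime tm Ω fun c => weightRows (n c) (ws c) (u c) (V c) := by
  refine flatMap (f := fun c w => (List.range (2 * (n c * n c) * n c + 1)).map fun t =>
    (V c).map fun v => if _root_.wordWeight (n c) w (u c ++ v) = t then 1 else 0) hws ?_
  refine map (f := fun (x : γ × List ℕ) t => (V x.1).map fun v =>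
    if _root_.wordWeight (n x.1) x.2 (u x.1 ++ v) = t then 1 else 0) ?_ ?_
  · have h := hn.comp (id (α := γ × List ℕ)).fst
    exact (((const 2).mul (h.mul h)).mul h).succ.range
  · refine map (f := fun (x : (γ × List ℕ) × ℕ) v =>
      if _root_.wordWeight (n x.1.1) x.1.2 (u x.1.1 ++ v) = x.2 then 1 else 0)
      (hV.comp id.fst.fst) ?_
    exact ite_eq (wordWeight (hn.comp id.fst.fst.fst) id.fst.fst.snd
      ((hu.comp id.fst.fst.fst).append id.snd)) id.fst.snd (const 1) (const 0)

theorem hardWords {b : PowerInput → ℕ} {r : PowerInput → ℕ → ℕ}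
    {ws : PowerInput → List (List ℕ)} (hb : PolyTime tm Ω b) (hb' : ∀ n, b n ≤ n.val)
    (hr : PolyTime tm Ω fun x : PowerInput × ℕ => r x.1 x.2) (hws : PolyTime tm Ω ws) :
    PolyTime tm Ω fun n : PowerInput => hardWords n.val (b n) (r n) (ws n) := by
  have hU := allWords hb hb'
  have hV := allWords (k := fun n => n.val - b n) (powerInput_val.sub hb) fun n => Nat.sub_le _ _
  refine flatMap (f := fun (n : PowerInput) i =>
    (List.range (_root_.allWords n.val (n.val - b n)).length).flatMap fun j =>
      List.replicate ((_root_.kernelVector (r n i) (_root_.allWords n.val (n.val - b n)).length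
        (_root_.weightRows n.val (ws n) ((_root_.allWords n.val (b n)).getD i [])
          (_root_.allWords n.val (n.val - b n)))).getD j 0)
        ((_root_.allWords n.val (b n)).getD i [] ++
          (_root_.allWords n.val (n.val - b n)).getD j [])) hU.length.range ?_
  refine flatMap (f := fun (x : PowerInput × ℕ) j =>
      List.replicate ((_root_.kernelVector (r x.1 x.2)
        (_root_.allWords x.1.val (x.1.val - b x.1)).length
        (_root_.weightRows x.1.val (ws x.1) ((_root_.allWords x.1.val (b x.1)).getD x.2 [])
          (_root_.allWords x.1.val (x.1.val - b x.1)))).getD j 0)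
        ((_root_.allWords x.1.val (b x.1)).getD x.2 [] ++
          (_root_.allWords x.1.val (x.1.val - b x.1)).getD j []))
    (hV.length.range.comp id.fst) ?_
  have hu : PolyTime tm Ω fun x : PowerInput × ℕ => (_root_.allWords x.1.val (b x.1)).getD x.2 [] :=
    (hU.comp id.fst).getD id.snd (const _)
  have hv := hV.comp (id (α := PowerInput × ℕ)).fst
  have hk := kernelVector hr hv.length (weightRows (powerInput_val.comp id.fst)
    (hws.comp id.fst) hu hv)
  exact replicate ((hk.comp id.fst).getD id.snd (const 0))
    ((hu.comp id.fst).append ((hv.comp id.fst).getD id.snd (const _)))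

theorem termCodes (pre : List ℕ) {w : γ → List (List ℕ)} (hw : PolyTime tm Ω w) :
    PolyTime tm Ω fun c => (w c).flatMap (termCodes pre) :=
  flatMap (f := fun _ => _root_.termCodes pre) hw ((const pre).append
    (append (flatMap (f := fun (_ : γ × List ℕ) a => List.replicate a 0 ++ [1]) id.snd
      ((replicate id.snd (const 0)).append (const _))) (const _)))

end PolyTime

/-! ### Parsing weight functions, and weights of words as sums -/

/-- Read backwards, terminators come first: a semicolon opens an empty function, a comma opens a
value 0 in front, and ticks increase it. Folding over the reversed list is a right fold over the
encoding, which allows induction. -/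
theorem parseWeights_encodeWeights {n : ℕ} (ws : List (Fin n → ℕ)) :
    parseWeights ((encodeWeights ws).map fun a => (a.code : ℕ)).reverse = ws.map List.ofFn := by
  let g : Punct → List (List ℕ) → List (List ℕ) := fun a s => parseStep s a.code
  have h : ∀ l : List Punct, parseWeights (l.map fun a => (a.code : ℕ)).reverse = l.foldr g [] := by
    intro l
    rw [parseWeights, List.foldl_reverse, List.foldr_map]
  have hticks : ∀ (a b : ℕ) (t : List ℕ) (s : List (List ℕ)),
      (List.replicate a Punct.tick).foldr g ((b :: t) :: s) = ((b + a) :: t) :: s := by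
    intro a b t s
    induction a with
    | zero => rfl
    | succ a ih =>
      rw [List.replicate_succ, List.foldr_cons, ih]
      simp [g, parseStep, Punct.code]
      omega
  have hnats : ∀ (l t : List ℕ) (s : List (List ℕ)),
      (encodeNats l).foldr g (t :: s) = (l ++ t) :: s := by
    intro l t s
    induction l with
    | nil => rfl
    | cons a l ih =>
      have : encodeNats (a :: l) = List.replicate a Punct.tick ++ (Punct.comma :: encodeNats l) := by
        simp [encodeNats]
      rw [this, List.foldr_append, List.foldr_cons, ih]
      have h₁ : g Punct.comma ((l ++ t) :: s) = (0 :: (l ++ t)) :: s := by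
        simp [g, parseStep, Punct.code]
      rw [h₁, hticks]
      simp
  rw [h]
  induction ws with
  | nil => rfl
  | cons w ws ih =>
    have : encodeWeights (w :: ws) = encodeNats (List.ofFn w) ++ (Punct.semicolon ::
        encodeWeights ws) := by simp [encodeWeights]
    rw [this, List.foldr_append, List.foldr_cons, ih]
    have h₁ : ∀ s, g Punct.semicolon s = [] :: s := by
      intro s
      simp [g, parseStep, Punct.code]
    rw [h₁, hnats]
    simp

/-- Dropping `n` entries after each letter keeps the row of the current position at the front of the
list, which replaces computing the index `n * l + i`. -/
theorem wordWeight_eq (n : ℕ) (w m : List ℕ) :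
    wordWeight n w m = ∑ l ∈ Finset.range m.length, w.getD (n * l + m.getD l 0) 0 := by
  have key : ∀ (m w : List ℕ) (s : ℕ),
      (m.foldl (fun p i => (p.1.drop n, p.2 + p.1.getD i 0)) (w, s)).2 =
        s + ∑ l ∈ Finset.range m.length, w.getD (n * l + m.getD l 0) 0 := by
    intro m
    induction m with
    | nil => simp
    | cons i m ih =>
      intro w s
      rw [List.foldl_cons, ih, List.length_cons, Finset.sum_range_succ']
      have : ∀ l, (w.drop n).getD (n * l + m.getD l 0) 0 =
          w.getD (n * (l + 1) + (i :: m).getD (l + 1) 0) 0 := by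
        intro l
        simp only [List.getD_eq_getElem?_getD, List.getElem?_drop, List.getElem?_cons_succ]
        rw [show n + (n * l + m[l]?.getD 0) = n * (l + 1) + m[l]?.getD 0 by ring]
      simp only [this]
      simp
      omega
  rw [wordWeight, key, zero_add]

/-! ### Linear algebra modulo a prime -/

section Elimination

variable {K : Type} [Field K] {N : ℕ}

/-- A list of numbers as a vector over `K`. -/
def listVector (K : Type) [Field K] (N : ℕ) (x : List ℕ) : Fin N → K := fun i => (x.getD i 0 : ℕ)

/-- The span over `K` of a list of vectors. -/
def listSpan (K : Type) [Field K] (N : ℕ) : List (List ℕ) → Submodule K (Fin N → K)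
  | [] => ⊥
  | x :: L => Submodule.span _ {listVector K N x} ⊔ listSpan K N L

theorem listVector_mem_listSpan {x : List ℕ} {L : List (List ℕ)} (h : x ∈ L) :
    listVector K N x ∈ listSpan K N L := by
  induction L with
  | nil => simp at h
  | cons y L ih =>
    rcases List.mem_cons.1 h with rfl | h
    · exact Submodule.mem_sup_left (Submodule.mem_span_singleton_self _)
    · exact Submodule.mem_sup_right (ih h)

theorem listSpan_le {L : List (List ℕ)} {W : Submodule K (Fin N → K)}
    (h : ∀ x ∈ L, listVector K N x ∈ W) : listSpan K N L ≤ W := by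
  induction L with
  | nil => exact bot_le
  | cons y L ih =>
    refine sup_le ?_ (ih fun x hx => h x (by simp [hx]))
    rw [Submodule.span_singleton_le_iff_mem]
    exact h y (by simp)

theorem finrank_span_singleton_sup_le (v : Fin N → K)
    (W : Submodule K (Fin N → K)) :
    Module.finrank K ↥(Submodule.span K {v} ⊔ W) ≤ Module.finrank K W + 1 := by
  have h₁ := Submodule.finrank_add_le_finrank_add_finrank (Submodule.span K {v}) W
  have h₂ : Module.finrank K ↥(Submodule.span K {v}) ≤ 1 := by
    simpa using finrank_span_le_card (R := K) ({v} : Set (Fin N → K))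
  omega

theorem finrank_listSpan_le (L : List (List ℕ)) :
    Module.finrank K (listSpan K N L) ≤ L.length := by
  induction L with
  | nil => exact (finrank_bot K (Fin N → K)).le
  | cons y L ih =>
    exact (finrank_span_singleton_sup_le (listVector K N y) (listSpan K N L)).trans
      (Nat.succ_le_succ ih)

/-- The vectors orthogonal to `a`. -/
def orthogonalTo (K : Type) [Field K] (N : ℕ) (a : List ℕ) : Submodule K (Fin N → K) :=
  LinearMap.ker (Fintype.linearCombination K (listVector K N a))

theorem mem_orthogonalTo {a : List ℕ} {v : Fin N → K} :
    v ∈ orthogonalTo K N a ↔ ∑ i, v i * listVector K N a i = 0 := by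
  simp [orthogonalTo, Fintype.linearCombination_apply]

variable {p : ℕ} [CharP K p] {r : ℕ}

theorem dotMod_cast (hr : r + 1 = p) (a x : List ℕ) :
    (dotMod r N a x : K) = ∑ i, listVector K N x i * listVector K N a i := by
  rw [dotMod, hr, ← CharP.cast_eq_mod K p]
  have h : ((List.range N).map fun j => a.getD j 0 * x.getD j 0).sum =
      ∑ j ∈ Finset.range N, a.getD j 0 * x.getD j 0 := by
    rfl
  rw [h, Finset.sum_range]
  push_cast
  exact Finset.sum_congr rfl fun i _ => mul_comm _ _

theorem dotMod_lt (a x : List ℕ) : dotMod r N a x < r + 1 := Nat.mod_lt _ (by omega)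

/-- The natural number `r + 1 - β` stands for `-β`; the bound on `β` makes the subtraction exact. -/
theorem listVector_combineMod (hr : r + 1 = p) {α β : ℕ} (hβ : β < r + 1) (x y : List ℕ) :
    listVector K N (combineMod r N α β x y) =
      (α : K) • listVector K N x - (β : K) • listVector K N y := by
  funext i
  have h : (combineMod r N α β x y).getD i 0 =
      (α * x.getD i 0 + (r + 1 - β) * y.getD i 0) % (r + 1) := by
    simp [combineMod, List.getD_eq_getElem?_getD]
  simp only [listVector, h, Pi.sub_apply, Pi.smul_apply, smul_eq_mul]
  rw [hr, ← CharP.cast_eq_mod K p]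
  rw [hr] at hβ
  push_cast [Nat.cast_sub hβ.le]
  rw [CharP.cast_eq_zero K p]
  ring

/-- The pivot is the only vector that may fail to be orthogonal to `a`. If it is orthogonal, it
joins the others and the next vector replaces it. If not, the next vector `x` becomes `α x - β q`,
where `α` and `β` are the inner products of the pivot `q` and of `x` with `a`. This is orthogonal to
`a`, and it spans the same space together with `q` because `α ≠ 0`. No inverse is computed. -/
theorem foldl_pivotStep_span (hr : r + 1 = p) (a : List ℕ) (L : List (List ℕ))
    (q : List ℕ × List (List ℕ)) (hq : ∀ x ∈ q.2, listVector K N x ∈ orthogonalTo K N a) :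
    listSpan K N ((L.foldl (pivotStep r N a) q).1 :: (L.foldl (pivotStep r N a) q).2) =
      listSpan K N (q.1 :: q.2) ⊔ listSpan K N L ∧
    ∀ x ∈ (L.foldl (pivotStep r N a) q).2, listVector K N x ∈ orthogonalTo K N a := by
  induction L generalizing q with
  | nil => simp [listSpan]; exact hq
  | cons x L ih =>
    have hx := dotMod_cast (K := K) (N := N) hr a x
    have hc := dotMod_cast (K := K) (N := N) hr a q.1
    by_cases h : dotMod r N a q.1 = 0
    · have e : pivotStep r N a q x = (x, q.1 :: q.2) := by simp [pivotStep, h]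
      have := ih (x, q.1 :: q.2) ?_
      · rw [List.foldl_cons, e]
        refine ⟨this.1.trans ?_, this.2⟩
        simp only [listSpan]
        ac_rfl
      · simp only [List.mem_cons, forall_eq_or_imp]
        refine ⟨?_, hq⟩
        rw [mem_orthogonalTo, ← hc, h, Nat.cast_zero]
    · have e : pivotStep r N a q x = (q.1, combineMod r N (dotMod r N a q.1) (dotMod r N a x) x q.1
          :: q.2) := by simp [pivotStep, h]
      have hv := listVector_combineMod (K := K) (N := N) hr (α := dotMod r N a q.1)
        (dotMod_lt (N := N) a x) x q.1
      -- `dotMod` is reduced modulo `p`, so being nonzero as a number it is nonzero in `K`.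
      have h0 : (dotMod r N a q.1 : K) ≠ 0 := by
        intro h0
        rw [CharP.cast_eq_zero_iff K p] at h0
        exact h (Nat.eq_zero_of_dvd_of_lt h0 (hr ▸ dotMod_lt (N := N) a q.1))
      have := ih (q.1, combineMod r N (dotMod r N a q.1) (dotMod r N a x) x q.1 :: q.2) ?_
      · rw [List.foldl_cons, e]
        refine ⟨this.1.trans ?_, this.2⟩
        simp only [listSpan]
        have key : Submodule.span K {listVector K N q.1} ⊔ Submodule.span K
            {listVector K N (combineMod r N (dotMod r N a q.1) (dotMod r N a x) x q.1)} =
            Submodule.span K {listVector K N q.1} ⊔ Submodule.span K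
              {listVector K N x} := by
          rw [hv]
          have h₁ : listVector K N q.1 ∈ Submodule.span K {listVector K N q.1} :=
            Submodule.mem_span_singleton_self _
          apply le_antisymm
          · refine sup_le le_sup_left ?_
            rw [Submodule.span_singleton_le_iff_mem]
            exact Submodule.sub_mem _ (Submodule.smul_mem _ _ (Submodule.mem_sup_right
              (Submodule.mem_span_singleton_self _)))
              (Submodule.smul_mem _ _ (Submodule.mem_sup_left h₁))
          · refine sup_le le_sup_left ?_
            rw [Submodule.span_singleton_le_iff_mem, ← Submodule.smul_mem_iff _ h0]
            refine (congrArg (· ∈ _) (sub_add_cancel ((dotMod r N a q.1 : K) • listVector K N x)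
              ((dotMod r N a x : K) • listVector K N q.1))).mp ?_
            exact Submodule.add_mem _ (Submodule.mem_sup_right
              (Submodule.mem_span_singleton_self _))
              (Submodule.smul_mem _ _ (Submodule.mem_sup_left h₁))
        rw [← sup_assoc, key]
        ac_rfl
      · simp only [List.mem_cons, forall_eq_or_imp]
        refine ⟨?_, hq⟩
        rw [mem_orthogonalTo, hv]
        simp only [Pi.sub_apply, Pi.smul_apply, smul_eq_mul, sub_mul, Finset.sum_sub_distrib,
          mul_assoc, ← Finset.mul_sum]
        rw [← hx, ← hc]
        ring

/-- Only the final pivot is thrown away, at the price of at most one dimension. -/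
theorem eliminate_span (hr : r + 1 = p) (L : List (List ℕ)) (a : List ℕ) :
    listSpan K N (eliminate r N L a) ≤ listSpan K N L ⊓ orthogonalTo K N a ∧
    Module.finrank K (listSpan K N L) ≤
      Module.finrank K (listSpan K N (eliminate r N L a)) + 1 := by
  cases L with
  | nil => exact ⟨bot_le, Nat.le_succ _⟩
  | cons x L =>
    have h := foldl_pivotStep_span (K := K) (N := N) hr a L (x, []) (by simp)
    have h₁ : listSpan K N (x :: L) = listSpan K N ((L.foldl (pivotStep r N a) (x, [])).1 ::
        eliminate r N (x :: L) a) := by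
      refine (h.1.trans ?_).symm
      simp [listSpan]
    rw [h₁]
    refine ⟨le_inf le_sup_right (listSpan_le h.2), finrank_span_singleton_sup_le _ _⟩

theorem foldl_eliminate_span (hr : r + 1 = p) (rows L : List (List ℕ)) :
    listSpan K N (rows.foldl (eliminate r N) L) ≤ listSpan K N L ∧
    (∀ a ∈ rows, listSpan K N (rows.foldl (eliminate r N) L) ≤ orthogonalTo K N a) ∧
    Module.finrank K (listSpan K N L) ≤
      Module.finrank K (listSpan K N (rows.foldl (eliminate r N) L)) + rows.length := by
  induction rows generalizing L with
  | nil => exact ⟨le_rfl, by simp, le_rfl⟩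
  | cons a rows ih =>
    have h₁ := eliminate_span (K := K) (N := N) hr L a
    have h₂ := ih (eliminate r N L a)
    refine ⟨h₂.1.trans (h₁.1.trans inf_le_left), ?_, ?_⟩
    · simp only [List.mem_cons, forall_eq_or_imp]
      exact ⟨h₂.1.trans (h₁.1.trans inf_le_right), h₂.2.1⟩
    · have h₃ := h₂.2.2
      have h₄ := h₁.2
      exact h₄.trans ((Nat.succ_le_succ h₃).trans (by rw [List.length_cons]; exact le_rfl))

theorem listSpan_unitVectors : listSpan K N (unitVectors N) = ⊤ := by
  classical
  rw [eq_top_iff, ← (Pi.basisFun K (Fin N)).span_eq, Submodule.span_le]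
  rintro _ ⟨i, rfl⟩
  have h : Pi.basisFun K (Fin N) i =
      listVector K N ((List.range N).map fun j => if (i : ℕ) = j then 1 else 0) := by
    funext j
    simp [listVector, List.getD_eq_getElem?_getD, Pi.single_apply, Fin.ext_iff, eq_comm]
  rw [h]
  exact listVector_mem_listSpan (List.mem_map.2 ⟨i, by simp, rfl⟩)

/-- If there are fewer rows than columns, the kernel vector is not zero. -/
theorem kernelVector_spec (K : Type) [Field K] {N p : ℕ} [CharP K p] {r : ℕ} (hr : r + 1 = p)
    {rows : List (List ℕ)} (h : rows.length < N) :
    listVector K N (kernelVector r N rows) ≠ 0 ∧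
    ∀ a ∈ rows, ∑ i, listVector K N (kernelVector r N rows) i * listVector K N a i = 0 := by
  have h₁ := foldl_eliminate_span (K := K) (N := N) hr rows (unitVectors N)
  have h₂ := (foldl_eliminate_mem (r := r) (N := N) (Q := fun _ => True) (by simp) rows
    (L := unitVectors N) (by simp)).2
  rw [listSpan_unitVectors, finrank_top, Module.finrank_fin_fun] at h₁
  have h₃ : (unitVectors N).length = N := by simp [unitVectors]
  unfold kernelVector
  generalize rows.foldl (eliminate r N) (unitVectors N) = L at h₁ h₂
  rcases L with _ | ⟨x, L⟩
  · simp at h₂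
    omega
  · refine ⟨fun h0 => ?_, fun a ha => ?_⟩
    -- The list has `N - rows.length` vectors, and its span has at least this dimension. If the head
    -- were zero, one vector less would span the same space.
    · have h₄ : listSpan K N (x :: L) = listSpan K N L := by
        have h0 : listVector K N x = 0 := h0
        simp [listSpan, h0]
      have h₅ := finrank_listSpan_le (K := K) (N := N) L
      rw [h₄] at h₁
      have := h₁.2.2
      simp at h₂
      omega
    · exact mem_orthogonalTo.1 (h₁.2.1 a ha (listVector_mem_listSpan (by simp)))

end Elimination

/-! ### Set systems without an isolated minimum -/

/-- If the coefficients `c j` sum up to zero over the members `E j` of any given weight, then the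
sets above which the coefficients do not sum up to zero have no unique set of minimum weight. -/
theorem not_hasUniqueMinWeightSet {n : ℕ} {J K : Type} [Fintype J] [DecidableEq J] [Field K]
    (E : J → Finset (Fin n)) (hE : ∀ i j, E i ⊆ E j → i = j) (c : J → K) (w : Fin n → ℕ)
    (h : ∀ t, ∑ j with ∑ x ∈ E j, w x = t, c j = 0) :
    ¬ HasUniqueMinWeightSet w {S | ∑ j with E j ⊆ S, c j ≠ 0} := by
  rintro ⟨S, ⟨hS, hmin⟩, huniq⟩
  -- The sets `E j` form an antichain, so the sum at `E j` has the single term `c j`.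
  have hmem : ∀ j, c j ≠ 0 → E j ∈ {S | ∑ j with E j ⊆ S, c j ≠ 0} := by
    intro j hj
    have : (Finset.univ.filter fun i => E i ⊆ E j) = {j} := by
      ext i
      simp only [Finset.mem_filter, Finset.mem_univ, true_and, Finset.mem_singleton]
      exact ⟨hE i j, fun h => h ▸ subset_rfl⟩
    simpa [this] using hj
  have key : ∀ j, c j ≠ 0 → ∑ x ∈ E j, w x ≤ ∑ x ∈ S, w x → E j = S := by
    intro j hj hle
    exact huniq (E j) ⟨hmem j hj, fun T hT => hle.trans (hmin T hT)⟩
  -- Some `E j` inside `S` has a nonzero coefficient and, weights being nonnegative, equals `S`. All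
  -- other coefficients in the weight class of `S` vanish.
  obtain ⟨j, hj, hcj⟩ := Finset.exists_ne_zero_of_sum_ne_zero hS
  rw [Finset.mem_filter] at hj
  have hjS := key j hcj (Finset.sum_le_sum_of_subset hj.2)
  have hsum := h (∑ x ∈ S, w x)
  rw [Finset.sum_eq_single_of_mem j (by simp [hjS])] at hsum
  · exact hcj hsum
  · intro i hi hij
    by_contra hci
    rw [Finset.mem_filter] at hi
    exact hij (hE i j (by rw [key i hci hi.2.le, hjS]))

/-! ### Boolean simulation of arithmetic circuits over finite fields -/

namespace BoolProg

variable {N : ℕ}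

/-- The Boolean functions computed at the nodes of a program. -/
def functions {k : ℕ} (P : BoolProg N k) : Set ((Fin N → Bool) → Bool) :=
  Set.range fun i x => P.eval x i

/-- Every program that computes the functions in `G` can be extended by `c` nodes so that it also
computes the functions in `H`. -/
def Derives (G : Set ((Fin N → Bool) → Bool)) (c : ℕ) (H : Set ((Fin N → Bool) → Bool)) : Prop :=
  ∀ (k : ℕ) (P : BoolProg N k), G ⊆ P.functions →
    ∃ Q : BoolProg N (k + c), P.functions ⊆ Q.functions ∧ H ⊆ Q.functions

variable {G H I : Set ((Fin N → Bool) → Bool)} {c d : ℕ}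

theorem functions_subset_of_snoc {k : ℕ} {P : BoolProg N k} {Q : BoolProg N (k + 1)}
    {g : (Fin N → Bool) → Bool}
    (h : ∀ x, Q.eval x = Fin.snoc (α := fun _ => Bool) (P.eval x) (g x)) :
    P.functions ⊆ Q.functions ∧ {g} ⊆ Q.functions := by
  constructor
  · rintro _ ⟨i, rfl⟩
    exact ⟨i.castSucc, by funext x; simp [h]⟩
  · rintro _ rfl
    exact ⟨Fin.last k, by funext x; simp [h]⟩

theorem derives_const (b : Bool) : Derives G 1 {fun _ => b} := fun _ P _ =>
  ⟨P.const b, functions_subset_of_snoc fun _ => rfl⟩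

theorem derives_not {g : (Fin N → Bool) → Bool} (hg : g ∈ G) :
    Derives G 1 {fun x => !g x} := fun _ P h => by
  obtain ⟨i, rfl⟩ := h hg
  exact ⟨P.not i, functions_subset_of_snoc fun _ => rfl⟩

theorem derives_and {g h : (Fin N → Bool) → Bool} (hg : g ∈ G) (hh : h ∈ G) :
    Derives G 1 {fun x => g x && h x} := fun _ P hP => by
  obtain ⟨i, rfl⟩ := hP hg
  obtain ⟨j, rfl⟩ := hP hh
  exact ⟨P.and i j, functions_subset_of_snoc fun _ => rfl⟩

theorem derives_or {g h : (Fin N → Bool) → Bool} (hg : g ∈ G) (hh : h ∈ G) :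
    Derives G 1 {fun x => g x || h x} := fun _ P hP => by
  obtain ⟨i, rfl⟩ := hP hg
  obtain ⟨j, rfl⟩ := hP hh
  exact ⟨P.or i j, functions_subset_of_snoc fun _ => rfl⟩

theorem Derives.subset (h : Derives G c H) (hI : I ⊆ G ∪ H) : Derives G c I := fun k P hP =>
  let ⟨Q, h₁, h₂⟩ := h k P hP
  ⟨Q, h₁, fun _ hg => (hI hg).elim (fun hg => h₁ (hP hg)) fun hg => h₂ hg⟩

theorem derives_self (G : Set ((Fin N → Bool) → Bool)) : Derives G 0 G :=
  fun _ P hP => ⟨P, subset_rfl, hP⟩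

theorem Derives.trans (h₁ : Derives G c H) (h₂ : Derives (G ∪ H) d I) :
    Derives G (c + d) I := fun k P hP => by
  obtain ⟨Q, hQ₁, hQ₂⟩ := h₁ k P hP
  obtain ⟨R, hR₁, hR₂⟩ := h₂ (k + c) Q (Set.union_subset (hP.trans hQ₁) hQ₂)
  rw [← add_assoc]
  exact ⟨R, hQ₁.trans hR₁, hR₂⟩

theorem Derives.union (h₁ : Derives G c H) (h₂ : Derives G d I) :
    Derives G (c + d) (H ∪ I) := fun k P hP => by
  obtain ⟨Q, hQ₁, hQ₂⟩ := h₁ k P hP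
  obtain ⟨R, hR₁, hR₂⟩ := h₂ (k + c) Q (hP.trans hQ₁)
  rw [← add_assoc]
  exact ⟨R, hQ₁.trans hR₁, Set.union_subset (hQ₂.trans hR₁) hR₂⟩

/-- Superfluous constant nodes are added. Padding is needed because the isolation hypothesis
concerns circuits with exactly `m` nodes. -/
theorem Derives.mono (h : Derives G c H) (hcd : c ≤ d) : Derives G d H := by
  obtain ⟨e, rfl⟩ := Nat.exists_eq_add_of_le hcd
  induction e with
  | zero => exact h
  | succ e ih =>
    exact ((ih (by omega)).union (derives_const true)).subset
      (Set.subset_union_of_subset_right Set.subset_union_left _)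

theorem derives_iUnion {ι : Type} [Fintype ι] {F : ι → Set ((Fin N → Bool) → Bool)}
    (h : ∀ i, Derives G c (F i)) : Derives G (Fintype.card ι * c) (⋃ i, F i) := by
  classical
  have key : ∀ s : Finset ι, Derives G (s.card * c) (⋃ i ∈ s, F i) := by
    intro s
    induction s using Finset.induction_on with
    | empty => simpa using (derives_self G).subset (I := ∅) (by simp)
    | insert i s hi ih =>
      rw [Finset.card_insert_of_notMem hi, Nat.add_one_mul]
      refine (ih.union (h i)).subset (Set.subset_union_of_subset_right ?_ _)
      simp [Set.union_comm]
  simpa using key Finset.univ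

theorem derives_any (l : List ((Fin N → Bool) → Bool)) (hl : ∀ g ∈ l, g ∈ G) :
    Derives G (l.length + 1) {fun x => l.any fun g => g x} := by
  induction l with
  | nil => exact derives_const false
  | cons g l ih =>
    have h := (ih fun h hh => hl h (by simp [hh])).trans (derives_or (g := g)
      (h := fun x => l.any fun g => g x) (Or.inl (hl g (by simp))) (Or.inr rfl))
    simpa using h

section OneHot

variable {K : Type} [DecidableEq K]

/-- The indicators of the values of a function. -/
def oneHot (f : (Fin N → Bool) → K) : Set ((Fin N → Bool) → Bool) :=
  Set.range fun a x => decide (f x = a)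

/-- All indicators are among the two constant functions, whatever the size of `K`. -/
theorem derives_oneHot_const (a : K) : Derives G 2 (oneHot fun _ => a) := by
  refine ((derives_const true).union (derives_const false)).subset ?_
  rintro _ ⟨b, rfl⟩
  by_cases h : a = b <;> simp [h]

theorem derives_oneHot_bit {g : (Fin N → Bool) → Bool} (hg : g ∈ G) {a b : K} (hab : a ≠ b) :
    Derives G 2 (oneHot fun x => if g x then a else b) := by
  refine ((derives_not hg).union (derives_const false)).subset ?_
  rintro _ ⟨c, rfl⟩
  by_cases h₁ : a = c
  · left
    subst h₁
    convert hg using 1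
    funext x
    cases h : g x <;> simp [h, hab.symm]
  · right
    by_cases h₂ : b = c
    · left
      subst h₂
      refine Set.mem_singleton_iff.2 ?_
      funext x
      cases h : g x <;> simp [h, hab]
    · right
      refine Set.mem_singleton_iff.2 ?_
      funext x
      cases h : g x <;> simp [h, h₁, h₂]

variable [Fintype K]

/-- The cost of an operation on a finite set. -/
def opCost (q : ℕ) : ℕ := q * q + q * (q * q + 1)

/-- A truth table: one conjunction for each of the q² pairs of arguments, then for each of the q
results a disjunction of at most q² of these. -/
theorem derives_oneHot_op (op : K → K → K) {f g : (Fin N → Bool) → K} (hf : oneHot f ⊆ G)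
    (hg : oneHot g ⊆ G) :
    Derives G (opCost (Fintype.card K)) (oneHot fun x => op (f x) (g x)) := by
  have h₁ := derives_iUnion (ι := K × K) (G := G)
    (F := fun p => {fun x => decide (f x = p.1) && decide (g x = p.2)})
    fun p => derives_and (hf ⟨p.1, rfl⟩) (hg ⟨p.2, rfl⟩)
  have h₂ : ∀ a : K, Derives (G ∪ ⋃ p : K × K,
      {fun x => decide (f x = p.1) && decide (g x = p.2)}) (Fintype.card K * Fintype.card K + 1)
      {fun x => decide (op (f x) (g x) = a)} := by
    intro a
    let l := ((Finset.univ : Finset (K × K)).filter fun p => op p.1 p.2 = a).toList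
    have h := derives_any (G := G ∪ ⋃ p : K × K,
      {fun x => decide (f x = p.1) && decide (g x = p.2)}) (l.map fun p => fun x =>
        decide (f x = p.1) && decide (g x = p.2)) ?_
    · have e : (fun x => (l.map fun p => fun x => decide (f x = p.1) && decide (g x = p.2)).any
          fun g => g x) = fun x => decide (op (f x) (g x) = a) := by
        funext x
        rw [Bool.eq_iff_iff]
        simp [l]
      rw [e] at h
      refine h.mono ?_
      have : l.length ≤ Fintype.card (K × K) := by
        simpa [l] using Finset.card_filter_le (Finset.univ : Finset (K × K)) _
      simpa using this
    · intro h hh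
      obtain ⟨p, -, rfl⟩ := List.mem_map.1 hh
      exact Or.inr (Set.mem_iUnion.2 ⟨p, rfl⟩)
  have h₃ := h₁.trans (derives_iUnion h₂)
  rw [Fintype.card_prod, mul_one] at h₃
  refine h₃.subset (Set.subset_union_of_subset_right ?_ _)
  rintro _ ⟨a, rfl⟩
  exact Set.mem_iUnion.2 ⟨a, rfl⟩

theorem derives_oneHot_sum [AddCommMonoid K] {ι : Type} [Fintype ι]
    {f : ι → (Fin N → Bool) → K} (hf : ∀ i, oneHot (f i) ⊆ G) :
    Derives G (2 + Fintype.card ι * opCost (Fintype.card K)) (oneHot fun x => ∑ i, f i x) := by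
  classical
  have key : ∀ s : Finset ι, Derives G (2 + s.card * opCost (Fintype.card K))
      (oneHot fun x => ∑ i ∈ s, f i x) := by
    intro s
    induction s using Finset.induction_on with
    | empty => simpa using derives_oneHot_const (G := G) (0 : K)
    | insert i s hi ih =>
      rw [Finset.card_insert_of_notMem hi, Nat.add_one_mul, ← add_assoc]
      have h := ih.trans (derives_oneHot_op (· + ·) ((hf i).trans Set.subset_union_left)
        Set.subset_union_right)
      simpa [Finset.sum_insert hi] using h
  exact key Finset.univ

end OneHot

section Simulation

variable {n d : ℕ}

/-- The cost of one arithmetic operation on `d` by `d` matrices. -/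
def nodeCost (q d : ℕ) : ℕ := d * d * (2 + 2 * (d * opCost q))

variable {K : Type} [DecidableEq K]

/-- The indicators of the entries of a matrix. -/
def matrixOneHot (A : (Fin N → Bool) → Matrix (Fin d) (Fin d) K) :
    Set ((Fin N → Bool) → Bool) :=
  ⋃ p : Fin d × Fin d, oneHot fun x => A x p.1 p.2

theorem oneHot_subset_matrixOneHot (A : (Fin N → Bool) → Matrix (Fin d) (Fin d) K)
    (a b : Fin d) : (oneHot fun x => A x a b) ⊆ matrixOneHot A :=
  Set.subset_iUnion (fun p : Fin d × Fin d => oneHot fun x => A x p.1 p.2) (a, b)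

theorem derives_matrixOneHot [Fintype K] {A : (Fin N → Bool) → Matrix (Fin d) (Fin d) K}
    (h : ∀ a b, Derives G (2 + 2 * (d * opCost (Fintype.card K))) (oneHot fun x => A x a b)) :
    Derives G (nodeCost (Fintype.card K) d) (matrixOneHot A) := by
  have := derives_iUnion (ι := Fin d × Fin d) fun p => h p.1 p.2
  rw [Fintype.card_prod, Fintype.card_fin] at this
  exact this

variable [Field K] [Fintype K]

theorem derives_matrixOneHot_add {A B : (Fin N → Bool) → Matrix (Fin d) (Fin d) K}
    (hA : matrixOneHot A ⊆ G) (hB : matrixOneHot B ⊆ G) :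
    Derives G (nodeCost (Fintype.card K) d) (matrixOneHot fun x => A x + B x) := by
  refine derives_matrixOneHot fun a b => ?_
  refine (derives_oneHot_op (· + ·) ((oneHot_subset_matrixOneHot A a b).trans hA)
    ((oneHot_subset_matrixOneHot B a b).trans hB)).mono ?_
  have : 1 * opCost (Fintype.card K) ≤ d * opCost (Fintype.card K) :=
    Nat.mul_le_mul_right _ a.pos
  omega

/-- Each of the d² entries needs d products and a sum of d terms, which accounts for `nodeCost`; the
other kinds of nodes are cheaper and get padded. -/
theorem derives_matrixOneHot_mul {A B : (Fin N → Bool) → Matrix (Fin d) (Fin d) K}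
    (hA : matrixOneHot A ⊆ G) (hB : matrixOneHot B ⊆ G) :
    Derives G (nodeCost (Fintype.card K) d) (matrixOneHot fun x => A x * B x) := by
  refine derives_matrixOneHot fun a b => ?_
  have h₁ := derives_iUnion (ι := Fin d) (G := G) fun l => derives_oneHot_op (· * ·)
    ((oneHot_subset_matrixOneHot A a l).trans hA) ((oneHot_subset_matrixOneHot B l b).trans hB)
  have h₂ := h₁.trans (derives_oneHot_sum (ι := Fin d) (f := fun l x => A x a l * B x l b)
    fun l => Set.subset_union_of_subset_right (Set.subset_iUnion (fun l => oneHot fun x =>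
      A x a l * B x l b) l) _)
  rw [Fintype.card_fin] at h₂
  simpa only [Matrix.mul_apply] using h₂.mono (by omega)

/-- A Boolean program can evaluate an arithmetic program at matrices whose entries are `0` or
inputs. -/
theorem derives_eval {X : (Fin N → Bool) → Fin n → Matrix (Fin d) (Fin d) K}
    (hX : ∀ i a b, (∃ e, ∀ x, X x i a b = if x e then 1 else 0) ∨ ∀ x, X x i a b = 0)
    {k : ℕ} (P : ArithProg K n k) :
    Derives (Set.range fun (i : Fin N) x => x i) (k * nodeCost (Fintype.card K) d)
      (⋃ i, matrixOneHot fun x => FreeAlgebra.lift K (X x) (P.eval i)) := by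
  have key : ∀ {k : ℕ} (P : ArithProg K n k) (Q : ArithProg K n (k + 1))
      (v : FreeAlgebra K (Fin n)),
      Q.eval = Fin.snoc (α := fun _ => FreeAlgebra K (Fin n)) P.eval v →
      Derives (Set.range fun (i : Fin N) x => x i) (k * nodeCost (Fintype.card K) d)
        (⋃ i, matrixOneHot fun x => FreeAlgebra.lift K (X x) (P.eval i)) →
      Derives ((Set.range fun (i : Fin N) x => x i) ∪
        ⋃ i, matrixOneHot fun x => FreeAlgebra.lift K (X x) (P.eval i))
        (nodeCost (Fintype.card K) d) (matrixOneHot fun x => FreeAlgebra.lift K (X x) v) →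
      Derives (Set.range fun (i : Fin N) x => x i) ((k + 1) * nodeCost (Fintype.card K) d)
        (⋃ i, matrixOneHot fun x => FreeAlgebra.lift K (X x) (Q.eval i)) := by
    intro k P Q v hQ hP hv
    rw [Nat.add_one_mul]
    refine hP.trans (hv.subset ?_)
    refine Set.iUnion_subset fun i => ?_
    rw [hQ]
    refine Fin.lastCases ?_ (fun i => ?_) i
    · simp only [Fin.snoc_last]
      exact Set.subset_union_right
    · simp only [Fin.snoc_castSucc]
      refine Set.subset_union_of_subset_left (Set.subset_union_of_subset_right ?_ _) _
      exact Set.subset_iUnion (fun i => matrixOneHot fun x =>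
        FreeAlgebra.lift K (X x) (P.eval i)) i
  induction P with
  | nil => simpa using (derives_self _).subset (I := ∅) (by simp)
  | var P i ih =>
    refine key P _ _ rfl ih (derives_matrixOneHot fun a b => Derives.mono ?_ (le_add_right le_rfl))
    simp only [FreeAlgebra.lift_ι_apply]
    rcases hX i a b with ⟨e, he⟩ | h
    · simp only [he]
      exact derives_oneHot_bit (g := fun x => x e) (Or.inl ⟨e, rfl⟩) one_ne_zero
    · simp only [h]
      exact derives_oneHot_const _
  | const P c ih =>
    refine key P _ _ rfl ih (derives_matrixOneHot fun a b => Derives.mono ?_ (le_add_right le_rfl))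
    simp only [AlgHom.commutes]
    exact derives_oneHot_const _
  | add P i j ih =>
    refine key P _ _ rfl ih ?_
    simp only [map_add]
    exact derives_matrixOneHot_add (Set.subset_union_of_subset_right (Set.subset_iUnion
      (fun i => matrixOneHot fun x => FreeAlgebra.lift K (X x) (P.eval i)) i) _)
      (Set.subset_union_of_subset_right (Set.subset_iUnion
      (fun i => matrixOneHot fun x => FreeAlgebra.lift K (X x) (P.eval i)) j) _)
  | mul P i j ih =>
    refine key P _ _ rfl ih ?_
    simp only [map_mul]
    exact derives_matrixOneHot_mul (Set.subset_union_of_subset_right (Set.subset_iUnion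
      (fun i => matrixOneHot fun x => FreeAlgebra.lift K (X x) (P.eval i)) i) _)
      (Set.subset_union_of_subset_right (Set.subset_iUnion
      (fun i => matrixOneHot fun x => FreeAlgebra.lift K (X x) (P.eval i)) j) _)

/-- A Boolean circuit can decide whether an entry of the value of an arithmetic program does not
vanish. -/
theorem exists_boolCircuit {X : (Fin N → Bool) → Fin n → Matrix (Fin d) (Fin d) K}
    (hX : ∀ i a b, (∃ e, ∀ x, X x i a b = if x e then 1 else 0) ∨ ∀ x, X x i a b = 0)
    {k : ℕ} (P : ArithProg K n k) (out : Fin k) (a b : Fin d) {m : ℕ}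
    (hm : N + (k * nodeCost (Fintype.card K) d + 1) ≤ m) :
    ∃ C : BoolCircuit N m, C.setSystem =
      {S | FreeAlgebra.lift K (X fun i => decide (i ∈ S)) (P.eval out) a b ≠ 0} := by
  have h := (derives_eval hX P).trans (derives_not (G := (Set.range fun (i : Fin N) x => x i) ∪
    ⋃ i, matrixOneHot fun x => FreeAlgebra.lift K (X x) (P.eval i))
    (g := fun x => decide (FreeAlgebra.lift K (X x) (P.eval out) a b = 0)) (Or.inr
      (Set.mem_iUnion.2 ⟨out, oneHot_subset_matrixOneHot _ a b ⟨0, rfl⟩⟩)))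
  obtain ⟨e, rfl⟩ := Nat.exists_eq_add_of_le hm
  obtain ⟨Q, -, hQ⟩ := h.mono (Nat.le_add_right _ e) N .inputs (by
    rintro _ ⟨i, rfl⟩
    exact ⟨i, rfl⟩)
  obtain ⟨o, ho⟩ := hQ rfl
  rw [add_assoc N]
  refine ⟨⟨Q, o⟩, ?_⟩
  ext S
  have := congrFun ho fun i => decide (i ∈ S)
  simp only at this
  simp [BoolCircuit.setSystem, this]

end Simulation

end BoolProg

/-! ### Selecting monomials by substituting matrices -/

/-- The letters of a word satisfy `q` at their positions, where positions are counted from `k`. -/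
def follows (q : ℕ → ℕ → Bool) : ℕ → List ℕ → Bool
  | _, [] => true
  | k, i :: w => q k i && follows q (k + 1) w

theorem follows_iff {q : ℕ → ℕ → Bool} {k : ℕ} {w : List ℕ} :
    follows q k w = true ↔ ∀ l < w.length, q (k + l) (w.getD l 0) = true := by
  induction w generalizing k with
  | nil => simp [follows]
  | cons i w ih =>
    rw [follows, Bool.and_eq_true, ih, List.length_cons]
    constructor
    · rintro ⟨h₁, h₂⟩ l hl
      cases l with
      | zero => exact h₁
      | succ l =>
        have := h₂ l (by omega)
        rwa [show k + 1 + l = k + (l + 1) by ring] at this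
    · intro h
      refine ⟨h 0 (by omega), fun l hl => ?_⟩
      have := h (l + 1) (by omega)
      rwa [show k + (l + 1) = k + 1 + l by ring] at this

/-- The matrix whose entries at `(a, a + 1)` indicate whether `q a i` holds. -/
def shiftMatrix (R : Type) [Zero R] [One R] (d : ℕ) (q : ℕ → ℕ → Bool) (i : ℕ) :
    Matrix (Fin (d + 1)) (Fin (d + 1)) R :=
  Matrix.of fun a b => if (a : ℕ) + 1 = b ∧ q a i = true then 1 else 0

/-- All nonzero entries lie just above the diagonal, so only one path contributes to an entry of the
product. Its steps count the positions in the word, and its factors test the letters there. -/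
theorem prod_shiftMatrix (R : Type) [CommRing R] {d : ℕ} (q : ℕ → ℕ → Bool) (w : List ℕ)
    (a b : Fin (d + 1)) : (w.map (shiftMatrix R d q)).prod a b =
      if (a : ℕ) + w.length = b ∧ follows q a w = true then 1 else 0 := by
  induction w generalizing a with
  | nil => simp [follows, Matrix.one_apply, Fin.ext_iff]
  | cons i w ih =>
    rw [List.map_cons, List.prod_cons, Matrix.mul_apply]
    simp only [ih, List.length_cons, follows, Bool.and_eq_true]
    by_cases ha : (a : ℕ) + 1 < d + 1
    · rw [Finset.sum_eq_single (⟨a + 1, ha⟩ : Fin (d + 1))]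
      · simp only [shiftMatrix, Matrix.of_apply, true_and, ← ite_and, mul_ite, mul_one, mul_zero]
        refine if_congr ?_ rfl rfl
        rw [show (a : ℕ) + 1 + w.length = a + (w.length + 1) by ring]
        tauto
      · intro c _ hc
        have : ¬ ((a : ℕ) + 1 = c) := fun h => hc (Fin.ext h.symm)
        simp [shiftMatrix, this]
      · simp
    · rw [if_neg (by have := b.isLt; omega)]
      refine Finset.sum_eq_zero fun c _ => ?_
      have : ¬ ((a : ℕ) + 1 = c) := by have := c.isLt; omega
      simp [shiftMatrix, this]

theorem map_shiftMatrix {R S : Type} [Semiring R] [Semiring S] (φ : R →+* S) (d : ℕ)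
    (q : ℕ → ℕ → Bool) (i : ℕ) : (shiftMatrix R d q i).map φ = shiftMatrix S d q i := by
  ext a b
  simp only [shiftMatrix, Matrix.map_apply, Matrix.of_apply]
  split_ifs <;> simp

/-- The word over `Fin n` with the given letters. -/
def finWord (n : ℕ) (w : List ℕ) : List (Fin n) :=
  w.filterMap fun i => if h : i < n then some ⟨i, h⟩ else none

theorem map_val_finWord {n : ℕ} {w : List ℕ} (hw : ∀ i ∈ w, i < n) :
    (finWord n w).map Fin.val = w := by
  induction w with
  | nil => rfl
  | cons i w ih =>
    have hi : i < n := hw i (by simp)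
    rw [finWord, List.filterMap_cons_some (by rw [dif_pos hi]), List.map_cons]
    exact congrArg _ (ih fun j hj => hw j (by simp [hj]))

theorem mem_hardWords {n b : ℕ} (hb : b ≤ n) {r : ℕ → ℕ} {ws : List (List ℕ)} {w : List ℕ}
    (hw : w ∈ hardWords n b r ws) : w.length = n ∧ ∀ i ∈ w, i < n := by
  simp only [hardWords, List.mem_flatMap, List.mem_range, List.mem_replicate] at hw
  obtain ⟨i, hi, j, hj, -, rfl⟩ := hw
  have hu := mem_allWords.1 (List.getElem_mem hi)
  have hv := mem_allWords.1 (List.getElem_mem hj)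
  rw [List.getD_eq_getElem _ _ hi, List.getD_eq_getElem _ _ hj]
  refine ⟨by rw [List.length_append, hu.1, hv.1]; omega, fun l hl => ?_⟩
  rcases List.mem_append.1 hl with hl | hl
  · exact hu.2 l hl
  · exact hv.2 l hl

/-- The terms of the sum of the monomials given by a list of words. -/
def wordTerms (F : Type) [One F] (n : ℕ) (W : List (List ℕ)) : List (F × List (Fin n)) :=
  W.map fun w => (1, finWord n w)

/-- The corner sees words of length `n` from position 0 on, each with value 1 or 0. The matrices may
have entries in an algebra `R` over `F`, which is used with the `p`-adic numbers over ℚ. -/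
theorem lift_shiftMatrix_wordTerms (F R : Type) [Field F] [CommRing R] [Algebra F R] {n : ℕ}
    (q : ℕ → ℕ → Bool) {W : List (List ℕ)} (hW : ∀ w ∈ W, w.length = n ∧ ∀ i ∈ w, i < n) :
    FreeAlgebra.lift F (fun i : Fin n => shiftMatrix R n q i) (ofTerms (wordTerms F n W)) 0
      (Fin.last n) = (W.countP (follows q 0) : R) := by
  induction W with
  | nil => simp [ofTerms, wordTerms]
  | cons w W ih =>
    have hw := hW w (by simp)
    have ih := ih fun v hv => hW v (by simp [hv])
    have h : ofTerms (wordTerms F n (w :: W)) =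
        ((finWord n w).map (FreeAlgebra.ι F)).prod + ofTerms (wordTerms F n W) := by
      simp [ofTerms, wordTerms]
    have h₁ : ((finWord n w).map fun i : Fin n => shiftMatrix R n q i) =
        w.map (shiftMatrix R n q) := by
      conv_rhs => rw [← map_val_finWord hw.2, List.map_map]
      rfl
    rw [h, map_add, map_list_prod, List.map_map, Matrix.add_apply, ih, List.countP_cons]
    have h₂ : (FreeAlgebra.lift F fun i : Fin n => shiftMatrix R n q i) ∘ FreeAlgebra.ι F =
        fun i : Fin n => shiftMatrix R n q i := by
      funext i
      simp
    rw [h₂, h₁, prod_shiftMatrix, hw.1]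
    by_cases hf : follows q 0 w = true <;> simp [hf, add_comm]

/-- The index of the pair of `l` and the letter at position `l` of the word `w`. -/
def graphIndex (n : ℕ) (w : List ℕ) (l : Fin n) : Fin (n * n) :=
  ⟨n * l + w.getD l 0 % n, by
    have h₁ := Nat.mod_lt (w.getD l 0) l.pos
    have h₂ : n * (l + 1) ≤ n * n := Nat.mul_le_mul_left _ l.isLt
    rw [mul_add, mul_one] at h₂
    omega⟩

/-- The graph of a word, as a set of indices of pairs. -/
def wordGraph (n : ℕ) (w : List ℕ) : Finset (Fin (n * n)) := Finset.univ.image (graphIndex n w)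

theorem graphIndex_div {n : ℕ} (w : List ℕ) (l : Fin n) : (graphIndex n w l : ℕ) / n = l := by
  rw [graphIndex, Nat.mul_add_div l.pos, Nat.div_eq_of_lt (Nat.mod_lt _ l.pos), add_zero]

theorem graphIndex_mod {n : ℕ} (w : List ℕ) (l : Fin n) :
    (graphIndex n w l : ℕ) % n = w.getD l 0 % n := by
  rw [graphIndex, Nat.mul_add_mod, Nat.mod_mod]

theorem graphIndex_injective (n : ℕ) (w : List ℕ) : Function.Injective (graphIndex n w) :=
  fun a b h => Fin.ext (by rw [← graphIndex_div w a, h, graphIndex_div])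

/-- The reduction in `graphIndex` only keeps indices in range for arbitrary lists; it changes
nothing for words over the right alphabet. -/
theorem getD_mod {n : ℕ} {w : List ℕ} (hw : ∀ i ∈ w, i < n) (l : Fin n) :
    w.getD l 0 % n = w.getD l 0 := by
  refine Nat.mod_eq_of_lt ?_
  rw [List.getD_eq_getElem?_getD]
  cases h : w[(l : ℕ)]? with
  | none => exact l.pos
  | some a => exact hw a (List.mem_of_getElem? h)

theorem graphIndex_val {n : ℕ} {w : List ℕ} (hw : ∀ i ∈ w, i < n) (l : Fin n) :
    (graphIndex n w l : ℕ) = n * l + w.getD l 0 :=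
  congrArg (n * (l : ℕ) + ·) (getD_mod hw l)

/-- A graph has exactly one pair for each position, so inclusion forces equal letters: graphs form
an antichain. -/
theorem eq_of_wordGraph_subset {n : ℕ} {v w : List ℕ} (hv : v.length = n ∧ ∀ i ∈ v, i < n)
    (hw : w.length = n ∧ ∀ i ∈ w, i < n) (h : wordGraph n v ⊆ wordGraph n w) : v = w := by
  refine List.ext_getElem (hv.1.trans hw.1.symm) fun l h₁ h₂ => ?_
  have hl : l < n := hv.1 ▸ h₁
  obtain ⟨l', -, h₃⟩ := Finset.mem_image.1 (h (Finset.mem_image_of_mem _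
    (Finset.mem_univ (⟨l, hl⟩ : Fin n))))
  have h₄ : l' = ⟨l, hl⟩ := by
    refine Fin.ext ?_
    rw [← graphIndex_div w l', h₃, graphIndex_div]
  subst h₄
  have h₅ := congrArg (fun e : Fin (n * n) => (e : ℕ) % n) h₃
  rw [graphIndex_mod, graphIndex_mod, getD_mod hv.2, getD_mod hw.2] at h₅
  rw [List.getD_eq_getElem _ _ h₁, List.getD_eq_getElem _ _ h₂] at h₅
  exact h₅.symm

theorem sum_wordGraph {n : ℕ} {w : List ℕ} (hw : w.length = n ∧ ∀ i ∈ w, i < n)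
    (f : Fin (n * n) → ℕ) : ∑ e ∈ wordGraph n w, f e = wordWeight n (List.ofFn f) w := by
  rw [wordGraph, Finset.sum_image ((graphIndex_injective n w).injOn), wordWeight_eq, hw.1,
    Finset.sum_range]
  refine Finset.sum_congr rfl fun l _ => ?_
  rw [← graphIndex_val hw.2, List.getD_eq_getElem _ _ (by simp)]
  simp

/-- The position `l` carries the letter `i`, which agrees with the prefix `u` of length `b`, and
the index of `(l, i)` belongs to a given set. -/
def prefixTest (n b : ℕ) (u : List ℕ) (x : Fin (n * n) → Bool) (l i : ℕ) : Bool :=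
  decide (l < b → u.getD l 0 = i) && if h : n * l + i < n * n then x ⟨n * l + i, h⟩ else false

/-- Both agreement with the prefix and inclusion of the graph are checked position by position,
which is the kind of condition that shift matrices can test. -/
theorem follows_prefixTest {n b : ℕ} {u u' v : List ℕ} (hu : u.length = b) (hu' : u'.length = b)
    (hv : (u' ++ v).length = n ∧ ∀ i ∈ u' ++ v, i < n) (S : Finset (Fin (n * n))) :
    follows (prefixTest n b u fun e => decide (e ∈ S)) 0 (u' ++ v) = true ↔
      u' = u ∧ wordGraph n (u' ++ v) ⊆ S := by
  have h : ∀ l : Fin n, n * l + (u' ++ v).getD l 0 = (graphIndex n (u' ++ v) l : ℕ) :=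
    fun l => (graphIndex_val hv.2 l).symm
  rw [follows_iff, hv.1]
  simp only [zero_add, prefixTest, Bool.and_eq_true, decide_eq_true_eq]
  constructor
  · intro H
    constructor
    · refine List.ext_getElem (hu'.trans hu.symm) fun l h₁ h₂ => ?_
      have h₃ := (H l (by have := hv.1; rw [List.length_append] at this; omega)).1 (hu ▸ h₂)
      rw [List.getD_append _ _ _ _ h₁, List.getD_eq_getElem _ _ h₁,
        List.getD_eq_getElem _ _ h₂] at h₃
      exact h₃.symm
    · intro e he
      obtain ⟨l, -, rfl⟩ := Finset.mem_image.1 he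
      have h₃ := (H l l.isLt).2
      simp only [h, Fin.is_lt, dif_pos, decide_eq_true_eq] at h₃
      exact h₃
  · rintro ⟨rfl, H⟩ l hl
    refine ⟨fun hlb => ?_, ?_⟩
    · rw [List.getD_append _ _ _ _ (hu ▸ hlb)]
    · have h₃ := h ⟨l, hl⟩
      dsimp only at h₃
      simp only [h₃, Fin.is_lt, dif_pos, decide_eq_true_eq]
      exact H (Finset.mem_image_of_mem _ (Finset.mem_univ _))

/-- The test rejects the blocks of all other prefixes, since prefixes are listed without repetition.
In the block that remains, each word occurs as often as its coefficient says. -/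
theorem countP_hardWords {n b : ℕ} (hb : b ≤ n) (r : ℕ → ℕ) (ws : List (List ℕ)) {i : ℕ}
    (hi : i < (allWords n b).length) (S : Finset (Fin (n * n))) :
    (hardWords n b r ws).countP
      (follows (prefixTest n b (allWords n b)[i] fun e => decide (e ∈ S)) 0) =
    ∑ j : Fin (allWords n (n - b)).length with
      wordGraph n ((allWords n b)[i] ++ (allWords n (n - b))[j]) ⊆ S,
      (kernelVector (r i) (allWords n (n - b)).length
        (weightRows n ws (allWords n b)[i] (allWords n (n - b)))).getD j 0 := by
  rw [hardWords, List.countP_flatMap]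
  have h₁ : ∀ (m : ℕ) (f : ℕ → ℕ), ((List.range m).map f).sum = ∑ a ∈ Finset.range m, f a :=
    fun m f => rfl
  have h₂ : ∀ i' (hi' : i' < (allWords n b).length) j (hj : j < (allWords n (n - b)).length),
      ((allWords n b)[i'] ++ (allWords n (n - b))[j]).length = n ∧
      ∀ l ∈ (allWords n b)[i'] ++ (allWords n (n - b))[j], l < n := by
    intro i' hi' j hj
    have hu := mem_allWords.1 (List.getElem_mem hi')
    have hv := mem_allWords.1 (List.getElem_mem hj)
    refine ⟨by rw [List.length_append, hu.1, hv.1]; omega, fun l hl => ?_⟩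
    rcases List.mem_append.1 hl with hl | hl
    · exact hu.2 l hl
    · exact hv.2 l hl
  rw [h₁, Finset.sum_eq_single i]
  · simp only [Function.comp_apply]
    rw [List.countP_flatMap, h₁, Finset.sum_range, Finset.sum_filter]
    refine Finset.sum_congr rfl fun j _ => ?_
    simp only [Function.comp_apply, List.countP_replicate]
    rw [List.getD_eq_getElem _ _ hi, List.getD_eq_getElem _ _ j.isLt]
    have hu := (mem_allWords.1 (List.getElem_mem hi)).1
    refine if_congr ?_ rfl rfl
    rw [follows_prefixTest hu hu (h₂ i hi j j.isLt)]
    exact and_iff_right rfl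
  · intro i' hi' hne
    rw [Finset.mem_range] at hi'
    simp only [Function.comp_apply]
    rw [List.countP_flatMap, h₁]
    refine Finset.sum_eq_zero fun j hj => ?_
    rw [Finset.mem_range] at hj
    simp only [Function.comp_apply, List.countP_replicate]
    rw [List.getD_eq_getElem _ _ hi', List.getD_eq_getElem _ _ hj, if_neg]
    rw [follows_prefixTest (mem_allWords.1 (List.getElem_mem hi)).1
      (mem_allWords.1 (List.getElem_mem hi')).1 (h₂ i' hi' j hj)]
    exact fun h => hne ((nodup_allWords n b).getElem_inj_iff.1 h.1)
  · simp [hi]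

/-! ### A small arithmetic circuit contradicts isolation -/

theorem length_weightRows (n : ℕ) (ws : List (List ℕ)) (u : List ℕ) (V : List (List ℕ)) :
    (weightRows n ws u V).length = ws.length * (2 * (n * n) * n + 1) := by
  simp [weightRows, List.length_flatMap]

/-- If `K` is a finite field whose characteristic is the modulus for some prefix, the hard words
cannot be counted modulo the characteristic by a small arithmetic program over `K`. -/
theorem lift_shiftMatrix_ne_countP (K : Type) [Field K] [Fintype K] {p : ℕ} [CharP K p] {n b : ℕ}
    (hb : b ≤ n) {r : ℕ → ℕ} {i : ℕ} (hi : i < n ^ b) (hr : r i + 1 = p)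
    {A : List (Fin (n * n) → ℕ)} (hA : ∀ w ∈ A, ∀ e, w e ≤ 2 * (n * n)) {m : ℕ}
    (hC : ∀ C : BoolCircuit (n * n) m, C.setSystem.Nonempty →
      ∃ w ∈ A, HasUniqueMinWeightSet w C.setSystem)
    (hrows : A.length * (2 * (n * n) * n + 1) < n ^ (n - b)) {k : ℕ} (P : ArithProg K n k)
    (out : Fin k) (hm : n * n + (k * BoolProg.nodeCost (Fintype.card K) (n + 1) + 1) ≤ m)
    (hP : ∀ q, FreeAlgebra.lift K (fun i : Fin n => shiftMatrix K n q i) (P.eval out) 0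
      (Fin.last n) = ((hardWords n b r (A.map List.ofFn)).countP (follows q 0) : K)) : False := by
  classical
  rw [← length_allWords] at hi
  set u := (allWords n b)[i] with hu
  have hu' := mem_allWords.1 (List.getElem_mem hi)
  rw [← hu] at hu'
  set V := allWords n (n - b) with hV
  have hVlen : V.length = n ^ (n - b) := length_allWords _ _
  have hw : ∀ j : Fin V.length, (u ++ V[j]).length = n ∧ ∀ l ∈ u ++ V[j], l < n := by
    intro j
    have hv := mem_allWords.1 (List.getElem_mem j.isLt)
    have hv₁ : V[j].length = n - b := hv.1
    refine ⟨by rw [List.length_append, hu'.1, hv₁]; omega, fun l hl => ?_⟩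
    rcases List.mem_append.1 hl with hl | hl
    · exact hu'.2 l hl
    · exact hv.2 l hl
  have hlen := length_weightRows n (A.map List.ofFn) u V
  rw [List.length_map] at hlen
  obtain ⟨h₁, h₂⟩ := kernelVector_spec K (N := V.length) hr
    (rows := weightRows n (A.map List.ofFn) u V) (by rw [hlen, hVlen]; exact hrows)
  set c := listVector K V.length (kernelVector (r i) V.length
    (weightRows n (A.map List.ofFn) u V)) with hc
  let E : Fin V.length → Finset (Fin (n * n)) := fun j => wordGraph n (u ++ V[j])
  have hE : ∀ j j', E j ⊆ E j' → j = j' := by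
    intro j j' h
    have h := List.append_cancel_left (eq_of_wordGraph_subset (hw j) (hw j') h)
    exact Fin.ext ((nodup_allWords n (n - b)).getElem_inj_iff.1 h)
  -- The prefix `u` is hardwired: an entry off the superdiagonal, or for a letter that disagrees
  -- with `u`, is constantly 0, and every other entry is an input bit.
  obtain ⟨C, hCS⟩ := BoolProg.exists_boolCircuit (K := K) (N := n * n)
    (X := fun x i => shiftMatrix K n (prefixTest n b u x) i) (by
      intro i a a'
      by_cases h : (a : ℕ) + 1 = a' ∧ (a < b → u.getD a 0 = i) ∧ n * a + i < n * n
      · refine Or.inl ⟨⟨n * a + i, h.2.2⟩, fun x => ?_⟩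
        have e : prefixTest n b u x a i = x ⟨n * a + i, h.2.2⟩ := by
          rw [prefixTest, dif_pos h.2.2, decide_eq_true h.2.1, Bool.true_and]
        simp only [shiftMatrix, Matrix.of_apply, e, h.1, true_and]
      · refine Or.inr fun x => ?_
        simp only [shiftMatrix, Matrix.of_apply]
        refine if_neg fun h' => h ⟨h'.1, ?_⟩
        have h' := h'.2
        rw [prefixTest, Bool.and_eq_true, decide_eq_true_eq] at h'
        refine ⟨h'.1, ?_⟩
        by_contra hlt
        simp [hlt] at h') P out 0 (Fin.last n) hm
  have hsys : C.setSystem = {S | ∑ j with E j ⊆ S, c j ≠ 0} := by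
    rw [hCS]
    ext S
    rw [Set.mem_ofPred_eq, Set.mem_ofPred_eq, hP, countP_hardWords hb _ _ hi, Nat.cast_sum]
    rfl
  -- The system is not empty: at the graph of a word with nonzero coefficient the sum has this
  -- coefficient as its only term.
  obtain ⟨w, hwA, hmin⟩ := hC C (by
    obtain ⟨j, hj⟩ := Function.ne_iff.1 h₁
    refine ⟨E j, ?_⟩
    rw [hsys]
    have : (Finset.univ.filter fun j' => E j' ⊆ E j) = {j} := by
      ext j'
      simp only [Finset.mem_filter, Finset.mem_univ, true_and, Finset.mem_singleton]
      exact ⟨hE j' j, fun h => h ▸ subset_rfl⟩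
    rw [Set.mem_ofPred_eq, this, Finset.sum_singleton]
    exact hj)
  rw [hsys] at hmin
  refine not_hasUniqueMinWeightSet E hE c w (fun t => ?_) hmin
  have hsum : ∀ j, ∑ e ∈ E j, w e = wordWeight n (List.ofFn w) (u ++ V[j]) :=
    fun j => sum_wordGraph (hw j) w
  by_cases ht : t < 2 * (n * n) * n + 1
  · have h := h₂ (V.map fun v => if wordWeight n (List.ofFn w) (u ++ v) = t then 1 else 0)
      (List.mem_flatMap.2 ⟨List.ofFn w, List.mem_map.2 ⟨w, hwA, rfl⟩,
        List.mem_map.2 ⟨t, List.mem_range.2 ht, rfl⟩⟩)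
    rw [Finset.sum_filter]
    refine (Finset.sum_congr rfl fun j _ => ?_).trans h
    have : listVector K V.length (V.map fun v => if wordWeight n (List.ofFn w) (u ++ v) = t
        then 1 else 0) j = if ∑ e ∈ E j, w e = t then 1 else 0 := by
      rw [hsum, listVector, List.getD_eq_getElem _ _ (by simp), List.getElem_map]
      split_ifs with h₁ h₂ h₂
      · simp
      · exact absurd h₁ h₂
      · exact absurd h₂ h₁
      · simp
    rw [this, mul_ite, mul_one, mul_zero]
  -- Larger weights, for which there are no rows, do not occur: a graph has at most n pairs, each of
  -- weight at most 2 n².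
  · rw [Finset.filter_false_of_mem, Finset.sum_empty]
    intro j _ hj
    have hcard : (E j).card ≤ n := by
      refine Finset.card_image_le.trans ?_
      simp
    have : ∑ e ∈ E j, w e ≤ (E j).card * (2 * (n * n)) :=
      Finset.sum_le_card_nsmul _ _ _ fun e _ => hA w hwA e
    have : (E j).card * (2 * (n * n)) ≤ n * (2 * (n * n)) := Nat.mul_le_mul_right _ hcard
    have : n * (2 * (n * n)) = 2 * (n * n) * n := by ring
    omega

/-! ### Reduction of rational circuits modulo a prime -/

/-- The product of the denominators of all constants of an arithmetic program over `ℚ`. -/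
def ArithProg.denProd {n : ℕ} : {k : ℕ} → ArithProg ℚ n k → ℕ
  | _, .nil => 1
  | _, .var P _ => P.denProd
  | _, .const P c => P.denProd * c.den
  | _, .add P _ _ => P.denProd
  | _, .mul P _ _ => P.denProd

theorem ArithProg.denProd_pos {n k : ℕ} (P : ArithProg ℚ n k) : 0 < P.denProd := by
  induction P with
  | nil => exact one_pos
  | var P i ih => exact ih
  | const P c ih => exact Nat.mul_pos ih c.pos
  | add P i j ih => exact ih
  | mul P i j ih => exact ih

theorem lt_two_pow_length_encodePosNum (p : PosNum) :
    (p : ℕ) < 2 ^ (Computability.encodePosNum p).length := by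
  induction p with
  | one => simp [Computability.encodePosNum]
  | bit0 p ih =>
    rw [Computability.encodePosNum, List.length_cons, pow_succ, PosNum.cast_bit0]
    omega
  | bit1 p ih =>
    rw [Computability.encodePosNum, List.length_cons, pow_succ, PosNum.cast_bit1]
    omega

theorem lt_two_pow_length_encodeNat (n : ℕ) : n < 2 ^ (Computability.encodeNat n).length := by
  rw [Computability.encodeNat]
  conv_lhs => rw [← Num.to_of_nat n]
  cases (n : Num) with
  | zero => simp [Computability.encodeNum]
  | pos p => exact lt_two_pow_length_encodePosNum p

/-- This is where it matters that a rational constant counts with its binary length. -/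
theorem ArithProg.denProd_le {n k : ℕ} (P : ArithProg ℚ n k) :
    P.denProd ≤ 2 ^ P.size encodeRat := by
  induction P with
  | nil => exact Nat.one_le_two_pow
  | var P i ih => exact ih.trans (Nat.pow_le_pow_right two_pos (Nat.le_succ _))
  | const P c ih =>
    rw [denProd, size, pow_add]
    refine Nat.mul_le_mul ih ((lt_two_pow_length_encodeNat c.den).le.trans
      (Nat.pow_le_pow_right two_pos ?_))
    simp only [encodeRat, List.length_append, List.length_cons, List.length_map]
    omega
  | add P i j ih => exact ih.trans (Nat.pow_le_pow_right two_pos (Nat.le_succ _))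
  | mul P i j ih => exact ih.trans (Nat.pow_le_pow_right two_pos (Nat.le_succ _))

theorem ArithProg.length_le_size {F Γ : Type} {enc : F → List Γ} (henc : ∀ c, enc c ≠ []) {n k : ℕ}
    (P : ArithProg F n k) : k ≤ P.size enc := by
  induction P with
  | nil => exact le_rfl
  | var P i ih => exact Nat.succ_le_succ ih
  | const P c ih => exact Nat.add_le_add ih (List.length_pos_iff.2 (henc c))
  | add P i j ih => exact Nat.succ_le_succ ih
  | mul P i j ih => exact Nat.succ_le_succ ih

/-- An arithmetic program over `ℚ` can be reduced modulo a prime that does not divide the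
denominators of its constants. -/
theorem ArithProg.exists_reduction {p : ℕ} [Fact p.Prime] {n k : ℕ} (P : ArithProg ℚ n k)
    (hp : ¬ p ∣ P.denProd) : ∃ Q : ArithProg (ZMod p) n k, ∀ (d : ℕ)
      (X : Fin n → Matrix (Fin d) (Fin d) ℤ_[p]) (i : Fin k), ∃ Z : Matrix (Fin d) (Fin d) ℤ_[p],
      FreeAlgebra.lift ℚ (fun j => PadicInt.Coe.ringHom.mapMatrix (X j)) (P.eval i) =
        PadicInt.Coe.ringHom.mapMatrix Z ∧
      FreeAlgebra.lift (ZMod p) (fun j => PadicInt.toZMod.mapMatrix (X j)) (Q.eval i) =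
        PadicInt.toZMod.mapMatrix Z := by
  -- Both evaluations are images of one matrix over the `p`-adic integers, which is built along the
  -- program.
  induction P with
  | nil => exact ⟨.nil, fun _ _ i => i.elim0⟩
  | var P i ih =>
    obtain ⟨Q, hQ⟩ := ih hp
    refine ⟨Q.var i, fun d X j => ?_⟩
    refine Fin.lastCases ?_ (fun j => ?_) j
    · exact ⟨X i, by simp [eval], by simp [eval]⟩
    · simpa [eval] using hQ d X j
  | const P c ih =>
    obtain ⟨Q, hQ⟩ := ih fun h => hp (h.mul_right _)
    -- As `p` does not divide its denominator, the constant is a `p`-adic integer; its residue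
    -- replaces it in the reduced program.
    have hc : ‖(c : ℚ_[p])‖ ≤ 1 := Padic.norm_rat_le_one fun h => hp (h.mul_left _)
    obtain ⟨z, hz⟩ : ∃ z : ℤ_[p], PadicInt.Coe.ringHom z = (c : ℚ_[p]) := ⟨⟨c, hc⟩, rfl⟩
    refine ⟨Q.const (PadicInt.toZMod z), fun d X j => ?_⟩
    refine Fin.lastCases ?_ (fun j => ?_) j
    · refine ⟨Matrix.diagonal fun _ => z, ?_, ?_⟩
      · simp only [eval, Fin.snoc_last, AlgHom.commutes, RingHom.mapMatrix_apply,
          Matrix.algebraMap_eq_diagonal, Pi.algebraMap_def]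
        rw [Matrix.diagonal_map (map_zero _), hz]
        rfl
      · simp only [eval, Fin.snoc_last, AlgHom.commutes, RingHom.mapMatrix_apply,
          Matrix.algebraMap_eq_diagonal, Pi.algebraMap_def]
        rw [Matrix.diagonal_map (map_zero _)]
        rfl
    · simpa [eval] using hQ d X j
  | add P i i' ih =>
    obtain ⟨Q, hQ⟩ := ih hp
    refine ⟨Q.add i i', fun d X j => ?_⟩
    refine Fin.lastCases ?_ (fun j => ?_) j
    · obtain ⟨Z, h₁, h₂⟩ := hQ d X i
      obtain ⟨Z', h₃, h₄⟩ := hQ d X i'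
      refine ⟨Z + Z', ?_, ?_⟩
      · simp only [eval, Fin.snoc_last, map_add, h₁, h₃]
      · simp only [eval, Fin.snoc_last, map_add, h₂, h₄]
    · simpa [eval] using hQ d X j
  | mul P i i' ih =>
    obtain ⟨Q, hQ⟩ := ih hp
    refine ⟨Q.mul i i', fun d X j => ?_⟩
    refine Fin.lastCases ?_ (fun j => ?_) j
    · obtain ⟨Z, h₁, h₂⟩ := hQ d X i
      obtain ⟨Z', h₃, h₄⟩ := hQ d X i'
      refine ⟨Z * Z', ?_, ?_⟩
      · simp only [eval, Fin.snoc_last, map_mul, h₁, h₃]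
      · simp only [eval, Fin.snoc_last, map_mul, h₂, h₄]
    · simpa [eval] using hQ d X j

/-- Over ℚ_p the corner entry is a natural number. As ℤ_p embeds into ℚ_p, the integral matrix has
the same entry, and it can be reduced modulo `p`. -/
theorem exists_reduction_countP {p : ℕ} [Fact p.Prime] {n k : ℕ} (P : ArithProg ℚ n k)
    (hp : ¬ p ∣ P.denProd) (out : Fin k) {W : List (List ℕ)}
    (hW : ∀ w ∈ W, w.length = n ∧ ∀ i ∈ w, i < n) (hP : P.eval out = ofTerms (wordTerms ℚ n W)) :
    ∃ Q : ArithProg (ZMod p) n k, ∀ q,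
      FreeAlgebra.lift (ZMod p) (fun i : Fin n => shiftMatrix (ZMod p) n q i) (Q.eval out) 0
        (Fin.last n) = (W.countP (follows q 0) : ZMod p) := by
  obtain ⟨Q, hQ⟩ := P.exists_reduction hp
  refine ⟨Q, fun q => ?_⟩
  obtain ⟨Z, h₁, h₂⟩ := hQ (n + 1) (fun i => shiftMatrix ℤ_[p] n q i) out
  have h := lift_shiftMatrix_wordTerms ℚ ℚ_[p] q hW
  simp only [RingHom.mapMatrix_apply, map_shiftMatrix] at h₁ h₂
  rw [← hP, h₁, Matrix.map_apply] at h
  have hZ : Z 0 (Fin.last n) = (W.countP (follows q 0) : ℤ_[p]) := by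
    refine Subtype.coe_injective ?_
    exact h.trans (PadicInt.coe_natCast _).symm
  rw [h₂, Matrix.map_apply, hZ, map_natCast]

open Nat in
/-- A number below `2 ^ s` is not divisible by some prime of polynomial size in `s`. -/
theorem exists_prime_not_dvd {D s : ℕ} (hD : 0 < D) (hs : D ≤ 2 ^ s) :
    ∃ p, p.Prime ∧ p ≤ 4 * (s + 2) ^ 2 ∧ ¬ p ∣ D := by
  by_contra! H
  obtain ⟨N, hN⟩ : ∃ N, N = 4 * (s + 2) ^ 2 := ⟨_, rfl⟩
  rw [← hN] at H
  -- If all primes up to `N` divide `D`, then so does their product, which is at least 2 to the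
  -- number of these primes.
  have h₁ : (primesLE N).card ≤ s := by
    have h : ∏ p ∈ primesLE N, p ∣ D :=
      Finset.prod_primes_dvd D (fun p hp => (mem_primesLE.1 hp).2.prime) fun p hp =>
        H p (mem_primesLE.1 hp).2 (mem_primesLE.1 hp).1
    have h' : 2 ^ (primesLE N).card ≤ ∏ p ∈ primesLE N, p :=
      Finset.pow_card_le_prod _ _ _ fun p hp => (mem_primesLE.1 hp).2.two_le
    exact (Nat.pow_le_pow_iff_right one_lt_two).1 (h'.trans ((Nat.le_of_dvd hD h).trans hs))
  -- With few primes the least common multiple of 1, …, N is at most N ^ s, but by Chebyshev it is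
  -- at least 2 ^ N up to a factor N + 1. This would give N ≤ (2 s + 7) (s + 1), which is less than
  -- 4 (s + 2)².
  have h₂ : lcmUpto N ≤ N ^ (primesLE N).card := by
    rw [lcmUpto_eq_prod_pow_log]
    refine Finset.prod_le_pow_card _ _ _ fun p hp => Nat.pow_log_le_self _ (by rw [hN]; positivity)
  have h₃ := Chebyshev.two_pow_le_mul_lcmUpto N
  have h₄ : N + 1 ≤ 2 ^ (2 * s + 7) := by
    have : s + 2 ≤ 2 ^ (s + 2) := Nat.lt_two_pow_self.le
    have e : 2 ^ (2 * s + 7) = 8 * (2 ^ (s + 2)) ^ 2 := by ring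
    rw [e, hN]
    nlinarith
  have h₅ : 2 ^ N ≤ 2 ^ ((2 * s + 7) * (s + 1)) := by
    rw [pow_mul]
    refine h₃.trans (le_trans ?_ (Nat.pow_le_pow_left h₄ (s + 1)))
    rw [pow_succ, mul_comm]
    refine Nat.mul_le_mul_right _ (h₂.trans ?_)
    exact (Nat.pow_le_pow_left (Nat.le_succ N) _).trans (Nat.pow_le_pow_right (Nat.succ_pos N) h₁)
  have h₆ := (Nat.pow_le_pow_iff_right one_lt_two).1 h₅
  nlinarith

/-! ### Writing down the polynomial; homogeneity -/

/-- The letters with the given codes. -/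
def termLetter {Γ : Type} (x y z : Γ) : Fin 8 → Γ ⊕ Punct :=
  ![.inr .tick, .inr .comma, .inr .semicolon, .inl x, .inl y, .inl z, .inl z, .inl z]

/-- Repeated words take the place of coefficients, so every term begins with the same codes `pre`,
those of the coefficient 1. -/
theorem encodeTerms_wordTerms {F Γ : Type} [Field F] {enc : F → List Γ} {x y z : Γ} {pre : List ℕ}
    (hpre : (pre.map fun a => termLetter x y z (Fin.ofNat 8 a)) = (enc 1).map Sum.inl) {n : ℕ}
    {W : List (List ℕ)} (hW : ∀ w ∈ W, ∀ i ∈ w, i < n) :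
    encodeTerms enc (wordTerms F n W) =
      (W.flatMap (termCodes pre)).map fun a => termLetter x y z (Fin.ofNat 8 a) := by
  have hnats : ∀ w : List ℕ, (encodeNats w).map (Sum.inr (α := Γ)) =
      (w.flatMap fun a => List.replicate a 0 ++ [1]).map
        fun a => termLetter x y z (Fin.ofNat 8 a) := by
    intro w
    induction w with
    | nil => rfl
    | cons i w ih =>
      rw [encodeNats, List.flatMap_cons, List.map_append, List.flatMap_cons, List.map_append]
      rw [encodeNats] at ih
      rw [ih, List.map_append, List.map_append, List.map_replicate, List.map_replicate]
      rfl
  induction W with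
  | nil => rfl
  | cons w W ih =>
    have ih := ih fun v hv => hW v (by simp [hv])
    rw [encodeTerms, wordTerms] at ih ⊢
    rw [List.map_cons, List.flatMap_cons, ih, List.flatMap_cons, map_val_finWord (hW w (by simp)),
      termCodes]
    simp only [List.map_append, hnats, hpre]
    rfl

theorem isHomogeneousOfDegree_wordTerms {F : Type} [Field F] {n : ℕ} {W : List (List ℕ)}
    (hW : ∀ w ∈ W, w.length = n ∧ ∀ i ∈ w, i < n) :
    IsHomogeneousOfDegree (ofTerms (wordTerms F n W)) n := by
  rw [IsHomogeneousOfDegree]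
  induction W with
  | nil => simp [ofTerms, wordTerms]
  | cons w W ih =>
    have hw := hW w (by simp)
    have h : ofTerms (wordTerms F n (w :: W)) =
        ((finWord n w).map (FreeAlgebra.ι F)).prod + ofTerms (wordTerms F n W) := by
      simp [ofTerms, wordTerms]
    rw [h]
    refine Submodule.add_mem _ (Submodule.subset_span ?_) (ih fun v hv => hW v (by simp [hv]))
    have hl : (finWord n w).length = n := by
      have := congrArg List.length (map_val_finWord hw.2)
      rw [List.length_map] at this
      exact this.trans hw.1
    refine ⟨fun j => (finWord n w)[j], congrArg List.prod ?_⟩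
    refine List.ext_getElem (by simp [hl]) fun l h₁ h₂ => ?_
    simp

/-- What is used of the isolation hypothesis. -/
theorem IsolationHypothesis.exists_polyTime (h : IsolationHypothesis) :
    ∃ (tm : Turing.FinTM2) (A : (m n : ℕ) → List (Fin n → ℕ)) (K : ℕ),
      (∀ Ω, PolyTime tm Ω fun p : ℕ × ℕ => (A p.1 p.2).map List.ofFn) ∧
      (∀ m n, (A m n).length ≤ (2 * m + 2 * n + 5) ^ K) ∧
      (∀ m n, ∀ w ∈ A m n, ∀ i, w i ≤ 2 * n) ∧
      ∀ (m n : ℕ) (C : BoolCircuit n m), C.setSystem.Nonempty →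
        ∃ w ∈ A m n, HasUniqueMinWeightSet w C.setSystem := by
  obtain ⟨A, ⟨M⟩, hA, hC⟩ := h
  have hpoly : ∀ Ω, PolyTime M.tm Ω fun p : ℕ × ℕ => (A p.1 p.2).map List.ofFn := fun Ω =>
    (PolyTime.call M Ω).parseWeights.congr fun p => parseWeights_encodeWeights (A p.1 p.2)
  -- The size of the output bounds the number of weight functions; the tree of `(m, n)` has `2 * m +
  -- 2 * n + 3` nodes.
  obtain ⟨K, hK⟩ := (hpoly Unit).size_le
  refine ⟨M.tm, A, K, hpoly, fun m n => ?_, fun m n w hw i => (hA m n w hw i).2, hC⟩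
  have h₁ := hK (m, n)
  have h₂ := TreeEncoding.length_lt_size ((A m n).map List.ofFn)
  rw [List.length_map] at h₂
  refine h₂.le.trans (h₁.trans (Nat.pow_le_pow_left ?_ K))
  simp only [TreeEncoding.size_prod, TreeEncoding.size_nat]
  omega

/-! ### The hard family and its explicitness -/

section HardFamily

variable (A : (m n : ℕ) → List (Fin n → ℕ)) (c : ℕ) (r : ℕ → ℕ)

/-- The words of the hard polynomial in `n` variables, when the weight functions are computed by
`A` and the prefixes have length `n / c`. -/
def hardFamily (n : ℕ) : List (List ℕ) :=
  hardWords n (n / c) r ((A (n ^ (n / c)) (n * n)).map List.ofFn)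

theorem mem_hardFamily {n : ℕ} : ∀ w ∈ hardFamily A c r n, w.length = n ∧ ∀ i ∈ w, i < n :=
  fun _ hw => mem_hardWords (Nat.div_le_self n c) hw

variable {A c r}

theorem PolyTime.hardFamily {tm : Turing.FinTM2} {Ω : Type}
    (hA : PolyTime tm Ω fun p : ℕ × ℕ => (A p.1 p.2).map List.ofFn) (hc : 0 < c)
    (hr : PolyTime tm Ω r) : PolyTime tm Ω fun n : PowerInput => hardFamily A c r n.val := by
  have hb : PolyTime tm Ω fun n : PowerInput => n.val / c :=
    (powerInput_val.div_mod (const c) fun _ => hc).fst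
  have hb' : ∀ n : PowerInput, n.val / c ≤ n.val := fun n => Nat.div_le_self _ _
  -- The circuit size, in unary, is obtained as the number of prefixes.
  have hm : PolyTime tm Ω fun n : PowerInput => n.val ^ (n.val / c) :=
    (allWords hb hb').length.congr fun n => length_allWords _ _
  exact hardWords hb hb' (r := fun _ => r) (hr.comp id.snd)
    (hA.comp (hm.pair (powerInput_val.mul powerInput_val)))

theorem isExplicit_hardFamily {F Γ : Type} [Field F] {enc : F → List Γ} {x y z : Γ} {pre : List ℕ}
    (hpre : (pre.map fun a => termLetter x y z (Fin.ofNat 8 a)) = (enc 1).map Sum.inl)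
    {tm : Turing.FinTM2}
    (hA : PolyTime tm (Γ ⊕ Punct) fun p : ℕ × ℕ => (A p.1 p.2).map List.ofFn) (hc : 0 < c)
    (hr : PolyTime tm (Γ ⊕ Punct) r) :
    IsExplicit enc fun n => ofTerms (wordTerms F n (hardFamily A c r n)) := by
  obtain ⟨k, M, hM⟩ := exists_computableInTime tm (termLetter x y z)
    ((PolyTime.hardFamily hA hc hr).termCodes pre)
  have e : (fun n => encodeTerms enc (wordTerms F n (hardFamily A c r n))) = fun n =>
      ((hardFamily A c r n).flatMap (termCodes pre)).map
        fun a => termLetter x y z (Fin.ofNat 8 a) :=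
    funext fun n => encodeTerms_wordTerms hpre fun w hw => (mem_hardFamily A c r w hw).2
  refine ⟨fun n => wordTerms F n (hardFamily A c r n), k, ?_⟩
  rw [e]
  exact ⟨M, fun n => rfl, hM⟩

end HardFamily

/-! ### Estimates -/

/-- The Boolean circuit has size polynomial in z = s + n + 2, and 22 is an exponent that suffices.
The bound z ^ 4 for the size of the field leaves room for a prime up to 4 (s + 2)². -/
theorem nodeCost_le {n k q z : ℕ} (hn : n + 2 ≤ z) (hk : k ≤ z) (hq : 0 < q) (hqz : q ≤ z ^ 4) :
    n * n + (k * BoolProg.nodeCost q (n + 1) + 1) ≤ z ^ 22 := by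
  have hz : 2 ≤ z := by omega
  have hz0 : 0 < z := by omega
  have h₁ : BoolProg.opCost q ≤ 3 * z ^ 12 := by
    have h : q * q + q * (q * q + 1) ≤ 3 * q ^ 3 := by
      have := Nat.mul_le_mul hq hq
      nlinarith [Nat.mul_le_mul_left (q * q) hq, Nat.mul_le_mul_left q this]
    refine h.trans (Nat.mul_le_mul_left 3 ?_)
    calc q ^ 3 ≤ (z ^ 4) ^ 3 := Nat.pow_le_pow_left hqz 3
      _ = z ^ 12 := by ring
  have h₂ : BoolProg.nodeCost q (n + 1) ≤ z * z * (2 + 2 * (z * (3 * z ^ 12))) := by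
    rw [BoolProg.nodeCost]
    gcongr <;> omega
  have h₃ : z * z * (2 + 2 * (z * (3 * z ^ 12))) ≤ 8 * z ^ 15 := by
    have : 1 ≤ z ^ 13 := Nat.one_le_pow _ _ hz0
    calc z * z * (2 + 2 * (z * (3 * z ^ 12))) = z * z * (2 + 6 * z ^ 13) := by ring
      _ ≤ z * z * (2 * z ^ 13 + 6 * z ^ 13) := by gcongr; omega
      _ = 8 * z ^ 15 := by ring
  have h₄ : k * BoolProg.nodeCost q (n + 1) ≤ z * (8 * z ^ 15) :=
    Nat.mul_le_mul hk (h₂.trans h₃)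
  have h₅ : n * n + 1 ≤ z ^ 16 := by
    have : z ^ 2 ≤ z ^ 16 := Nat.pow_le_pow_right hz0 (by norm_num)
    nlinarith
  have h₆ : 16 ≤ z ^ 4 := by
    calc 16 = 2 ^ 4 := by norm_num
      _ ≤ z ^ 4 := Nat.pow_le_pow_left hz 4
  have h₇ : z ^ 20 ≤ z ^ 22 := Nat.pow_le_pow_right hz0 (by norm_num)
  have h₈ : 16 * z ^ 16 ≤ z ^ 20 := by
    calc 16 * z ^ 16 ≤ z ^ 4 * z ^ 16 := Nat.mul_le_mul_right _ h₆
      _ = z ^ 20 := by ring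
  have h₉ : z * (8 * z ^ 15) = 8 * z ^ 16 := by ring
  omega

/-- The number of conditions is at most n ^ ((b + 3) K + 4). Here (K + 1) b is at most n / 2 and 3 K
+ 4 is less than n / 2, so the exponent is below n - b. -/
theorem length_mul_lt {K n b l : ℕ} (hb : 2 * (K + 1) * b ≤ n) (hn : 20 * (K + 1) ≤ n)
    (hl : l ≤ (2 * n ^ b + 2 * (n * n) + 5) ^ K) : l * (2 * (n * n) * n + 1) < n ^ (n - b) := by
  have h20 : 20 ≤ n := by nlinarith
  have h₁ : 2 * n ^ b + 2 * (n * n) + 5 ≤ n ^ (b + 3) := by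
    have h : 1 ≤ n ^ b := Nat.one_le_pow _ _ (by omega)
    have e : n ^ (b + 3) = n ^ b * n ^ 3 := pow_add ..
    have h' : 4 * n ^ 2 + 7 ≤ n ^ 3 := by nlinarith [sq_nonneg n, Nat.mul_le_mul h20 h20]
    rw [e]
    nlinarith [Nat.mul_le_mul_left (n ^ b) h']
  have h₂ : 2 * (n * n) * n + 1 ≤ n ^ 4 := by
    have : 20 * n ^ 3 ≤ n * n ^ 3 := Nat.mul_le_mul_right _ h20
    have h3 : 1 ≤ n ^ 3 := Nat.one_le_pow _ _ (by omega)
    have e₁ : n * n ^ 3 = n ^ 4 := by ring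
    have e₂ : 2 * (n * n) * n = 2 * n ^ 3 := by ring
    omega
  calc l * (2 * (n * n) * n + 1) ≤ (n ^ (b + 3)) ^ K * n ^ 4 :=
        Nat.mul_le_mul (hl.trans (Nat.pow_le_pow_left h₁ K)) h₂
    _ = n ^ ((b + 3) * K + 4) := by rw [← pow_mul, ← pow_add]
    _ < n ^ (n - b) := Nat.pow_lt_pow_right (by omega) (by
        have : 2 * (K + 1) * b = 2 * ((b + 3) * K + b) - 6 * K := by
          rw [show 2 * ((b + 3) * K + b) = 2 * (K + 1) * b + 6 * K by ring]; omega
        have e : (b + 3) * K = b * K + 3 * K := by ring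
        have e' : 2 * (K + 1) * b = 2 * (b * K) + 2 * b := by ring
        omega)

/-- A function whose logarithm is `o(n lg n)` is eventually smaller than any root of `n ^ n`. -/
theorem eventually_pow_le_pow_self {s : ℕ → ℕ}
    (hs : (fun n : ℕ => Real.logb 2 (s n)) =o[atTop] fun n : ℕ => (n : ℝ) * Real.logb 2 n)
    (e : ℕ) : ∀ᶠ n in atTop, s n ^ e ≤ n ^ n := by
  rcases Nat.eq_zero_or_pos e with rfl | he
  · filter_upwards [eventually_ge_atTop 1] with n hn
    rw [pow_zero]
    exact Nat.one_le_pow _ _ hn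
  have he' : (0 : ℝ) < e := by exact_mod_cast he
  filter_upwards [hs.def (inv_pos.2 he'), eventually_ge_atTop 1] with n hn hn1
  rcases Nat.eq_zero_or_pos (s n) with h0 | h0
  · rw [h0, zero_pow he.ne']
    exact Nat.zero_le _
  have hn1' : (1 : ℝ) ≤ n := by exact_mod_cast hn1
  have h0' : (0 : ℝ) < s n := by exact_mod_cast h0
  have hl : 0 ≤ (n : ℝ) * Real.logb 2 n :=
    mul_nonneg (Nat.cast_nonneg n) (Real.logb_nonneg one_lt_two hn1')
  rw [Real.norm_eq_abs, Real.norm_eq_abs, abs_of_nonneg hl] at hn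
  have h₁ : e * Real.logb 2 (s n) ≤ n * Real.logb 2 n := by
    have := (le_abs_self _).trans hn
    rwa [inv_mul_eq_div, le_div_iff₀' he'] at this
  have h₂ : Real.logb 2 ((s n : ℝ) ^ e) ≤ Real.logb 2 ((n : ℝ) ^ n) := by
    rwa [Real.logb_pow, Real.logb_pow]
  have h₃ := (Real.logb_le_logb one_lt_two (pow_pos h0' e) (by positivity)).1 h₂
  exact_mod_cast h₃

/-- For n ≥ c we have n ≤ 2 c (n / c) despite rounding, so it suffices to compare the (2 c)-th power
of the left side with n ^ n. There s n + n + 2 is at most n ^ 4 or (s n)², according to which of s n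
and n + 2 is larger. -/
theorem eventually_pow_le_pow_div {s : ℕ → ℕ}
    (hs : (fun n : ℕ => Real.logb 2 (s n)) =o[atTop] fun n : ℕ => (n : ℝ) * Real.logb 2 n)
    (e : ℕ) {c : ℕ} (hc : 0 < c) : ∀ᶠ n in atTop, (s n + n + 2) ^ e ≤ n ^ (n / c) := by
  filter_upwards [eventually_pow_le_pow_self hs (2 * (e * (2 * c))),
    eventually_ge_atTop (4 * (e * (2 * c)) + c + 2)] with n hn hnc
  have h₁ : n ≤ n / c * (2 * c) := by
    have h₁ := Nat.div_add_mod n c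
    have h₂ := Nat.mod_lt n hc
    have h₃ : 1 ≤ n / c := (Nat.one_le_div_iff hc).2 (by omega)
    have h₄ : c * 1 ≤ c * (n / c) := Nat.mul_le_mul_left c h₃
    have e : n / c * (2 * c) = 2 * (c * (n / c)) := by ring
    omega
  have h₂ : (s n + n + 2) ^ (e * (2 * c)) ≤ n ^ n := by
    rcases le_total (s n) (n + 2) with h | h
    · have : s n + n + 2 ≤ n ^ 4 := by
        have h2 : 2 ≤ n := by omega
        have : 8 * n ≤ n ^ 3 * n := Nat.mul_le_mul_right n (Nat.pow_le_pow_left h2 3)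
        have e : n ^ 4 = n ^ 3 * n := by ring
        omega
      calc (s n + n + 2) ^ (e * (2 * c)) ≤ (n ^ 4) ^ (e * (2 * c)) := Nat.pow_le_pow_left this _
        _ = n ^ (4 * (e * (2 * c))) := (pow_mul ..).symm
        _ ≤ n ^ n := Nat.pow_le_pow_right (by omega) (by omega)
    · have : s n + n + 2 ≤ s n ^ 2 := by nlinarith
      calc (s n + n + 2) ^ (e * (2 * c)) ≤ (s n ^ 2) ^ (e * (2 * c)) := Nat.pow_le_pow_left this _
        _ = s n ^ (2 * (e * (2 * c))) := (pow_mul ..).symm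
        _ ≤ n ^ n := hn
  refine (Nat.pow_le_pow_iff_left (n := 2 * c) (by omega)).1 ?_
  rw [← pow_mul, ← pow_mul]
  exact h₂.trans (Nat.pow_le_pow_right (by omega) h₁)

/-! ### Hardness over finite fields and over the rationals -/

/-- The hard words cannot be counted modulo `p` by a small arithmetic program over a small field of
characteristic `p`. -/
theorem not_lift_shiftMatrix_eq_countP {A : (m n : ℕ) → List (Fin n → ℕ)} {K : ℕ}
    (hlen : ∀ m n, (A m n).length ≤ (2 * m + 2 * n + 5) ^ K)
    (hA : ∀ m n, ∀ w ∈ A m n, ∀ i, w i ≤ 2 * n)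
    (hC : ∀ (m n : ℕ) (C : BoolCircuit n m), C.setSystem.Nonempty →
      ∃ w ∈ A m n, HasUniqueMinWeightSet w C.setSystem)
    (F : Type) [Field F] [Fintype F] {p : ℕ} [CharP F p]
    {r : ℕ → ℕ} {n s i k : ℕ} (hn : 20 * (K + 1) ≤ n)
    (hs : (s + n + 2) ^ 22 ≤ n ^ (n / (2 * (K + 1)))) (hF : Fintype.card F ≤ (s + n + 2) ^ 4)
    (hi : i < n ^ (n / (2 * (K + 1)))) (hr : r i + 1 = p) (hk : k ≤ s) (P : ArithProg F n k)
    (out : Fin k) : ¬ ∀ q, FreeAlgebra.lift F (fun i : Fin n => shiftMatrix F n q i) (P.eval out) 0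
      (Fin.last n) = ((hardFamily A (2 * (K + 1)) r n).countP (follows q 0) : F) := fun h =>
  lift_shiftMatrix_ne_countP F (Nat.div_le_self n _) hi hr (hA _ _) (hC _ _)
    (length_mul_lt (Nat.mul_div_le n _) hn (hlen _ _)) P out
    ((nodeCost_le (by omega) (by omega) Fintype.card_pos hF).trans hs) h

theorem eventually_not_hasCircuitOfSize_of_finite {A : (m n : ℕ) → List (Fin n → ℕ)} {K : ℕ}
    (hlen : ∀ m n, (A m n).length ≤ (2 * m + 2 * n + 5) ^ K)
    (hA : ∀ m n, ∀ w ∈ A m n, ∀ i, w i ≤ 2 * n)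
    (hC : ∀ (m n : ℕ) (C : BoolCircuit n m), C.setSystem.Nonempty →
      ∃ w ∈ A m n, HasUniqueMinWeightSet w C.setSystem)
    (F : Type) [Field F] [Finite F] {p : ℕ}
    [CharP F p] (hp : p ≠ 0) {s : ℕ → ℕ}
    (hs : (fun n : ℕ => Real.logb 2 (s n)) =o[atTop] fun n : ℕ => (n : ℝ) * Real.logb 2 n) :
    ∀ᶠ n in atTop, ¬ HasCircuitOfSize (encodeLetter : F → List F)
      (ofTerms (wordTerms F n (hardFamily A (2 * (K + 1)) (fun _ => p - 1) n))) (s n) := by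
  have := Fintype.ofFinite F
  filter_upwards [eventually_pow_le_pow_div hs 22 (show 0 < 2 * (K + 1) by omega),
    eventually_ge_atTop (20 * (K + 1)), eventually_ge_atTop (Fintype.card F)] with n h₁ h₂ h₃
  rintro ⟨k, P, out, hP, hk⟩
  -- All prefixes have the same modulus `p`, so any of them will do.
  refine not_lift_shiftMatrix_eq_countP hlen hA hC F h₂ h₁ ?_ (i := 0)
    (Nat.pow_pos (by omega)) (r := fun _ => p - 1) (p := p)
    (Nat.sub_add_cancel (Nat.pos_of_ne_zero hp))
    ((P.length_le_size fun c => List.cons_ne_nil _ _).trans hk) P out fun q => ?_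
  · exact (show Fintype.card F ≤ s n + n + 2 by omega).trans (Nat.le_self_pow (by norm_num) _)
  · rw [hP]
    exact lift_shiftMatrix_wordTerms F F q (mem_hardFamily _ _ _)

/-- The prime is chosen after the circuit. With `Nat.succ` the i-th prefix has modulus i + 2, and p
≤ (s n + n + 2) ^ 4 is at most the number of prefixes, so p - 2 is the index of a prefix with
modulus `p`. Composite moduli play no part in the argument. -/
theorem eventually_not_hasCircuitOfSize_rat {A : (m n : ℕ) → List (Fin n → ℕ)} {K : ℕ}
    (hlen : ∀ m n, (A m n).length ≤ (2 * m + 2 * n + 5) ^ K)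
    (hA : ∀ m n, ∀ w ∈ A m n, ∀ i, w i ≤ 2 * n)
    (hC : ∀ (m n : ℕ) (C : BoolCircuit n m), C.setSystem.Nonempty →
      ∃ w ∈ A m n, HasUniqueMinWeightSet w C.setSystem)
    {s : ℕ → ℕ}
    (hs : (fun n : ℕ => Real.logb 2 (s n)) =o[atTop] fun n : ℕ => (n : ℝ) * Real.logb 2 n) :
    ∀ᶠ n in atTop, ¬ HasCircuitOfSize encodeRat
      (ofTerms (wordTerms ℚ n (hardFamily A (2 * (K + 1)) Nat.succ n))) (s n) := by
  filter_upwards [eventually_pow_le_pow_div hs 22 (show 0 < 2 * (K + 1) by omega),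
    eventually_ge_atTop (20 * (K + 1))] with n h₁ h₂
  rintro ⟨k, P, out, hP, hk⟩
  obtain ⟨p, hp, hps, hpD⟩ := exists_prime_not_dvd P.denProd_pos
    (P.denProd_le.trans (Nat.pow_le_pow_right two_pos hk))
  have := Fact.mk hp
  obtain ⟨Q, hQ⟩ := exists_reduction_countP P hpD out (mem_hardFamily _ _ _) hP
  have hpz : p ≤ (s n + n + 2) ^ 4 := by
    have h : 2 ^ 2 * (s n + 2) ^ 2 ≤ (s n + n + 2) ^ 2 * (s n + n + 2) ^ 2 := by
      gcongr <;> omega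
    calc p ≤ _ := hps
      _ ≤ _ := h
      _ = (s n + n + 2) ^ 4 := by ring
  refine not_lift_shiftMatrix_eq_countP hlen hA hC (ZMod p) h₂ h₁ ?_ (i := p - 2) ?_ (p := p) ?_
    ((P.length_le_size fun c => List.cons_ne_nil _ _).trans hk) Q out hQ
  · rwa [ZMod.card]
  · have h₃ : (s n + n + 2) ^ 4 ≤ (s n + n + 2) ^ 22 :=
      Nat.pow_le_pow_right (by omega) (by norm_num)
    have := hp.two_le
    omega
  · have := hp.two_le
    omega

theorem theorem5 (h : IsolationHypothesis) :
    HasExplicitHardPolynomials ℚ encodeRat ∧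
    ∀ (F : Type) [Field F] [Finite F],
      HasExplicitHardPolynomials F (encodeLetter : F → List F) := by
  obtain ⟨tm, A, K, hpoly, hlen, hA, hC⟩ := h.exists_polyTime
  have hc : 0 < 2 * (K + 1) := by omega
  constructor
  · refine ⟨fun n => ofTerms (wordTerms ℚ n (hardFamily A (2 * (K + 1)) Nat.succ n)),
      -- The word of the rational number 1: sign bit, numerator 1, separator, denominator 1.
      isExplicit_hardFamily (x := some false) (y := some true) (z := none) (pre := [3, 4, 5, 4]) ?_
        (hpoly _) hc PolyTime.id.succ,
      fun n => isHomogeneousOfDegree_wordTerms (mem_hardFamily _ _ _),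
      fun s hs => eventually_not_hasCircuitOfSize_rat hlen hA hC hs⟩
    simp [encodeRat, Computability.encodeNat, Computability.encodeNum,
      Computability.encodePosNum, termLetter]
  · intro F _ _
    obtain ⟨p, hp⟩ := CharP.exists F
    have hp0 : p ≠ 0 := by
      have := CharP.char_is_prime F p
      exact this.ne_zero
    exact ⟨fun n => ofTerms (wordTerms F n (hardFamily A (2 * (K + 1)) (fun _ => p - 1) n)),
      isExplicit_hardFamily (x := 1) (y := 1) (z := 1) (pre := [3]) rfl (hpoly _) hc
        (PolyTime.const _),
      fun n => isHomogeneousOfDegree_wordTerms (mem_hardFamily _ _ _),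
      fun s hs => eventually_not_hasCircuitOfSize_of_finite hlen hA hC F hp0 hs⟩
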